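/- **Model.** Fix $1\ge p>q>r>0$, $\rho\in(0,1]$, $\pi_+,\pi_-\in(0,1)$ and $s_+,s_-\in[0,1]$. For each $n$, assign the vertices of $[n]$ independently, with probability $1/2$ each, to the blocks $B_1,B_2$. Given the blocks, let $G_1,G_2$ be $\rho$-correlated graphs on $[n]$: the pairs of edge indicators $(\mathbf 1_{u\sim_{G_1}v},\mathbf 1_{u\sim_{G_2}v})$ are independent over $\{u,v\}$; both entries are Bernoulli with parameter $p$ if $u,v\in B_1$, $q$ if $u,v\in B_2$, and $r$ otherwise, and they have correlation $\rho$ (they are equal to 1 if the parameter is 1). The vertices of interest are $V^*_n=B_1$. **Adversary $\mathcal A_n$.** Independently of $(G_1,G_2)$, put each vertex into $W_+$ independently with probability $\pi_+$, and each vertex outside $W_+$ into $W_-$ independently with probability $\pi_-$. The contaminated graph $G_2^{c}$ arises from $G_2$ as follows, independently over unordered pairs: a non-adjacent pair with one vertex in $W_+$ and the other in $[n]\setminus W_-$ is joined with probability $s_+$; an adjacent pair with one vertex in $W_-$ and the other in $[n]\setminus W_+$ is disconnected with probability $s_-$. All other pairs are unchanged. Given block labels and $W_\pm$, $G_2$ has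 2 and $G_2^c$ has 6 blocks. **Nomination and consistency.** A ranking rule maps $(g_1,\mathfrak o(g_2),V^*)$, with $\mathfrak o$ a relabelling of the vertices of $g_2$, to a total order of the relabelled vertices. A vertex nomination scheme is a ranking rule such that, for all $g_1,g_2,V^*$ and each orbit $I$ of the automorphism group of $g_2$, the set of ranks of $\mathfrak o(I)$ does not depend on $\mathfrak o$. If $N_k$ is the number of $v\in V^*$ for which $\mathfrak o(v)$ has rank at most $k$, the level-$k$ recall error is $\mathbb E[1-N_k/|V^*|]$ (the loss is $0$ if $V^*=\emptyset$), and the level-$k$ precision error is $\mathbb E[1-N_k/k]$. A sequence of ranking rules is level-$(k_n)$ recall (precision) consistent if, for every sequence of relabellings $\mathfrak o_n$, its level-$k_n$ recall (precision) error minus the smallest such error among all vertex nomination schemes tends to $0$. **The rule $\Phi_n$.** Let $\hat K_n$ be an estimator of the number of blocks with $\mathbb P(\hat K_n(G_2)=2)\to1$ and $\mathbb P(\hat K_n(G_2^c)=6)\to1$. Given the relabelled second graph $h$ with adjacency matrix $A$, put $K=\hat K_n(h)$, embed the vertices as the rows of $U S^{1/2}\in\mathbb R^{n\times K}$, where $S$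 is the diagonal matrix of the $K$ largest eigenvalues of $|A|=(A^TA)^{1/2}$ and the columns of $U$ are corresponding orthonormal eigenvectors (padded by zero columns if $K>n$), and cluster the rows by optimal $K$-means. $\Phi_n$ ranks first a nonempty cluster with the highest proportion of adjacent pairs among its pairs of distinct vertices, in a fixed but arbitrary order, and then all other vertices in a fixed but arbitrary order (the orders are orders of the labels that depend only on $n$; ties and non-unique choices in the clustering are resolved arbitrarily). **Lemma.** Let $k_n=\lfloor n/2\rfloor$. If $p-q<s_-$ or $\frac{p-q}{1-q}<s_+$, then $(\Phi_n)$ is level-$(k_n)$ recall and precision consistent for the uncontaminated sequence $(G_1,G_2)$, but is no longer consistent for the contaminated sequence $(G_1,G_2^{c})$: it is neither level-$(k_n)$ recall consistent nor level-$(k_n)$ precision consistent. -/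

import Mathlib

open Filter Topology

namespace VertexNomination

/-! ### Vertex nomination: rules, schemes, losses, consistency

Both graphs live on `Fin n` and all vertices are core vertices.  The obfuscating set is a copy of
`Fin n`, so that an obfuscating function is a permutation of `Fin n`. -/

/-- A rule assigns to the first graph, the obfuscated second graph and the vertices of interest
(in the first graph) a total ordering of the obfuscated vertices, written as the map from an
obfuscated vertex to its position; the position counts from `0`, so that rank = position + 1. -/
abbrev RankingRule (n : ℕ) : Type :=
  SimpleGraph (Fin n) → SimpleGraph (Fin n) → Finset (Fin n) → (Fin n ≃ Fin n)

/-- The obfuscated graph: the copy of `g` in which vertex `u` is called `o u`. -/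
def obfuscate {n : ℕ} (o : Equiv.Perm (Fin n)) (g : SimpleGraph (Fin n)) : SimpleGraph (Fin n) :=
  g.map o.toEmbedding

/-- The vertices of `g` that are topologically equivalent to `u`. -/
def orbit {n : ℕ} (g : SimpleGraph (Fin n)) (u : Fin n) : Set (Fin n) :=
  {w | ∃ σ : g ≃g g, σ u = w}

/-- The set of positions of (the obfuscated copies of) the vertices in `S`. -/
def rankSet {n : ℕ} (Φ : RankingRule n) (g₁ g₂ : SimpleGraph (Fin n)) (o : Equiv.Perm (Fin n))
    (V : Finset (Fin n)) (S : Set (Fin n)) : Set (Fin n) :=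
  (fun u => Φ g₁ (obfuscate o g₂) V (o u)) '' S

/-- The consistency property of a vertex nomination scheme: the set of ranks of every class of
topologically equivalent vertices does not depend on the obfuscating function. -/
def IsVNScheme {n : ℕ} (Φ : RankingRule n) : Prop :=
  ∀ (g₁ g₂ : SimpleGraph (Fin n)) (V : Finset (Fin n)) (o₁ o₂ : Equiv.Perm (Fin n)) (u : Fin n),
    rankSet Φ g₁ g₂ o₁ V (orbit g₂ u) = rankSet Φ g₁ g₂ o₂ V (orbit g₂ u)

/-- Level-`k` recall loss: the fraction of vertices of interest whose rank is at least `k + 1`. -/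
noncomputable def recallLoss {n : ℕ} (Φ : RankingRule n) (g₁ g₂ : SimpleGraph (Fin n))
    (o : Equiv.Perm (Fin n)) (V : Finset (Fin n)) (k : ℕ) : ℝ :=
  ((V.filter fun v => k ≤ (Φ g₁ (obfuscate o g₂) V (o v) : ℕ)).card : ℝ) / (V.card : ℝ)

/-- Level-`k` precision loss: the proportion of the `k` top ranks that are not taken by vertices
of interest. -/
noncomputable def precisionLoss {n : ℕ} (Φ : RankingRule n) (g₁ g₂ : SimpleGraph (Fin n))
    (o : Equiv.Perm (Fin n)) (V : Finset (Fin n)) (k : ℕ) : ℝ :=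
  1 - ((V.filter fun v => (Φ g₁ (obfuscate o g₂) V (o v) : ℕ) < k).card : ℝ) / (k : ℝ)

/-- A joint law of the two graphs and the vertices of interest, given by random variables on a
finite probability space. -/
structure NominationModel (n : ℕ) where
  Ω : Type
  [fintype : Fintype Ω]
  weight : Ω → ℝ
  weight_nonneg : ∀ ω, 0 ≤ weight ω
  sum_weight : ∑ ω, weight ω = 1
  G₁ : Ω → SimpleGraph (Fin n)
  G₂ : Ω → SimpleGraph (Fin n)
  voi : Ω → Finset (Fin n)

attribute [instance] NominationModel.fintype

/-- Expectation under a model. -/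
def NominationModel.expect {n : ℕ} (F : NominationModel n) (f : F.Ω → ℝ) : ℝ :=
  ∑ ω, F.weight ω * f ω

open Classical in
/-- Probability of an event under a model. -/
noncomputable def NominationModel.prob {n : ℕ} (F : NominationModel n) (E : F.Ω → Prop) : ℝ :=
  F.expect fun ω => if E ω then 1 else 0

/-- Level-`k` recall error. -/
noncomputable def recallError {n : ℕ} (F : NominationModel n) (Φ : RankingRule n)
    (o : Equiv.Perm (Fin n)) (k : ℕ) : ℝ :=
  F.expect fun ω => recallLoss Φ (F.G₁ ω) (F.G₂ ω) o (F.voi ω) k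

/-- Level-`k` precision error. -/
noncomputable def precisionError {n : ℕ} (F : NominationModel n) (Φ : RankingRule n)
    (o : Equiv.Perm (Fin n)) (k : ℕ) : ℝ :=
  F.expect fun ω => precisionLoss Φ (F.G₁ ω) (F.G₂ ω) o (F.voi ω) k

/-- The recall error of a Bayes optimal scheme. -/
noncomputable def bayesRecallError {n : ℕ} (F : NominationModel n)
    (o : Equiv.Perm (Fin n)) (k : ℕ) : ℝ :=
  ⨅ Ψ : {Ψ : RankingRule n // IsVNScheme Ψ}, recallError F Ψ.1 o k

/-- The precision error of a Bayes optimal scheme. -/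
noncomputable def bayesPrecisionError {n : ℕ} (F : NominationModel n)
    (o : Equiv.Perm (Fin n)) (k : ℕ) : ℝ :=
  ⨅ Ψ : {Ψ : RankingRule n // IsVNScheme Ψ}, precisionError F Ψ.1 o k

/-- Level-`(k n)` recall consistency, for every sequence of obfuscating functions. -/
def RecallConsistent (F : ∀ n, NominationModel n) (Φ : ∀ n, RankingRule n) (k : ℕ → ℕ) : Prop :=
  ∀ o : ∀ n, Equiv.Perm (Fin n),
    Tendsto (fun n => recallError (F n) (Φ n) (o n) (k n) - bayesRecallError (F n) (o n) (k n))
      atTop (𝓝 0)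

/-- Level-`(k n)` precision consistency, for every sequence of obfuscating functions. -/
def PrecisionConsistent (F : ∀ n, NominationModel n) (Φ : ∀ n, RankingRule n) (k : ℕ → ℕ) :
    Prop :=
  ∀ o : ∀ n, Equiv.Perm (Fin n),
    Tendsto
      (fun n => precisionError (F n) (Φ n) (o n) (k n) - bayesPrecisionError (F n) (o n) (k n))
      atTop (𝓝 0)

/-! ### The correlated two-block model and the contamination procedure -/

/-- Parameters of the two-block model and of the adversary. -/
structure Params where
  p : ℝ
  q : ℝ
  r : ℝ
  rho : ℝ
  piPlus : ℝ
  piMinus : ℝ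
  sPlus : ℝ
  sMinus : ℝ
  r_pos : 0 < r
  r_lt_q : r < q
  q_lt_p : q < p
  p_le_one : p ≤ 1
  rho_pos : 0 < rho
  rho_le_one : rho ≤ 1
  piPlus_mem : piPlus ∈ Set.Ioo (0 : ℝ) 1
  piMinus_mem : piMinus ∈ Set.Ioo (0 : ℝ) 1
  sPlus_mem : sPlus ∈ Set.Icc (0 : ℝ) 1
  sMinus_mem : sMinus ∈ Set.Icc (0 : ℝ) 1

/-- Block probability matrix `[[p, r], [r, q]]`. -/
def Params.B (θ : Params) (a b : Fin 2) : ℝ :=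
  if a = b then (if a = 0 then θ.p else θ.q) else θ.r

/-- Bernoulli weights. -/
def bern (a : ℝ) (x : Bool) : ℝ := if x then a else 1 - a

/-- The joint law of two Bernoulli(`a`) variables with correlation `ρ`. -/
def corrBern (a ρ : ℝ) (x y : Bool) : ℝ :=
  bern a x * bern a y + (if x = y then 1 else -1) * (ρ * a * (1 - a))

/-- The block (`0` for the first, `1` for the second) of a vertex, the coin that selects it for
`W₊`, and the coin that selects it for `W₋` in case it is not in `W₊`. -/
abbrev VertexState : Type := Fin 2 × Bool × Bool

/-- For an unordered pair of vertices: the two edge indicators, in the first and in the second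
graph, the coin for adding an edge, and the coin for deleting it. -/
abbrev PairState : Type := Bool × Bool × Bool × Bool

/-- The sample space.  The (independent) entries at the diagonal of `Sym2 (Fin n)` are not used. -/
abbrev Outcome (n : ℕ) : Type := (Fin n → VertexState) × (Sym2 (Fin n) → PairState)

noncomputable def Params.vertexWeight (θ : Params) (x : VertexState) : ℝ :=
  1 / 2 * bern θ.piPlus x.2.1 * bern θ.piMinus x.2.2

/-- Edge probability of an unordered pair, given the block membership function. -/
def Params.pairProb (θ : Params) {n : ℕ} (b : Fin n → Fin 2) : Sym2 (Fin n) → ℝ :=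
  Sym2.lift ⟨fun u v => θ.B (b u) (b v), fun u v => by
    by_cases h : b u = b v
    · simp [h]
    · simp [Params.B, h, Ne.symm h]⟩

/-- Law of the state of a pair whose edge probability is `a`. -/
def Params.pairWeight (θ : Params) (a : ℝ) (x : PairState) : ℝ :=
  corrBern a θ.rho x.1 x.2.1 * bern θ.sPlus x.2.2.1 * bern θ.sMinus x.2.2.2

noncomputable def Params.weight (θ : Params) {n : ℕ} (ω : Outcome n) : ℝ :=
  (∏ v, θ.vertexWeight (ω.1 v)) *
    ∏ e, θ.pairWeight (θ.pairProb (fun v => (ω.1 v).1) e) (ω.2 e)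

/-- The graph with the given edge indicators. -/
def graphOf {n : ℕ} (x : Sym2 (Fin n) → Bool) : SimpleGraph (Fin n) where
  Adj u v := u ≠ v ∧ x s(u, v) = true
  symm := ⟨fun u v h => ⟨h.1.symm, by rw [Sym2.eq_swap]; exact h.2⟩⟩
  loopless := ⟨fun _ h => h.1 rfl⟩

/-- The contaminated graph.  A non-adjacent pair with one vertex in `Wp` and the other one outside
`Wm` is joined if its coin `add` says so, and an adjacent pair with one vertex in `Wm` and the
other one outside `Wp` is disconnected if its coin `del` says so. -/
def contaminate {n : ℕ} (g : SimpleGraph (Fin n)) (Wp Wm : Set (Fin n))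
    (add del : Sym2 (Fin n) → Bool) : SimpleGraph (Fin n) where
  Adj u v := u ≠ v ∧
    ((g.Adj u v ∧ ¬(((u ∈ Wm ∧ v ∉ Wp) ∨ (v ∈ Wm ∧ u ∉ Wp)) ∧ del s(u, v) = true)) ∨
      (¬g.Adj u v ∧ ((u ∈ Wp ∧ v ∉ Wm) ∨ (v ∈ Wp ∧ u ∉ Wm)) ∧ add s(u, v) = true))
  symm := ⟨fun u v h => by
    rw [Sym2.eq_swap, g.adj_comm v u]
    exact ⟨h.1.symm, h.2.imp (fun h => ⟨h.1, fun h' => h.2 ⟨h'.1.symm, h'.2⟩⟩)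
      (fun h => ⟨h.1, h.2.1.symm, h.2.2⟩)⟩⟩
  loopless := ⟨fun _ h => h.1 rfl⟩

def firstGraph {n : ℕ} (ω : Outcome n) : SimpleGraph (Fin n) := graphOf fun e => (ω.2 e).1

def secondGraph {n : ℕ} (ω : Outcome n) : SimpleGraph (Fin n) := graphOf fun e => (ω.2 e).2.1

def plusSet {n : ℕ} (ω : Outcome n) : Set (Fin n) := {v | (ω.1 v).2.1 = true}

def minusSet {n : ℕ} (ω : Outcome n) : Set (Fin n) := {v | v ∉ plusSet ω ∧ (ω.1 v).2.2 = true}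

/-- The second graph after the attack. -/
def attackedGraph {n : ℕ} (ω : Outcome n) : SimpleGraph (Fin n) :=
  contaminate (secondGraph ω) (plusSet ω) (minusSet ω)
    (fun e => (ω.2 e).2.2.1) (fun e => (ω.2 e).2.2.2)

/-- The first block. -/
def firstBlock {n : ℕ} (ω : Outcome n) : Finset (Fin n) :=
  Finset.univ.filter fun v => (ω.1 v).1 = 0

theorem bern_nonneg {a : ℝ} (h₀ : 0 ≤ a) (h₁ : a ≤ 1) (x : Bool) : 0 ≤ bern a x := by
  cases x <;> simp [bern, h₀, h₁]

theorem corrBern_nonneg {a ρ : ℝ} (h₀ : 0 ≤ a) (h₁ : a ≤ 1) (k₀ : 0 ≤ ρ) (k₁ : ρ ≤ 1)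
    (x y : Bool) : 0 ≤ corrBern a ρ x y := by
  have h : 0 ≤ a * (1 - a) := mul_nonneg h₀ (by linarith)
  have h2 : 0 ≤ ρ * (a * (1 - a)) := mul_nonneg k₀ h
  have h3 : 0 ≤ (1 - ρ) * (a * (1 - a)) := mul_nonneg (by linarith) h
  cases x <;> cases y <;> simp [corrBern, bern] <;> nlinarith [sq_nonneg a, sq_nonneg (1 - a)]

theorem Params.pairProb_mem (θ : Params) {n : ℕ} (b : Fin n → Fin 2) (e : Sym2 (Fin n)) :
    0 ≤ θ.pairProb b e ∧ θ.pairProb b e ≤ 1 := by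
  induction e using Sym2.ind with
  | _ u v =>
    have h1 := θ.r_pos
    have h2 := θ.r_lt_q
    have h3 := θ.q_lt_p
    have h4 := θ.p_le_one
    simp only [Params.pairProb, Sym2.lift_mk, Params.B]
    split_ifs <;> constructor <;> linarith

theorem Params.weight_nonneg (θ : Params) {n : ℕ} (ω : Outcome n) : 0 ≤ θ.weight ω := by
  refine mul_nonneg (Finset.prod_nonneg fun v _ => ?_) (Finset.prod_nonneg fun e _ => ?_)
  · exact mul_nonneg
      (mul_nonneg (by norm_num) (bern_nonneg θ.piPlus_mem.1.le θ.piPlus_mem.2.le _))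
      (bern_nonneg θ.piMinus_mem.1.le θ.piMinus_mem.2.le _)
  · have h := θ.pairProb_mem (fun v => (ω.1 v).1) e
    exact mul_nonneg (mul_nonneg (corrBern_nonneg h.1 h.2 θ.rho_pos.le θ.rho_le_one _ _)
      (bern_nonneg θ.sPlus_mem.1 θ.sPlus_mem.2 _)) (bern_nonneg θ.sMinus_mem.1 θ.sMinus_mem.2 _)

theorem Params.sum_pairWeight (θ : Params) (a : ℝ) : ∑ x, θ.pairWeight a x = 1 := by
  simp [Fintype.sum_prod_type, Params.pairWeight, corrBern, bern]
  ring

theorem Params.sum_vertexWeight (θ : Params) : ∑ x, θ.vertexWeight x = 1 := by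
  simp [Fintype.sum_prod_type, Params.vertexWeight, bern]
  ring

theorem Params.sum_weight (θ : Params) (n : ℕ) : ∑ ω : Outcome n, θ.weight ω = 1 := by
  simp only [Fintype.sum_prod_type, Params.weight, ← Finset.mul_sum]
  have h (b : Fin n → Fin 2) : ∑ y : Sym2 (Fin n) → PairState,
      ∏ e, θ.pairWeight (θ.pairProb b e) (y e) = 1 := by
    rw [← Fintype.prod_sum fun e x => θ.pairWeight (θ.pairProb b e) x]
    simp [Params.sum_pairWeight]
  simp only [h, mul_one]
  rw [← Fintype.prod_sum fun (_ : Fin n) x => θ.vertexWeight x]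
  simp [Params.sum_vertexWeight]

/-- The correlated two-block model; the vertices of interest are those of the first block. -/
noncomputable def cleanModel (θ : Params) (n : ℕ) : NominationModel n where
  Ω := Outcome n
  weight := θ.weight
  weight_nonneg := θ.weight_nonneg
  sum_weight := θ.sum_weight n
  G₁ := firstGraph
  G₂ := secondGraph
  voi := firstBlock

/-- The same model with the second graph attacked by the adversary. -/
noncomputable def contaminatedModel (θ : Params) (n : ℕ) : NominationModel n where
  Ω := Outcome n
  weight := θ.weight
  weight_nonneg := θ.weight_nonneg
  sum_weight := θ.sum_weight n
  G₁ := firstGraph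
  G₂ := attackedGraph
  voi := firstBlock

/-! ### The spectral rule -/

/-- `X` is an adjacency spectral embedding of `A` into dimension `d`: `X = U S^(1/2)`, where `S`
holds the `d` largest eigenvalues of `|A| = (Aᵀ A)^(1/2)` and the columns of `U` are corresponding
orthonormal eigenvectors (padded with zero columns if `d > n`). -/
def IsASE {n d : ℕ} (A : Matrix (Fin n) (Fin n) ℝ) (X : Matrix (Fin n) (Fin d) ℝ) : Prop :=
  ∃ (M U : Matrix (Fin n) (Fin n) ℝ) (σ : Fin n → ℝ),
    M.PosSemidef ∧ M * M = A.transpose * A ∧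
    U ∈ Matrix.orthogonalGroup (Fin n) ℝ ∧ M = U * Matrix.diagonal σ * U.transpose ∧
    Antitone σ ∧
    ∀ i j, X i j = if h : (j : ℕ) < n then U i ⟨j, h⟩ * Real.sqrt (σ ⟨j, h⟩) else 0

/-- Sum of squared distances of the rows of `X` to the centers that the labels assign to them. -/
def kMeansCost {n d : ℕ} (X : Matrix (Fin n) (Fin d) ℝ) (label : Fin n → ℕ)
    (center : ℕ → Fin d → ℝ) : ℝ :=
  ∑ i, ∑ j, (X i j - center (label i) j) ^ 2

/-- `label` is an optimal `K`-means clustering of the rows of `X`. -/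
def IsKMeans {n d : ℕ} (K : ℕ) (X : Matrix (Fin n) (Fin d) ℝ) (label : Fin n → ℕ) : Prop :=
  (∀ i, label i < K) ∧ ∃ center : ℕ → Fin d → ℝ,
    ∀ (label' : Fin n → ℕ) (center' : ℕ → Fin d → ℝ), (∀ i, label' i < K) →
      kMeansCost X label center ≤ kMeansCost X label' center'

/-- The cluster of vertex `i`. -/
def cluster {n : ℕ} (label : Fin n → ℕ) (i : Fin n) : Finset (Fin n) :=
  Finset.univ.filter fun j => label j = label i

open Classical in
/-- The proportion of adjacent pairs among the pairs of distinct vertices of `T`. -/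
noncomputable def withinDensity {n : ℕ} (h : SimpleGraph (Fin n)) (T : Finset (Fin n)) : ℝ :=
  (((T ×ˢ T).filter fun e => h.Adj e.1 e.2).card : ℝ) / ((T.card : ℝ) * ((T.card : ℝ) - 1))

open Classical in
/-- `T` is a cluster with the highest within-cluster edge density in a spectral clustering of `h`
into `K` clusters: `K`-means for the adjacency spectral embedding into dimension `K`. -/
def IsTopSpectralCluster {n : ℕ} (K : ℕ) (h : SimpleGraph (Fin n)) (T : Finset (Fin n)) : Prop :=
  ∃ (X : Matrix (Fin n) (Fin K) ℝ) (label : Fin n → ℕ) (i₀ : Fin n),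
    IsASE (h.adjMatrix ℝ) X ∧ IsKMeans K X label ∧ T = cluster label i₀ ∧
    ∀ i, withinDensity h (cluster label i) ≤ withinDensity h T

/-- Sorting key: first `T` in the order `τ`, then the complement of `T` in the order `τ'`. -/
def sortKey {n : ℕ} (T : Finset (Fin n)) (τ τ' : Equiv.Perm (Fin n)) (w : Fin n) :
    Fin 2 ×ₗ Fin n :=
  if w ∈ T then toLex (0, τ w) else toLex (1, τ' w)

theorem sortKey_injective {n : ℕ} (T : Finset (Fin n)) (τ τ' : Equiv.Perm (Fin n)) :
    Function.Injective (sortKey T τ τ') := by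
  intro w w' h
  unfold sortKey at h
  split_ifs at h
  · exact τ.injective (by simpa using h)
  · simp at h
  · simp at h
  · exact τ'.injective (by simpa using h)

/-- The ordering that ranks `T` first, in the order `τ`, and the other vertices after it, in the
order `τ'`. -/
noncomputable def groupFirst {n : ℕ} (T : Finset (Fin n)) (τ τ' : Equiv.Perm (Fin n)) :
    Fin n ≃ Fin n :=
  (@monoEquivOfFin (Fin n) _ (LinearOrder.lift' (sortKey T τ τ') (sortKey_injective T τ τ')) n
    (Fintype.card_fin n)).toEquiv.symm

theorem monoEquivOfFin_symm_lt_iff {α : Type} [Fintype α] [LinearOrder α] {k : ℕ}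
    (h : Fintype.card α = k) (x y : α) :
    (monoEquivOfFin α h).toEquiv.symm x < (monoEquivOfFin α h).toEquiv.symm y ↔ x < y :=
  OrderIso.lt_iff_lt (monoEquivOfFin α h).symm

theorem groupFirst_lt_iff {n : ℕ} (T : Finset (Fin n)) (τ τ' : Equiv.Perm (Fin n))
    (w w' : Fin n) :
    groupFirst T τ τ' w < groupFirst T τ τ' w' ↔ sortKey T τ τ' w < sortKey T τ τ' w' := by
  exact @monoEquivOfFin_symm_lt_iff (Fin n) _
    (LinearOrder.lift' (sortKey T τ τ') (sortKey_injective T τ τ')) n (Fintype.card_fin n) w w'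

/-- The rule that clusters the obfuscated second graph spectrally into `K` clusters, nominates a
cluster of highest within-cluster edge density first and then all other vertices, both in a fixed
but arbitrary order.  The choices that the spectral clustering leaves open are arbitrary. -/
def IsSpectralRule {n : ℕ} (K : SimpleGraph (Fin n) → ℕ) (Φ : RankingRule n) : Prop :=
  ∃ τ τ' : Equiv.Perm (Fin n), ∀ h : SimpleGraph (Fin n), ∃ T : Finset (Fin n),
    IsTopSpectralCluster (K h) h T ∧ ∀ g₁ V, Φ g₁ h V = groupFirst T τ τ'

end VertexNomination

/-! In both models the smallest possible errors tend to 0, so consistency of a rule means that its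
own errors tend to 0. It remains to see what the spectral rule does on either graph.

Bayes errors. Since the first block is given, the edge indicators of G₁ can be centred, and a
permutation σ is scored by the sum over pairs e of (1[e ∈ G₁] − P(e)) · 1[σ(e) ∈ second graph].
Pairs moved by σ have mean zero; fixed pairs contribute their covariance, which stays nonnegative
under the attack. Every vertex has linearly many partners in the other block to which its edges are
never altered (W₊ against W₋, the rest against the rest), each with covariance ρr(1−r) > 0. Hence a
moved vertex costs order n in the mean (`card_moved_le`). Bounded differences give tails exp(−κn²),
which beat the n! permutations (`whp_score`), so the best match is correct at all but o(n) vertices.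
Passing to canonical representatives turns this matching rule into a scheme (`exists_isVNScheme`).

Spectral clustering. Adjacency matrix minus block mean has operator norm o(n), by a fourth moment
bound (`whp_opBound`). If the block matrix has distinct rows, optimal K-means then recovers the
types of all but o(n) vertices, without any eigengap, and the top cluster is close to a type class
of almost maximal density (`exists_spectral_threshold`). In the uncontaminated graph this class is
the first block because p > q, and its size is about n/2, the level.

Contamination. A positive attack rate makes the six rows distinct. The top cluster is now close to
one of six classes and misses a linear part of its block, so it has at most n/2 − cn/2 vertices. The
next positions follow an order fixed in advance. Among its first ⌊cn/2⌋ labels a constant proportion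
lies in the second block and in W₋, a class that is not the top one because its density is at most q
< p. These vertices waste linearly many of the first ⌊n/2⌋ ranks (`whp_contaminated_losses`). -/

namespace VertexNomination

/-! ### Expectations over finite products -/

section Product

variable {ι S : Type*} [Fintype ι] [DecidableEq ι] [Fintype S]

/-- Expectation of `f` under the product of the weights `w i`. -/
def prodExpect (w : ι → S → ℝ) (f : (ι → S) → ℝ) : ℝ :=
  ∑ x, (∏ i, w i (x i)) * f x

/-- Average of `f` over the coordinate `e`. -/
def coordAverage (w : ι → S → ℝ) (e : ι) (f : (ι → S) → ℝ) (x : ι → S) : ℝ :=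
  ∑ s, w e s * f (Function.update x e s)

/-- Exchanging a coordinate with an independent copy preserves the joint weight. The product form
avoids dividing by weights that may vanish. -/
theorem prod_update_mul (w : ι → S → ℝ) (e : ι) (x : ι → S) (s : S) :
    (∏ i, w i (Function.update x e s i)) * w e (x e) = (∏ i, w i (x i)) * w e s := by
  rw [← Finset.mul_prod_erase _ _ (Finset.mem_univ e),
    ← Finset.mul_prod_erase _ (fun i => w i (x i)) (Finset.mem_univ e)]
  have h : ∏ i ∈ Finset.univ.erase e, w i (Function.update x e s i)
      = ∏ i ∈ Finset.univ.erase e, w i (x i) := by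
    refine Finset.prod_congr rfl fun i hi => ?_
    rw [Function.update_of_ne (Finset.ne_of_mem_erase hi)]
  rw [h, Function.update_self]
  ring

/-- Resampling one coordinate preserves the law: swapping it with its independent copy is a
weight-preserving involution of `(ι → S) × S`. -/
theorem prodExpect_coordAverage {w : ι → S → ℝ} (hw : ∀ i, ∑ s, w i s = 1) (e : ι)
    (f : (ι → S) → ℝ) : prodExpect w (coordAverage w e f) = prodExpect w f := by
  let swap : (ι → S) × S ≃ (ι → S) × S :=
    { toFun := fun a => (Function.update a.1 e a.2, a.1 e)
      invFun := fun a => (Function.update a.1 e a.2, a.1 e)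
      left_inv := fun a => by simp
      right_inv := fun a => by simp }
  have h1 : prodExpect w (coordAverage w e f) =
      ∑ a : (ι → S) × S, (∏ i, w i (a.1 i)) * w e a.2 * f (Function.update a.1 e a.2) := by
    simp only [prodExpect, coordAverage, Finset.mul_sum, Fintype.sum_prod_type, mul_assoc]
  have h2 : prodExpect w f =
      ∑ a : (ι → S) × S, (∏ i, w i (a.1 i)) * w e a.2 * f a.1 := by
    simp only [prodExpect, Fintype.sum_prod_type]
    refine Finset.sum_congr rfl fun x _ => ?_
    rw [← Finset.sum_mul, ← Finset.mul_sum, hw, mul_one]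
  rw [h1, h2]
  refine Fintype.sum_equiv swap _ _ fun a => ?_
  simp only [swap, Equiv.coe_fn_mk, prod_update_mul]

theorem prodExpect_const {w : ι → S → ℝ} (hw : ∀ i, ∑ s, w i s = 1) (c : ℝ) :
    prodExpect w (fun _ => c) = c := by
  rw [prodExpect, ← Finset.sum_mul, ← Fintype.prod_sum fun i s => w i s]
  simp [hw]

theorem prodExpect_mono {w : ι → S → ℝ} (hw : ∀ i s, 0 ≤ w i s) {f g : (ι → S) → ℝ}
    (h : ∀ x, f x ≤ g x) : prodExpect w f ≤ prodExpect w g :=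
  Finset.sum_le_sum fun x _ =>
    mul_le_mul_of_nonneg_left (h x) (Finset.prod_nonneg fun i _ => hw i _)

theorem prodExpect_sum {κ : Type*} (w : ι → S → ℝ) (s : Finset κ) (f : κ → (ι → S) → ℝ) :
    prodExpect w (fun x => ∑ k ∈ s, f k x) = ∑ k ∈ s, prodExpect w (f k) := by
  simp only [prodExpect, Finset.mul_sum]
  exact Finset.sum_comm

theorem prodExpect_const_mul (w : ι → S → ℝ) (c : ℝ) (f : (ι → S) → ℝ) :
    prodExpect w (fun x => c * f x) = c * prodExpect w f := by
  simp only [prodExpect, Finset.mul_sum]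
  exact Finset.sum_congr rfl fun x _ => by ring

theorem prodExpect_coord {w : ι → S → ℝ} (hw : ∀ i, ∑ s, w i s = 1) (e : ι) (φ : S → ℝ) :
    prodExpect w (fun x => φ (x e)) = ∑ s, w e s * φ s := by
  rw [← prodExpect_coordAverage hw e]
  have h : coordAverage w e (fun x => φ (x e)) = fun _ => ∑ s, w e s * φ s := by
    funext x
    simp only [coordAverage, Function.update_self]
  rw [h, prodExpect_const hw]

/-- A centred function of one coordinate is orthogonal to every function of the others. -/
theorem prodExpect_mul_eq_zero {w : ι → S → ℝ} (hw : ∀ i, ∑ s, w i s = 1) {e : ι} {φ : S → ℝ}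
    (hφ : ∑ s, w e s * φ s = 0) {g : (ι → S) → ℝ}
    (hg : ∀ x s, g (Function.update x e s) = g x) :
    prodExpect w (fun x => φ (x e) * g x) = 0 := by
  rw [← prodExpect_coordAverage hw e]
  have h : coordAverage w e (fun x => φ (x e) * g x) = fun _ => 0 := by
    funext x
    simp only [coordAverage, Function.update_self, hg, ← mul_assoc]
    rw [← Finset.sum_mul, hφ, zero_mul]
  rw [h, prodExpect_const hw]

/-- The linear term will vanish when a centred variable is averaged. For |x| ≤ 1 this is e^x ≤ 1 + x
+ x²; outside, crude bounds suffice. -/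
theorem exp_le_add_exp_sq (x : ℝ) : Real.exp x ≤ x + Real.exp (x ^ 2) := by
  rcases le_or_gt x 1 with h | h
  · rcases le_or_gt (-1) x with h' | h'
    · have h1 := Real.abs_exp_sub_one_sub_id_le (abs_le.2 ⟨h', h⟩)
      have h2 := Real.add_one_le_exp (x ^ 2)
      linarith [(abs_le.1 h1).2]
    · have h1 := Real.add_one_le_exp (x ^ 2)
      have h2 : Real.exp x ≤ 1 := Real.exp_le_one_iff.2 (by linarith)
      nlinarith
  · have h1 : Real.exp x ≤ Real.exp (x ^ 2) := Real.exp_le_exp.2 (by nlinarith)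
    linarith

/-- A function deviates from its mean `m` by at most its oscillation. Apply `exp_le_add_exp_sq` to
`l * (f s - m)` and average. The constant in the exponent is not Hoeffding's, which is irrelevant
here. -/
theorem sum_exp_le {w f : S → ℝ} (hw0 : ∀ s, 0 ≤ w s) (hw : ∑ s, w s = 1) {c : ℝ}
    (hf : ∀ s s', |f s - f s'| ≤ c) (l : ℝ) :
    ∑ s, w s * Real.exp (l * f s) ≤
      Real.exp (l ^ 2 * c ^ 2) * Real.exp (l * ∑ s, w s * f s) := by
  set m := ∑ s, w s * f s with hm
  have hdev : ∀ s, |f s - m| ≤ c := by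
    intro s
    have h1 : f s - m = ∑ s', w s' * (f s - f s') := by
      simp only [mul_sub, Finset.sum_sub_distrib, ← Finset.sum_mul, hw, one_mul, hm]
    rw [h1]
    calc |∑ s', w s' * (f s - f s')| ≤ ∑ s', |w s' * (f s - f s')| :=
          Finset.abs_sum_le_sum_abs _ _
      _ ≤ ∑ s', w s' * c := Finset.sum_le_sum fun s' _ => by
          rw [abs_mul, abs_of_nonneg (hw0 s')]
          exact mul_le_mul_of_nonneg_left (hf s s') (hw0 s')
      _ = c := by rw [← Finset.sum_mul, hw, one_mul]
  have h2 : ∀ s, Real.exp (l * f s) ≤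
      Real.exp (l * m) * (l * (f s - m) + Real.exp (l ^ 2 * c ^ 2)) := by
    intro s
    have h3 : Real.exp (l * f s) = Real.exp (l * m) * Real.exp (l * (f s - m)) := by
      rw [← Real.exp_add]; ring_nf
    rw [h3]
    refine mul_le_mul_of_nonneg_left ?_ (Real.exp_pos _).le
    refine (exp_le_add_exp_sq _).trans (add_le_add_right (Real.exp_le_exp.2 ?_) _)
    rw [mul_pow]
    exact mul_le_mul_of_nonneg_left (sq_le_sq' (by linarith [(abs_le.1 (hdev s)).1])
      (abs_le.1 (hdev s)).2) (sq_nonneg l)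
  calc ∑ s, w s * Real.exp (l * f s)
      ≤ ∑ s, w s * (Real.exp (l * m) * (l * (f s - m) + Real.exp (l ^ 2 * c ^ 2))) :=
        Finset.sum_le_sum fun s _ => mul_le_mul_of_nonneg_left (h2 s) (hw0 s)
    _ = Real.exp (l * m) * (l * (∑ s, w s * f s - (∑ s, w s) * m)
          + (∑ s, w s) * Real.exp (l ^ 2 * c ^ 2)) := by
        generalize Real.exp (l * m) = a
        generalize Real.exp (l ^ 2 * c ^ 2) = b
        rw [Finset.sum_mul, Finset.sum_mul, ← Finset.sum_sub_distrib, Finset.mul_sum,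
          ← Finset.sum_add_distrib, Finset.mul_sum]
        exact Finset.sum_congr rfl fun s _ => by ring
    _ = _ := by rw [hw, ← hm]; ring

/-- Exponential moment bound for functions with bounded differences. -/
theorem prodExpect_exp_le {w : ι → S → ℝ} (hw0 : ∀ i s, 0 ≤ w i s) (hw : ∀ i, ∑ s, w i s = 1)
    {c : ℝ} (l : ℝ) (J : Finset ι) : ∀ f : (ι → S) → ℝ,
      (∀ x i s s', |f (Function.update x i s) - f (Function.update x i s')| ≤ c) →
      (∀ i ∉ J, ∀ x s, f (Function.update x i s) = f x) →
      prodExpect w (fun x => Real.exp (l * f x)) ≤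
        Real.exp (J.card * (l ^ 2 * c ^ 2)) * Real.exp (l * prodExpect w f) := by
  -- `J` contains the coordinates on which `f` depends. Averaging over one of them keeps the mean
  -- and the bounded differences, removes it from `J`, and costs a factor exp(l²c²).
  induction J using Finset.induction_on with
  | empty =>
    intro f _ hf
    have hconst : ∀ x y, f x = f y := by
      intro x y
      have key : ∀ A : Finset ι, f (A.piecewise x y) = f y := by
        intro A
        induction A using Finset.induction_on with
        | empty => simp
        | insert a A _ ih => rw [Finset.piecewise_insert, hf a (by simp), ih]
      simpa using key Finset.univ
    rcases isEmpty_or_nonempty (ι → S) with hS | ⟨⟨x₀⟩⟩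
    · have := prodExpect_const hw (1 : ℝ)
      simp [prodExpect] at this
    · have h1 : f = fun _ => f x₀ := funext fun x => hconst x x₀
      rw [h1, prodExpect_const hw, prodExpect_const hw]
      simp
  | insert e J he ih =>
    intro f hc hf
    have hcomm : ∀ (x : ι → S) (i : ι), i ≠ e → ∀ s s', Function.update (Function.update x i s) e s'
        = Function.update (Function.update x e s') i s := fun x i hi s s' =>
      Function.update_comm hi s s' x
    have hself : ∀ x s, coordAverage w e f (Function.update x e s) = coordAverage w e f x := by
      intro x s; simp [coordAverage]
    have hnonneg : 0 ≤ c ∨ IsEmpty (ι → S) := by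
      rcases isEmpty_or_nonempty (ι → S) with hS | ⟨⟨x₀⟩⟩
      · exact Or.inr hS
      · exact Or.inl ((abs_nonneg _).trans (hc x₀ e (x₀ e) (x₀ e)))
    have h1 := ih (coordAverage w e f) (by
      intro x i s s'
      by_cases hi : i = e
      · subst hi
        rw [hself, hself, sub_self, abs_zero]
        exact hnonneg.resolve_right fun h => h.elim x
      · simp only [coordAverage, ← Finset.sum_sub_distrib, ← mul_sub]
        calc _ ≤ ∑ a, |w e a * (f (Function.update (Function.update x i s) e a)
                - f (Function.update (Function.update x i s') e a))| :=
              Finset.abs_sum_le_sum_abs _ _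
          _ ≤ ∑ a, w e a * c := Finset.sum_le_sum fun a _ => by
              rw [abs_mul, abs_of_nonneg (hw0 e a), hcomm x i hi, hcomm x i hi]
              exact mul_le_mul_of_nonneg_left (hc _ _ _ _) (hw0 e a)
          _ = c := by rw [← Finset.sum_mul, hw, one_mul]) (by
      intro i hi x s
      by_cases hie : i = e
      · rw [hie, hself]
      · simp only [coordAverage]
        refine Finset.sum_congr rfl fun a _ => ?_
        rw [hcomm x i hie, hf i (by simp [hie, hi])])
    rw [prodExpect_coordAverage hw] at h1
    rw [← prodExpect_coordAverage hw e (fun x => Real.exp (l * f x))]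
    calc prodExpect w (coordAverage w e fun x => Real.exp (l * f x))
        ≤ prodExpect w (fun x => Real.exp (l ^ 2 * c ^ 2) *
            Real.exp (l * coordAverage w e f x)) := prodExpect_mono hw0 fun x =>
          sum_exp_le (hw0 e) (hw e) (fun s s' => hc x e s s') l
      _ ≤ Real.exp (l ^ 2 * c ^ 2) * (Real.exp (J.card * (l ^ 2 * c ^ 2))
            * Real.exp (l * prodExpect w f)) := by
          rw [prodExpect_const_mul]
          exact mul_le_mul_of_nonneg_left h1 (Real.exp_pos _).le
      _ = _ := by
          rw [Finset.card_insert_of_notMem he, ← mul_assoc, ← Real.exp_add]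
          push_cast
          ring_nf

-- Markov's inequality for exp(l f); `l` stays free and is tuned in each application.
open Classical in
theorem prodExpect_upper_tail {w : ι → S → ℝ} (hw0 : ∀ i s, 0 ≤ w i s)
    (hw : ∀ i, ∑ s, w i s = 1) {c : ℝ} (f : (ι → S) → ℝ)
    (hc : ∀ x i s s', |f (Function.update x i s) - f (Function.update x i s')| ≤ c)
    {l : ℝ} (hl : 0 ≤ l) (t : ℝ) :
    prodExpect w (fun x => if t < f x - prodExpect w f then 1 else 0) ≤
      Real.exp (Fintype.card ι * (l ^ 2 * c ^ 2) - l * t) := by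
  have h1 := prodExpect_exp_le hw0 hw l Finset.univ f hc (by simp)
  have h2 : prodExpect w (fun x => if t < f x - prodExpect w f then 1 else 0) ≤
      prodExpect w (fun x => Real.exp (-l * t - l * prodExpect w f) * Real.exp (l * f x)) := by
    refine prodExpect_mono hw0 fun x => ?_
    rw [← Real.exp_add]
    split_ifs with h
    · exact Real.one_le_exp (by nlinarith)
    · exact (Real.exp_pos _).le
  refine h2.trans ?_
  rw [prodExpect_const_mul]
  refine (mul_le_mul_of_nonneg_left h1 (Real.exp_pos _).le).trans_eq ?_
  rw [← Real.exp_add, ← Real.exp_add, Finset.card_univ]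
  ring_nf

open Classical in
/-- Bounded differences inequality. -/
theorem prodExpect_tail {w : ι → S → ℝ} (hw0 : ∀ i s, 0 ≤ w i s)
    (hw : ∀ i, ∑ s, w i s = 1) {c : ℝ} (f : (ι → S) → ℝ)
    (hc : ∀ x i s s', |f (Function.update x i s) - f (Function.update x i s')| ≤ c)
    {l : ℝ} (hl : 0 ≤ l) (t : ℝ) :
    prodExpect w (fun x => if t < |f x - prodExpect w f| then 1 else 0) ≤
      2 * Real.exp (Fintype.card ι * (l ^ 2 * c ^ 2) - l * t) := by
  have h1 := prodExpect_upper_tail hw0 hw f hc hl t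
  have h2 := prodExpect_upper_tail hw0 hw (fun x => -1 * f x) (c := c) (by
    intro x i s s'
    rw [← mul_sub, abs_mul]
    simpa using hc x i s s') hl t
  rw [prodExpect_const_mul] at h2
  have h3 : prodExpect w (fun x => if t < |f x - prodExpect w f| then 1 else 0) ≤
      prodExpect w (fun x => ∑ b : Bool, if b then (if t < f x - prodExpect w f then 1 else 0)
        else (if t < -1 * f x - -1 * prodExpect w f then (1 : ℝ) else 0)) := by
    refine prodExpect_mono hw0 fun x => ?_
    simp only [Fintype.sum_bool, if_true, Bool.false_eq_true, if_false]
    split_ifs with ha hb hc hc <;> try norm_num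
    exact absurd ((lt_abs.1 ha).resolve_left hb) (by intro h; exact hc (by linarith))
  rw [prodExpect_sum] at h3
  simp only [Fintype.sum_bool, if_true, Bool.false_eq_true, if_false] at h3
  linarith

end Product

end VertexNomination

namespace VertexNomination

open Matrix

/-! ### Spectral decomposition of the absolute value of a symmetric matrix -/

/-- The `u k` form an orthonormal basis of eigenvectors of `|A|`, with decreasing eigenvalues. -/
structure AbsEigenbasis {n : ℕ} (A : Matrix (Fin n) (Fin n) ℝ) (u : Fin n → Fin n → ℝ)
    (σ : Fin n → ℝ) : Prop where
  symm : Aᵀ = A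
  orth : ∀ k l, u k ⬝ᵥ u l = if k = l then 1 else 0
  complete : ∀ x : Fin n → ℝ, x = ∑ k, (u k ⬝ᵥ x) • u k
  sq : ∀ k, A *ᵥ (A *ᵥ u k) = σ k ^ 2 • u k
  nonneg : ∀ k, 0 ≤ σ k
  anti : Antitone σ

/-- The columns of `U` diagonalise `|A|`, hence `A²` with eigenvalues `σ k ^ 2`. They need not be
eigenvectors of `A` itself: eigenvalues of opposite sign may be mixed. -/
theorem IsASE.exists_eigenbasis {n d : ℕ} {A : Matrix (Fin n) (Fin n) ℝ} (hA : Aᵀ = A)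
    {X : Matrix (Fin n) (Fin d) ℝ} (h : IsASE A X) :
    ∃ u σ, AbsEigenbasis A u σ ∧
      ∀ i j, X i j = if h : (j : ℕ) < n then u ⟨j, h⟩ i * Real.sqrt (σ ⟨j, h⟩) else 0 := by
  obtain ⟨M, U, σ, hM, hMA, hU, hMU, hσ, hX⟩ := h
  have h1 : Uᵀ * U = 1 := (Matrix.mem_orthogonalGroup_iff' (Fin n) ℝ).1 hU
  have h2 : U * Uᵀ = 1 := (Matrix.mem_orthogonalGroup_iff (Fin n) ℝ).1 hU
  have horth : ∀ k l, Uᵀ k ⬝ᵥ Uᵀ l = if k = l then 1 else 0 := by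
    intro k l
    have := congrFun (congrFun h1 k) l
    rw [Matrix.one_apply] at this
    rw [← this]
    rfl
  have hMu : ∀ k, M *ᵥ Uᵀ k = σ k • Uᵀ k := by
    intro k
    have h3 : Uᵀ *ᵥ (Uᵀ k) = Pi.single k 1 := by
      funext l
      rw [Matrix.mulVec, horth, Pi.single_apply]
    rw [hMU, ← Matrix.mulVec_mulVec, h3, ← Matrix.mulVec_mulVec]
    funext i
    rw [Matrix.mulVec, dotProduct, Finset.sum_eq_single k]
    · simp [Matrix.mulVec_diagonal, mul_comm]
    · intro b _ hb
      simp [Matrix.mulVec_diagonal, hb]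
    · simp
  refine ⟨Uᵀ, σ, ⟨hA, horth, ?_, ?_, ?_, hσ⟩, hX⟩
  · intro x
    have h4 : x = U *ᵥ (Uᵀ *ᵥ x) := by rw [Matrix.mulVec_mulVec, h2, Matrix.one_mulVec]
    conv_lhs => rw [h4]
    funext i
    simp [Matrix.mulVec, dotProduct, mul_comm]
  · intro k
    rw [Matrix.mulVec_mulVec]
    nth_rewrite 1 [← hA]
    rw [← hMA, ← Matrix.mulVec_mulVec, hMu, Matrix.mulVec_smul, hMu, smul_smul, sq]
  · intro k
    have h5 := hM.dotProduct_mulVec_nonneg (Uᵀ k)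
    rw [hMu, star_trivial, dotProduct_smul, horth] at h5
    simpa using h5

namespace AbsEigenbasis

variable {n : ℕ} {A : Matrix (Fin n) (Fin n) ℝ} {u : Fin n → Fin n → ℝ} {σ : Fin n → ℝ}

theorem dotProduct_mulVec_comm (H : AbsEigenbasis A u σ) (x y : Fin n → ℝ) :
    (A *ᵥ x) ⬝ᵥ y = x ⬝ᵥ (A *ᵥ y) := by
  rw [Matrix.dotProduct_mulVec, ← Matrix.mulVec_transpose, H.symm]

theorem dotProduct_sum (H : AbsEigenbasis A u σ) (s : Finset (Fin n)) (a : Fin n → ℝ)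
    (l : Fin n) : u l ⬝ᵥ (∑ k ∈ s, a k • u k) = if l ∈ s then a l else 0 := by
  simp [_root_.dotProduct_sum, H.orth]

theorem sum_dotProduct_sum (H : AbsEigenbasis A u σ) (s : Finset (Fin n)) (a : Fin n → ℝ) :
    (∑ k ∈ s, a k • u k) ⬝ᵥ (∑ k ∈ s, a k • u k) = ∑ k ∈ s, a k ^ 2 := by
  rw [_root_.sum_dotProduct]
  refine Finset.sum_congr rfl fun k hk => ?_
  rw [smul_dotProduct, H.dotProduct_sum, if_pos hk, smul_eq_mul, pow_two]

/-- The images `A *ᵥ u k` are again orthogonal, with lengths `σ k`. -/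
theorem mulVec_sum_dotProduct (H : AbsEigenbasis A u σ) (s : Finset (Fin n)) (a : Fin n → ℝ) :
    (A *ᵥ ∑ k ∈ s, a k • u k) ⬝ᵥ (A *ᵥ ∑ k ∈ s, a k • u k) = ∑ k ∈ s, σ k ^ 2 * a k ^ 2 := by
  rw [H.dotProduct_mulVec_comm, _root_.sum_dotProduct]
  refine Finset.sum_congr rfl fun k hk => ?_
  rw [smul_dotProduct, ← H.dotProduct_mulVec_comm, ← H.dotProduct_mulVec_comm, H.sq,
    smul_dotProduct, H.dotProduct_sum, if_pos hk, smul_eq_mul, smul_eq_mul]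
  ring

theorem mulVec_dotProduct_self (H : AbsEigenbasis A u σ) (k : Fin n) :
    (A *ᵥ u k) ⬝ᵥ (A *ᵥ u k) = σ k ^ 2 := by
  rw [H.dotProduct_mulVec_comm, H.sq, dotProduct_smul, H.orth, if_pos rfl, smul_eq_mul, mul_one]

theorem le_of_bound (H : AbsEigenbasis A u σ) {B : ℝ} (hB : 0 ≤ B)
    (h : ∀ x, (A *ᵥ x) ⬝ᵥ (A *ᵥ x) ≤ B ^ 2 * (x ⬝ᵥ x)) (k : Fin n) : σ k ≤ B := by
  have h1 := h (u k)
  rw [H.mulVec_dotProduct_self, H.orth, if_pos rfl, mul_one] at h1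
  exact (pow_le_pow_iff_left₀ (H.nonneg k) hB two_ne_zero).1 h1

end AbsEigenbasis

/-! ### Adjacency matrices close to a block matrix -/

/-- The matrix whose entries depend on the types of the two indices only. -/
def blockMatrix {n : ℕ} {τ : Type*} (M : τ → τ → ℝ) (t : Fin n → τ) : Matrix (Fin n) (Fin n) ℝ :=
  Matrix.of fun i j => M (t i) (t j)

/-- `E` has operator norm at most `D`. -/
def OpBound {n : ℕ} (E : Matrix (Fin n) (Fin n) ℝ) (D : ℝ) : Prop :=
  ∀ x : Fin n → ℝ, (E *ᵥ x) ⬝ᵥ (E *ᵥ x) ≤ D ^ 2 * (x ⬝ᵥ x)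

/-- Indicator vector of a type. -/
def typeVec {n : ℕ} {τ : Type*} [DecidableEq τ] (t : Fin n → τ) (c : τ) : Fin n → ℝ :=
  fun i => if t i = c then 1 else 0

section Block

variable {n : ℕ} {τ : Type*} [Fintype τ] [DecidableEq τ] {M : τ → τ → ℝ} {t : Fin n → τ}

theorem blockMatrix_mulVec (x : Fin n → ℝ) (i : Fin n) :
    (blockMatrix M t *ᵥ x) i = ∑ c, M (t i) c * (typeVec t c ⬝ᵥ x) := by
  simp only [Matrix.mulVec, dotProduct, blockMatrix, Matrix.of_apply, typeVec, Finset.mul_sum]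
  rw [Finset.sum_comm]
  refine Finset.sum_congr rfl fun j _ => ?_
  rw [Finset.sum_eq_single (t j)] <;> simp +contextual [eq_comm]

theorem typeVec_dotProduct_self (c : τ) :
    typeVec t c ⬝ᵥ typeVec t c = ((Finset.univ.filter fun i => t i = c).card : ℝ) := by
  simp only [typeVec, dotProduct, mul_ite, mul_one, mul_zero]
  rw [Finset.card_filter]
  push_cast
  exact Finset.sum_congr rfl fun i _ => by split_ifs <;> rfl

theorem typeVec_dotProduct_self_le (c : τ) : typeVec t c ⬝ᵥ typeVec t c ≤ (n : ℝ) := by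
  rw [typeVec_dotProduct_self]
  exact_mod_cast (Finset.card_le_univ _).trans_eq (Fintype.card_fin n)

theorem blockMatrix_mulVec_typeVec (c : τ) (i : Fin n) :
    (blockMatrix M t *ᵥ typeVec t c) i =
      M (t i) c * ((Finset.univ.filter fun i => t i = c).card : ℝ) := by
  rw [blockMatrix_mulVec, Finset.sum_eq_single c]
  · rw [typeVec_dotProduct_self]
  · intro b _ hb
    have : typeVec t b ⬝ᵥ typeVec t c = 0 := by
      refine Finset.sum_eq_zero fun i _ => ?_
      simp only [typeVec]
      split_ifs with h1 h2
      · exact absurd (h1.symm.trans h2) hb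
      all_goals simp
    rw [this, mul_zero]
  · simp

variable {A : Matrix (Fin n) (Fin n) ℝ} {u : Fin n → Fin n → ℝ} {σ : Fin n → ℝ} {D : ℝ}

/-- The eigenvalues of `|A|` beyond the number of types are small. -/
theorem AbsEigenbasis.sigma_le (H : AbsEigenbasis A u σ) (hD : 0 ≤ D)
    (hE : OpBound (A - blockMatrix M t) D) {k : Fin n} (hk : Fintype.card τ ≤ k) :
    σ k ≤ D := by
  classical
  let s : Finset (Fin n) := Finset.univ.filter fun l => l ≤ k
  let v : Fin n → τ → ℝ := fun l c => typeVec t c ⬝ᵥ u l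
  have hs : s.card = k + 1 := by
    have : s = Finset.Iic k := by ext; simp [s]
    rw [this, Fin.card_Iic]
  -- The first k + 1 eigenvectors, tested against the type indicators, give k + 1 vectors in a space
  -- of dimension at most k. A dependency yields a nonzero x orthogonal to all type indicators. The
  -- block matrix annihilates x, so |Ax| ≤ D|x|, whereas |Ax| ≥ σ k |x|.
  have hdep : ¬ LinearIndepOn ℝ v (s : Set (Fin n)) := by
    intro h
    have h1 := LinearIndependent.fintype_card_le_finrank h
    simp only [Module.finrank_fintype_fun_eq_card, Fintype.card_coe, Finset.coe_sort_coe] at h1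
    omega
  rw [linearIndepOn_finset_iff] at hdep
  push Not at hdep
  obtain ⟨a, ha, l, hl, hal⟩ := hdep
  set x : Fin n → ℝ := ∑ l ∈ s, a l • u l with hx
  have hPx : blockMatrix M t *ᵥ x = 0 := by
    funext i
    rw [blockMatrix_mulVec, Pi.zero_apply]
    refine Finset.sum_eq_zero fun c _ => ?_
    have h2 := congrFun ha c
    simp only [Finset.sum_apply, Pi.smul_apply, Pi.zero_apply, v, smul_eq_mul] at h2
    have h3 : typeVec t c ⬝ᵥ x = 0 := by
      rw [hx, _root_.dotProduct_sum, ← h2]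
      exact Finset.sum_congr rfl fun l _ => by rw [dotProduct_smul, smul_eq_mul]
    rw [h3, mul_zero]
  have h4 := hE x
  rw [Matrix.sub_mulVec, hPx, sub_zero, H.mulVec_sum_dotProduct, H.sum_dotProduct_sum] at h4
  have h5 : σ k ^ 2 * ∑ l ∈ s, a l ^ 2 ≤ ∑ l ∈ s, σ l ^ 2 * a l ^ 2 := by
    rw [Finset.mul_sum]
    refine Finset.sum_le_sum fun l hl => mul_le_mul_of_nonneg_right ?_ (sq_nonneg _)
    exact pow_le_pow_left₀ (H.nonneg k) (H.anti (Finset.mem_filter.1 hl).2) 2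
  have h6 : 0 < ∑ l ∈ s, a l ^ 2 :=
    Finset.sum_pos' (fun _ _ => sq_nonneg _) ⟨l, hl, by positivity⟩
  have h7 : σ k ^ 2 ≤ D ^ 2 := le_of_mul_le_mul_right (h5.trans h4) h6
  exact (pow_le_pow_iff_left₀ (H.nonneg k) hD two_ne_zero).1 h7

theorem dotProduct_sq_le (x y : Fin n → ℝ) : (x ⬝ᵥ y) ^ 2 ≤ (x ⬝ᵥ x) * (y ⬝ᵥ y) := by
  have h := Finset.sum_mul_sq_le_sq_mul_sq Finset.univ x y
  simpa only [dotProduct, sq] using h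

theorem dotProduct_self_nonneg' (x : Fin n → ℝ) : 0 ≤ x ⬝ᵥ x :=
  Finset.sum_nonneg fun _ _ => mul_self_nonneg _

/-- The error of the approximation of `(blockMatrix M t) 1_c` by the leading eigenvectors. -/
def sepError (M : τ → τ → ℝ) (t : Fin n → τ) (A : Matrix (Fin n) (Fin n) ℝ)
    (u : Fin n → Fin n → ℝ) (c : τ) : Fin n → ℝ :=
  (∑ k ∈ Finset.univ.filter (fun k : Fin n => (k : ℕ) < Fintype.card τ),
    (u k ⬝ᵥ (A *ᵥ typeVec t c)) • u k) - blockMatrix M t *ᵥ typeVec t c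

/-- The error is y − z, with y = (A − P)1_c for the block matrix P and z the part of A1_c along the
eigenvectors beyond the number of types. There |Az| ≤ D|z|, and ⟨Az, 1_c⟩ = |z|², so Cauchy–Schwarz
gives |z|² ≤ D²n. No eigengap is involved. -/
theorem AbsEigenbasis.sepError_le (H : AbsEigenbasis A u σ) (hD : 0 ≤ D)
    (hE : OpBound (A - blockMatrix M t) D) (c : τ) :
    ∑ i, sepError M t A u c i ^ 2 ≤ 4 * D ^ 2 * n := by
  set s := Finset.univ.filter (fun k : Fin n => (k : ℕ) < Fintype.card τ) with hs
  set s' := Finset.univ.filter (fun k : Fin n => ¬ (k : ℕ) < Fintype.card τ) with hs'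
  set a : Fin n → ℝ := fun k => u k ⬝ᵥ (A *ᵥ typeVec t c) with ha
  set z : Fin n → ℝ := ∑ k ∈ s', a k • u k with hz
  set y := (A - blockMatrix M t) *ᵥ typeVec t c with hy
  have h1 : sepError M t A u c = y - z := by
    have h2 := H.complete (A *ᵥ typeVec t c)
    rw [← Finset.sum_filter_add_sum_filter_not Finset.univ
      (fun k : Fin n => (k : ℕ) < Fintype.card τ)] at h2
    rw [hy, Matrix.sub_mulVec]
    rw [h2]
    simp only [sepError, ← hs, ← hs', hz, ha]
    rw [add_sub_right_comm, add_sub_cancel_right]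
  have hzz : z ⬝ᵥ z = ∑ k ∈ s', a k ^ 2 := H.sum_dotProduct_sum s' a
  have hzA : (A *ᵥ z) ⬝ᵥ typeVec t c = z ⬝ᵥ z := by
    rw [H.dotProduct_mulVec_comm, hzz, hz, _root_.sum_dotProduct]
    exact Finset.sum_congr rfl fun k _ => by rw [smul_dotProduct, smul_eq_mul, pow_two]
  have hAz : (A *ᵥ z) ⬝ᵥ (A *ᵥ z) ≤ D ^ 2 * (z ⬝ᵥ z) := by
    rw [hz, H.mulVec_sum_dotProduct, ← hz, hzz, Finset.mul_sum]
    refine Finset.sum_le_sum fun k hk => mul_le_mul_of_nonneg_right ?_ (sq_nonneg _)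
    exact pow_le_pow_left₀ (H.nonneg k)
      (H.sigma_le hD hE (not_lt.1 (Finset.mem_filter.1 hk).2)) 2
  have hcn := typeVec_dotProduct_self_le (t := t) c
  have hc0 := dotProduct_self_nonneg' (typeVec t c)
  have hz0 := dotProduct_self_nonneg' z
  have hzle : z ⬝ᵥ z ≤ D ^ 2 * n := by
    rcases hz0.eq_or_lt with h | h
    · rw [← h]; positivity
    · have h3 := dotProduct_sq_le (A *ᵥ z) (typeVec t c)
      rw [hzA] at h3
      have h4 : (z ⬝ᵥ z) ^ 2 ≤ (D ^ 2 * (z ⬝ᵥ z)) * n :=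
        h3.trans (mul_le_mul hAz hcn hc0 (by positivity))
      have h5 : (z ⬝ᵥ z) * (z ⬝ᵥ z) ≤ (z ⬝ᵥ z) * (D ^ 2 * n) := by nlinarith
      exact le_of_mul_le_mul_left h5 h
  have hyle : y ⬝ᵥ y ≤ D ^ 2 * n :=
    (hE _).trans (mul_le_mul_of_nonneg_left hcn (sq_nonneg _))
  calc ∑ i, sepError M t A u c i ^ 2 ≤ ∑ i, (2 * (y i * y i) + 2 * (z i * z i)) := by
        refine Finset.sum_le_sum fun i _ => ?_
        rw [h1, Pi.sub_apply]
        nlinarith [sq_nonneg (y i + z i)]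
    _ = 2 * (y ⬝ᵥ y) + 2 * (z ⬝ᵥ z) := by
        rw [Finset.sum_add_distrib, ← Finset.mul_sum, ← Finset.mul_sum]; rfl
    _ ≤ _ := by linarith

/-- The cost of the clustering by types is small, and so is the optimal cost. -/
theorem AbsEigenbasis.exists_cost_le (H : AbsEigenbasis A u σ) (hD : 0 ≤ D)
    (hE : OpBound (A - blockMatrix M t) D) {X : Matrix (Fin n) (Fin (Fintype.card τ)) ℝ}
    (hX : ∀ i j, X i j = if h : (j : ℕ) < n then u ⟨j, h⟩ i * Real.sqrt (σ ⟨j, h⟩) else 0)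
    {label : Fin n → ℕ} (hL : IsKMeans (Fintype.card τ) X label) :
    ∃ center, kMeansCost X label center ≤ Fintype.card τ * D := by
  obtain ⟨_, center, hopt⟩ := hL
  refine ⟨center, ?_⟩
  let e := Fintype.equivFin τ
  -- Each centre depends on the type only. In a column with σ ≤ D the centre 0 costs σ. If σ > D,
  -- then u = A²u/σ² is replaced by PAu/σ², which is constant on types, at a cost of at most D²/σ ≤
  -- D.
  let cen : ℕ → Fin (Fintype.card τ) → ℝ := fun l j =>
    if hl : l < Fintype.card τ then
      if hj : (j : ℕ) < n then
        if σ ⟨j, hj⟩ ≤ D then 0 else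
          Real.sqrt (σ ⟨j, hj⟩) / σ ⟨j, hj⟩ ^ 2 *
            ∑ c, M (e.symm ⟨l, hl⟩) c * (typeVec t c ⬝ᵥ (A *ᵥ u ⟨j, hj⟩))
      else 0
    else 0
  refine (hopt (fun i => e (t i)) cen fun i => (e (t i)).2).trans ?_
  rw [kMeansCost, Finset.sum_comm]
  have hj : ∀ j : Fin (Fintype.card τ), ∑ i, (X i j - cen (e (t i)) j) ^ 2 ≤ D := by
    intro j
    by_cases hjn : (j : ℕ) < n
    · set k : Fin n := ⟨j, hjn⟩ with hk
      have hσ := H.nonneg k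
      have hss : Real.sqrt (σ k) ^ 2 = σ k := Real.sq_sqrt hσ
      by_cases hsD : σ k ≤ D
      · calc ∑ i, (X i j - cen (e (t i)) j) ^ 2 = ∑ i, σ k * (u k i * u k i) := by
              refine Finset.sum_congr rfl fun i _ => ?_
              simp only [hX, cen, Fin.is_lt, dif_pos hjn, dite_true, ← hk, if_pos hsD, sub_zero]
              rw [mul_pow, hss]; ring
          _ = σ k * (u k ⬝ᵥ u k) := by rw [← Finset.mul_sum]; rfl
          _ ≤ D := by rw [H.orth, if_pos rfl, mul_one]; exact hsD
      · push Not at hsD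
        have hpos : 0 < σ k := hD.trans_lt hsD
        set y := (A - blockMatrix M t) *ᵥ (A *ᵥ u k) with hy
        have hyle : y ⬝ᵥ y ≤ D ^ 2 * σ k ^ 2 := by
          have := hE (A *ᵥ u k)
          rwa [H.mulVec_dotProduct_self] at this
        have hyi : ∀ i, u k i - (blockMatrix M t *ᵥ (A *ᵥ u k)) i / σ k ^ 2 = y i / σ k ^ 2 := by
          intro i
          rw [hy, Matrix.sub_mulVec, H.sq, Pi.sub_apply, Pi.smul_apply, smul_eq_mul]
          field_simp
        calc ∑ i, (X i j - cen (e (t i)) j) ^ 2 = ∑ i, σ k / σ k ^ 4 * (y i * y i) := by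
              refine Finset.sum_congr rfl fun i _ => ?_
              simp only [hX, cen, Fin.is_lt, dif_pos hjn, dite_true, ← hk, if_neg (not_le.2 hsD),
                Fin.eta, Equiv.symm_apply_apply]
              rw [← blockMatrix_mulVec]
              have : u k i * Real.sqrt (σ k) - Real.sqrt (σ k) / σ k ^ 2 *
                  (blockMatrix M t *ᵥ (A *ᵥ u k)) i = Real.sqrt (σ k) *
                  (u k i - (blockMatrix M t *ᵥ (A *ᵥ u k)) i / σ k ^ 2) := by ring
              rw [this, hyi, mul_pow, hss]
              field_simp
          _ = σ k / σ k ^ 4 * (y ⬝ᵥ y) := by rw [← Finset.mul_sum]; rfl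
          _ ≤ σ k / σ k ^ 4 * (D ^ 2 * σ k ^ 2) :=
              mul_le_mul_of_nonneg_left hyle (by positivity)
          _ = D * (D / σ k) := by field_simp
          _ ≤ D := mul_le_of_le_one_right hD ((div_le_one hpos).2 hsD.le)
    · have : ∀ i, X i j - cen (e (t i)) j = 0 := fun i => by
        simp only [hX, cen, Fin.is_lt, dif_neg hjn, dite_true, sub_zero]
      simp [this, hD]
  calc _ ≤ ∑ _j : Fin (Fintype.card τ), D := Finset.sum_le_sum fun j _ => hj j
    _ = _ := by simp

/-- Well-approximated rows in the same cluster have the same type. -/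
theorem AbsEigenbasis.type_eq_of_label_eq (H : AbsEigenbasis A u σ)
    (hAn : ∀ x, (A *ᵥ x) ⬝ᵥ (A *ᵥ x) ≤ (n : ℝ) ^ 2 * (x ⬝ᵥ x)) (hn : 0 < n)
    {X : Matrix (Fin n) (Fin (Fintype.card τ)) ℝ}
    (hX : ∀ i j, X i j = if h : (j : ℕ) < n then u ⟨j, h⟩ i * Real.sqrt (σ ⟨j, h⟩) else 0)
    {γ c₀ ζ η : ℝ} (hγ : 0 ≤ γ) (hζ : 0 ≤ ζ)
    (hM : ∀ a b, a ≠ b → ∃ c, γ ≤ |M a c - M b c|)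
    (hcount : ∀ c, c₀ * n ≤ ((Finset.univ.filter fun i => t i = c).card : ℝ))
    (hsmall : 2 * (Fintype.card τ * ζ) + 2 * η < γ * c₀)
    {z : Fin (Fintype.card τ) → ℝ} {i i' : Fin n}
    (hi : ∑ j, (X i j - z j) ^ 2 ≤ ζ ^ 2) (hi' : ∑ j, (X i' j - z j) ^ 2 ≤ ζ ^ 2)
    (hs : ∀ c, |sepError M t A u c i| ≤ η * n) (hs' : ∀ c, |sepError M t A u c i'| ≤ η * n) :
    t i = t i' := by
  by_contra hne
  obtain ⟨c, hc⟩ := hM _ _ hne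
  have hn' : (0 : ℝ) < n := by exact_mod_cast hn
  set s := Finset.univ.filter (fun k : Fin n => (k : ℕ) < Fintype.card τ) with hsdef
  set a : Fin n → ℝ := fun k => u k ⬝ᵥ (A *ᵥ typeVec t c) with ha
  have hrow : ∀ m, (∑ k ∈ s, a k * u k m) = sepError M t A u c m +
      M (t m) c * ((Finset.univ.filter fun i => t i = c).card : ℝ) := by
    intro m
    rw [← blockMatrix_mulVec_typeVec (M := M)]
    simp [sepError, ← hsdef, ha]
  -- The coefficient is at most σ√n. One factor √σ turns eigenvector coordinates into embedding
  -- coordinates, which are close; the other is at most √n. Thus no lower bound on the eigenvalues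
  -- is needed.
  have hcoord : ∀ k ∈ s, |a k * (u k i - u k i')| ≤ n * (2 * ζ) := by
    intro k hk
    have hkK : (k : ℕ) < Fintype.card τ := (Finset.mem_filter.1 hk).2
    have hσ := H.nonneg k
    have h1 : |a k| ≤ σ k * Real.sqrt n := by
      refine abs_le_of_sq_le_sq ?_ (by positivity)
      have h2 := dotProduct_sq_le (A *ᵥ u k) (typeVec t c)
      rw [H.dotProduct_mulVec_comm, H.mulVec_dotProduct_self] at h2
      rw [mul_pow, Real.sq_sqrt hn'.le]
      exact h2.trans (mul_le_mul_of_nonneg_left (typeVec_dotProduct_self_le c) (sq_nonneg _))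
    have hle : ∀ m, ∑ j, (X m j - z j) ^ 2 ≤ ζ ^ 2 → |X m ⟨k, hkK⟩ - z ⟨k, hkK⟩| ≤ ζ := by
      intro m hm
      refine abs_le_of_sq_le_sq ?_ hζ
      exact (Finset.single_le_sum (f := fun j => (X m j - z j) ^ 2) (fun _ _ => sq_nonneg _)
        (Finset.mem_univ (⟨k, hkK⟩ : Fin (Fintype.card τ)))).trans hm
    have h3 : |Real.sqrt (σ k) * (u k i - u k i')| ≤ 2 * ζ := by
      have h4 := hle i hi
      have h5 := hle i' hi'
      simp only [hX, Fin.is_lt, dite_true, Fin.eta] at h4 h5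
      rw [abs_le] at h4 h5 ⊢
      constructor <;> linarith [h4.1, h4.2, h5.1, h5.2]
    have h6 : Real.sqrt (σ k) ≤ Real.sqrt n :=
      Real.sqrt_le_sqrt (H.le_of_bound hn'.le hAn k)
    calc |a k * (u k i - u k i')| = |a k| * |u k i - u k i'| := abs_mul _ _
      _ ≤ σ k * Real.sqrt n * |u k i - u k i'| :=
          mul_le_mul_of_nonneg_right h1 (abs_nonneg _)
      _ = Real.sqrt (σ k) * Real.sqrt n * |Real.sqrt (σ k) * (u k i - u k i')| := by
          rw [abs_mul, abs_of_nonneg (Real.sqrt_nonneg _)]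
          nth_rewrite 1 [← Real.mul_self_sqrt hσ]
          ring
      _ ≤ Real.sqrt n * Real.sqrt n * (2 * ζ) := by gcongr
      _ = _ := by rw [Real.mul_self_sqrt hn'.le]
  have hcard : (s.card : ℝ) ≤ Fintype.card τ := by
    have : s.card ≤ (Finset.range (Fintype.card τ)).card :=
      Finset.card_le_card_of_injOn (fun k => (k : ℕ))
        (fun k hk => by simpa [s] using hk) (fun k _ l _ h => Fin.ext h)
    rw [Finset.card_range] at this
    exact_mod_cast this
  have hup : |∑ k ∈ s, a k * (u k i - u k i')| ≤ Fintype.card τ * (n * (2 * ζ)) :=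
    calc _ ≤ ∑ k ∈ s, |a k * (u k i - u k i')| := Finset.abs_sum_le_sum_abs _ _
      _ ≤ ∑ k ∈ s, (n * (2 * ζ)) := Finset.sum_le_sum hcoord
      _ = s.card * (n * (2 * ζ)) := by simp
      _ ≤ _ := mul_le_mul_of_nonneg_right hcard (by positivity)
  have hsplit : ∑ k ∈ s, a k * (u k i - u k i') = (sepError M t A u c i - sepError M t A u c i')
      + (M (t i) c - M (t i') c) * ((Finset.univ.filter fun i => t i = c).card : ℝ) := by
    simp only [mul_sub, Finset.sum_sub_distrib, hrow]
    ring
  have hlow : γ * (c₀ * n) ≤ |(M (t i) c - M (t i') c) *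
      ((Finset.univ.filter fun i => t i = c).card : ℝ)| := by
    rw [abs_mul, Nat.abs_cast]
    exact (mul_le_mul_of_nonneg_left (hcount c) hγ).trans
      (mul_le_mul_of_nonneg_right hc (Nat.cast_nonneg _))
  have h7 : |(M (t i) c - M (t i') c) * ((Finset.univ.filter fun i => t i = c).card : ℝ)| ≤
      Fintype.card τ * (n * (2 * ζ)) + (η * n + η * n) := by
    have h8 : (M (t i) c - M (t i') c) * ((Finset.univ.filter fun i => t i = c).card : ℝ) =
      (∑ k ∈ s, a k * (u k i - u k i')) - (sepError M t A u c i - sepError M t A u c i') := by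
      rw [hsplit]; ring
    rw [h8]
    exact (abs_sub _ _).trans (add_le_add hup ((abs_sub _ _).trans (add_le_add (hs c) (hs' c))))
  nlinarith

end Block

end VertexNomination

namespace VertexNomination

open Matrix

/-! ### Spectral clusters against type classes -/

section Clusters

variable {n : ℕ} {τ : Type*} [Fintype τ] [DecidableEq τ]

/-- If the clusters are pure on a set of good vertices that meets every type, and there are as
many clusters as types, then clusters and types agree on good vertices. -/
theorem cluster_type_correspondence {L : Fin n → ℕ} (hL : ∀ i, L i < Fintype.card τ)
    {t : Fin n → τ} {B : Finset (Fin n)} (hpure : ∀ i ∉ B, ∀ j ∉ B, L i = L j → t i = t j)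
    (hmeet : ∀ a, ∃ i ∉ B, t i = a) :
    (∀ i, ∃ a, ∀ j ∉ B, (j ∈ cluster L i ↔ t j = a)) ∧
      ∀ a, ∃ i, ∀ j ∉ B, (j ∈ cluster L i ↔ t j = a) := by
  choose g hgB hgt using hmeet
  -- A type is sent to the label of one of its good vertices. Purity makes this injective, hence
  -- bijective by cardinality; every label therefore belongs to exactly one type.
  let f : τ → Fin (Fintype.card τ) := fun a => ⟨L (g a), hL _⟩
  have hf : Function.Bijective f := by
    rw [Fintype.bijective_iff_injective_and_card]
    refine ⟨fun a b hab => ?_, by simp⟩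
    rw [← hgt a, ← hgt b]
    exact hpure _ (hgB a) _ (hgB b) (by simpa [f] using hab)
  have key : ∀ a, ∀ j ∉ B, (j ∈ cluster L (g a) ↔ t j = a) := by
    intro a j hj
    simp only [cluster, Finset.mem_filter, Finset.mem_univ, true_and]
    constructor
    · intro h
      rw [hpure j hj (g a) (hgB a) h, hgt]
    · intro h
      obtain ⟨b, hb⟩ := hf.2 ⟨L j, hL j⟩
      have hb' : L (g b) = L j := by simpa [f] using hb
      have h1 := hpure (g b) (hgB b) j hj hb'
      rw [hgt, h] at h1
      rw [← hb', h1]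
  refine ⟨fun i => ?_, fun a => ⟨g a, key a⟩⟩
  obtain ⟨a, ha⟩ := hf.2 ⟨L i, hL i⟩
  have ha' : L (g a) = L i := by simpa [f] using ha
  refine ⟨a, fun j hj => ?_⟩
  rw [← key a j hj]
  simp [cluster, ha']

theorem card_filter_mul_le {ι : Type*} [Fintype ι] (f : ι → ℝ) (hf : ∀ i, 0 ≤ f i) (c : ℝ) :
    ((Finset.univ.filter fun i => c < f i).card : ℝ) * c ≤ ∑ i, f i := by
  classical
  calc ((Finset.univ.filter fun i => c < f i).card : ℝ) * c
      = ∑ i ∈ Finset.univ.filter (fun i => c < f i), c := by simp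
    _ ≤ ∑ i ∈ Finset.univ.filter (fun i => c < f i), f i :=
        Finset.sum_le_sum fun i hi => (Finset.mem_filter.1 hi).2.le
    _ ≤ ∑ i, f i := Finset.sum_le_sum_of_subset_of_nonneg (Finset.filter_subset _ _)
        fun i _ _ => hf i

open Classical in
theorem card_filter_adj_eq (h : SimpleGraph (Fin n)) (T : Finset (Fin n)) :
    (((T ×ˢ T).filter fun e => h.Adj e.1 e.2).card : ℝ) =
      ∑ i ∈ T, ∑ j ∈ T, h.adjMatrix ℝ i j := by
  rw [Finset.card_filter]
  push_cast
  rw [Finset.sum_product]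
  simp [SimpleGraph.adjMatrix_apply]

open Classical in
/-- The edge density of a set that is almost a type class. -/
theorem abs_withinDensity_sub_le {M : τ → τ → ℝ} (hM : ∀ a b, M a b ∈ Set.Icc (0 : ℝ) 1)
    {h : SimpleGraph (Fin n)} {t : Fin n → τ} {D : ℝ} (hD : 0 ≤ D)
    (hE : OpBound (h.adjMatrix ℝ - blockMatrix M t) D) {T B : Finset (Fin n)} {a : τ}
    (hT : ∀ j ∉ B, (j ∈ T ↔ t j = a)) (hcard : 2 ≤ T.card) :
    |withinDensity h T - M a a| ≤ (D + 2 * B.card + 1) / ((T.card : ℝ) - 1) := by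
  set m : ℝ := (T.card : ℝ) with hm
  have hm2 : (2 : ℝ) ≤ m := by rw [hm]; exact_mod_cast hcard
  have hvec : ∀ E : Matrix (Fin n) (Fin n) ℝ, ∑ i ∈ T, ∑ j ∈ T, E i j =
      (fun i => if i ∈ T then (1 : ℝ) else 0) ⬝ᵥ (E *ᵥ fun i => if i ∈ T then (1 : ℝ) else 0) := by
    intro E
    simp [dotProduct, Matrix.mulVec]
  have hTT : (fun i => if i ∈ T then (1 : ℝ) else 0) ⬝ᵥ (fun i => if i ∈ T then (1 : ℝ) else 0)
      = m := by
    simp [dotProduct, hm]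
  have h1 : |∑ i ∈ T, ∑ j ∈ T, (h.adjMatrix ℝ - blockMatrix M t) i j| ≤ D * m := by
    rw [hvec]
    refine abs_le_of_sq_le_sq ((dotProduct_sq_le _ _).trans ?_) (by positivity)
    rw [hTT]
    have := hE (fun i => if i ∈ T then (1 : ℝ) else 0)
    rw [hTT] at this
    nlinarith
  have h2 : |∑ i ∈ T, ∑ j ∈ T, (M (t i) (t j) - M a a)| ≤ 2 * B.card * m := by
    calc |∑ i ∈ T, ∑ j ∈ T, (M (t i) (t j) - M a a)|
        ≤ ∑ i ∈ T, ∑ j ∈ T, |M (t i) (t j) - M a a| :=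
          (Finset.abs_sum_le_sum_abs _ _).trans
            (Finset.sum_le_sum fun i _ => Finset.abs_sum_le_sum_abs _ _)
      _ ≤ ∑ i ∈ T, ∑ j ∈ T, ((if i ∈ B then 1 else 0) + if j ∈ B then 1 else 0) := by
          refine Finset.sum_le_sum fun i hi => Finset.sum_le_sum fun j hj => ?_
          have hb : |M (t i) (t j) - M a a| ≤ 1 := by
            have h3 := hM (t i) (t j)
            have h4 := hM a a
            rw [abs_le]; constructor <;> linarith [h3.1, h3.2, h4.1, h4.2]
          by_cases hiB : i ∈ B
          · rw [if_pos hiB]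
            refine hb.trans (le_add_of_nonneg_right ?_)
            split_ifs <;> norm_num
          · by_cases hjB : j ∈ B
            · rw [if_pos hjB, if_neg hiB, zero_add]; exact hb
            · rw [(hT i hiB).1 hi, (hT j hjB).1 hj]; simp [hiB, hjB]
      _ = m * (∑ i ∈ T, if i ∈ B then (1 : ℝ) else 0) +
            m * (∑ i ∈ T, if i ∈ B then (1 : ℝ) else 0) := by
          simp only [Finset.sum_add_distrib, Finset.sum_const, nsmul_eq_mul, ← Finset.mul_sum,
            ← hm]
      _ ≤ _ := by
          have : (∑ i ∈ T, if i ∈ B then (1 : ℝ) else 0) ≤ B.card := by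
            rw [← Finset.sum_filter, Finset.sum_const, nsmul_eq_mul, mul_one]
            exact_mod_cast Finset.card_le_card fun i hi => (Finset.mem_filter.1 hi).2
          nlinarith
  have h3 : ∑ i ∈ T, ∑ j ∈ T, h.adjMatrix ℝ i j =
      (∑ i ∈ T, ∑ j ∈ T, (h.adjMatrix ℝ - blockMatrix M t) i j) +
        (∑ i ∈ T, ∑ j ∈ T, (M (t i) (t j) - M a a)) + m * m * M a a := by
    have : m * m * M a a = ∑ i ∈ T, ∑ j ∈ T, M a a := by
      simp [hm, mul_assoc]
    rw [this, ← Finset.sum_add_distrib, ← Finset.sum_add_distrib]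
    refine Finset.sum_congr rfl fun i _ => ?_
    rw [← Finset.sum_add_distrib, ← Finset.sum_add_distrib]
    refine Finset.sum_congr rfl fun j _ => ?_
    simp [blockMatrix]
  have h4 : withinDensity h T = (∑ i ∈ T, ∑ j ∈ T, h.adjMatrix ℝ i j) / (m * (m - 1)) := by
    rw [withinDensity, ← card_filter_adj_eq]
  set e1 := ∑ i ∈ T, ∑ j ∈ T, (h.adjMatrix ℝ - blockMatrix M t) i j
  set e2 := ∑ i ∈ T, ∑ j ∈ T, (M (t i) (t j) - M a a)
  have hm1 : 0 < m - 1 := by linarith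
  have hm0 : 0 < m := by linarith
  -- The block sum runs over all m² ordered pairs, the density over the m(m − 1) off the diagonal;
  -- the difference is the summand `m * M a a`, the source of the `+ 1` in the bound.
  have h5 : withinDensity h T - M a a = (e1 + e2 + m * M a a) / (m * (m - 1)) := by
    rw [h4, h3]; field_simp; ring
  rw [h5, abs_div, abs_of_pos (mul_pos hm0 hm1), div_le_div_iff₀ (mul_pos hm0 hm1) hm1]
  have h6 : |e1 + e2 + m * M a a| ≤ D * m + 2 * B.card * m + m := by
    refine (abs_add_le _ _).trans (add_le_add ((abs_add_le _ _).trans (add_le_add h1 h2)) ?_)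
    rw [abs_mul, abs_of_pos hm0, abs_of_nonneg (hM a a).1]
    exact mul_le_of_le_one_right hm0.le (hM a a).2
  calc |e1 + e2 + m * M a a| * (m - 1) ≤ (D * m + 2 * B.card * m + m) * (m - 1) :=
        mul_le_mul_of_nonneg_right h6 hm1.le
    _ = _ := by ring

open Classical in
theorem adjMatrix_mulVec_bound (h : SimpleGraph (Fin n)) :
    OpBound (h.adjMatrix ℝ) (n : ℝ) := by
  intro x
  have h1 : ∀ i, (h.adjMatrix ℝ *ᵥ x) i * (h.adjMatrix ℝ *ᵥ x) i ≤ n * (x ⬝ᵥ x) := by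
    intro i
    have h2 := dotProduct_sq_le (h.adjMatrix ℝ i) x
    rw [pow_two] at h2
    refine h2.trans (mul_le_mul_of_nonneg_right ?_ (dotProduct_self_nonneg' x))
    calc h.adjMatrix ℝ i ⬝ᵥ h.adjMatrix ℝ i ≤ ∑ _j : Fin n, (1 : ℝ) :=
          Finset.sum_le_sum fun j _ => by
            rw [SimpleGraph.adjMatrix_apply]; split_ifs <;> norm_num
      _ = n := by simp
  calc _ ≤ ∑ _i : Fin n, n * (x ⬝ᵥ x) := Finset.sum_le_sum fun i _ => h1 i
    _ = _ := by simp; ring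

theorem exists_uniform_gap [Nonempty τ] {M : τ → τ → ℝ}
    (hrow : ∀ a b, a ≠ b → ∃ c, M a c ≠ M b c) :
    ∃ γ : ℝ, 0 < γ ∧ ∀ a b, a ≠ b → ∃ c, γ ≤ |M a c - M b c| := by
  have h : ∀ a b, ∃ c, a ≠ b → M a c ≠ M b c := fun a b => by
    by_cases hab : a = b
    · exact ⟨a, fun h => absurd hab h⟩
    · obtain ⟨c, hc⟩ := hrow a b hab
      exact ⟨c, fun _ => hc⟩
  choose c hc using h
  obtain ⟨x, hx⟩ := Finite.exists_min fun x : τ × τ =>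
    if x.1 = x.2 then (1 : ℝ) else |M x.1 (c x.1 x.2) - M x.2 (c x.1 x.2)|
  refine ⟨_, ?_, fun a b hab => ⟨c a b, (hx (a, b)).trans_eq (if_neg hab)⟩⟩
  split_ifs with h
  · norm_num
  · exact abs_pos.2 (sub_ne_zero.2 (hc _ _ h))

open Classical in
/-- The bad vertices of a spectral clustering are few. -/
theorem exists_bad_set {M : τ → τ → ℝ} {γ c₀ : ℝ} (hγ : 0 < γ) (hc₀ : 0 < c₀) [Nonempty τ]
    (hM : ∀ a b, a ≠ b → ∃ c, γ ≤ |M a c - M b c|) :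
    ∃ C : ℝ, 0 < C ∧ ∀ (n : ℕ), 0 < n → ∀ (h : SimpleGraph (Fin n)) (t : Fin n → τ),
      (∀ c, c₀ * n ≤ ((Finset.univ.filter fun i => t i = c).card : ℝ)) →
      ∀ δ : ℝ, 0 < δ → δ ≤ 1 → OpBound (h.adjMatrix ℝ - blockMatrix M t) (δ * n) →
      ∀ (X : Matrix (Fin n) (Fin (Fintype.card τ)) ℝ) (L : Fin n → ℕ),
        IsASE (h.adjMatrix ℝ) X → IsKMeans (Fintype.card τ) X L →
        ∃ B : Finset (Fin n), (B.card : ℝ) ≤ C * δ * n ∧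
          ∀ i ∉ B, ∀ j ∉ B, L i = L j → t i = t j := by
  have hK : (0 : ℝ) < Fintype.card τ := by exact_mod_cast Fintype.card_pos
  set K : ℝ := (Fintype.card τ : ℝ) with hKdef
  -- Chosen such that 2Kζ + 2η = γc₀/2, strictly below the separation γc₀ required by
  -- `AbsEigenbasis.type_eq_of_label_eq`.
  set ζ := γ * c₀ / (8 * K) with hζ
  set η := γ * c₀ / 8 with hη
  have hζ0 : 0 < ζ := by positivity
  have hη0 : 0 < η := by positivity
  refine ⟨K * (1 / ζ ^ 2 + 4 / η ^ 2), by positivity, ?_⟩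
  intro n hn h t hcount δ hδ hδ1 hE X L hX hL
  have hn' : (0 : ℝ) < n := by exact_mod_cast hn
  obtain ⟨u, σ, H, hXu⟩ := hX.exists_eigenbasis (SimpleGraph.transpose_adjMatrix h)
  obtain ⟨center, hcost⟩ := H.exists_cost_le (by positivity) hE hXu hL
  let B₀ := Finset.univ.filter fun i => ζ ^ 2 < ∑ j, (X i j - center (L i) j) ^ 2
  let B₁ : τ → Finset (Fin n) := fun c => Finset.univ.filter fun i =>
    (η * n) ^ 2 < sepError M t (h.adjMatrix ℝ) u c i ^ 2
  refine ⟨B₀ ∪ Finset.univ.biUnion B₁, ?_, ?_⟩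
  · have h0 : (B₀.card : ℝ) ≤ K * δ * n / ζ ^ 2 := by
      rw [le_div_iff₀ (by positivity)]
      refine (card_filter_mul_le _ (fun i => Finset.sum_nonneg fun _ _ => sq_nonneg _) _).trans ?_
      exact hcost.trans_eq (by ring)
    have h1 : ∀ c, ((B₁ c).card : ℝ) ≤ 4 * δ * n / η ^ 2 := by
      intro c
      have h2 := (card_filter_mul_le (fun i => sepError M t (h.adjMatrix ℝ) u c i ^ 2)
        (fun i => sq_nonneg _) ((η * n) ^ 2)).trans (H.sepError_le (by positivity) hE c)
      rw [le_div_iff₀ (by positivity)]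
      have h3 : ((B₁ c).card * η ^ 2) * (n : ℝ) ^ 2 ≤ (4 * δ ^ 2 * n) * (n : ℝ) ^ 2 := by
        calc _ = ((B₁ c).card : ℝ) * (η * n) ^ 2 := by ring
          _ ≤ _ := h2
          _ = _ := by ring
      have h4 := le_of_mul_le_mul_right h3 (by positivity)
      refine h4.trans ?_
      have : δ ^ 2 ≤ δ := by nlinarith
      nlinarith
    calc ((B₀ ∪ Finset.univ.biUnion B₁).card : ℝ) ≤ B₀.card + ∑ c, ((B₁ c).card : ℝ) := by
          exact_mod_cast (Finset.card_union_le _ _).trans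
            (Nat.add_le_add_left Finset.card_biUnion_le _)
      _ ≤ K * δ * n / ζ ^ 2 + ∑ _c : τ, 4 * δ * n / η ^ 2 :=
          add_le_add h0 (Finset.sum_le_sum fun c _ => h1 c)
      _ = _ := by
          rw [Finset.sum_const, Finset.card_univ, nsmul_eq_mul, ← hKdef]; ring
  · intro i hi j hj hij
    simp only [Finset.mem_union, Finset.mem_biUnion, Finset.mem_univ, true_and, not_or,
      not_exists, B₀, B₁, Finset.mem_filter, not_lt] at hi hj
    refine H.type_eq_of_label_eq (adjMatrix_mulVec_bound h) hn hXu hγ.le hζ0.le hM hcount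
      (ζ := ζ) (η := η) ?_ hi.1 (by rw [hij]; exact hj.1)
      (fun c => abs_le_of_sq_le_sq (hi.2 c) (by positivity))
      (fun c => abs_le_of_sq_le_sq (hj.2 c) (by positivity))
    have : K * ζ = γ * c₀ / 8 := by rw [hζ]; field_simp
    rw [← hKdef, this, hη]
    nlinarith [mul_pos hγ hc₀]

open Classical in
/-- If the graph is close to a block matrix with distinct rows, then a cluster of highest density
of its spectral clustering is close to a type class of almost highest density. -/
theorem exists_spectral_threshold [Nonempty τ] {M : τ → τ → ℝ}
    (hM : ∀ a b, M a b ∈ Set.Icc (0 : ℝ) 1) (hrow : ∀ a b, a ≠ b → ∃ c, M a c ≠ M b c)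
    {c₀ ε : ℝ} (hc₀ : 0 < c₀) (hε : 0 < ε) :
    ∃ δ : ℝ, 0 < δ ∧ ∃ N : ℕ, ∀ n, N ≤ n → ∀ (h : SimpleGraph (Fin n)) (t : Fin n → τ),
      (∀ c, c₀ * n ≤ ((Finset.univ.filter fun i => t i = c).card : ℝ)) →
      OpBound (h.adjMatrix ℝ - blockMatrix M t) (δ * n) →
      ∀ T, IsTopSpectralCluster (Fintype.card τ) h T →
        ∃ (a : τ) (B : Finset (Fin n)), (∀ b, M b b ≤ M a a + ε) ∧ (B.card : ℝ) ≤ ε * n ∧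
          ∀ j ∉ B, (j ∈ T ↔ t j = a) := by
  obtain ⟨γ, hγ, hgap⟩ := exists_uniform_gap hrow
  obtain ⟨C, hC, hbad⟩ := exists_bad_set hγ hc₀ hgap
  -- The bound c₀/2 keeps the bad set smaller than every type class and leaves at least c₀n/2
  -- vertices in every cluster. The bounds c₀ε/64 make the numerator of the density error at most
  -- c₀εn/16, against a denominator of at least c₀n/4; so each density is accurate to ε/2.
  set ε' := min (min ε (c₀ / 2)) (c₀ * ε / 64) with hε'
  have hε'0 : 0 < ε' := by positivity
  have hε'1 : ε' ≤ ε := (min_le_left _ _).trans (min_le_left _ _)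
  have hε'2 : ε' ≤ c₀ / 2 := (min_le_left _ _).trans (min_le_right _ _)
  have hε'3 : ε' ≤ c₀ * ε / 64 := min_le_right _ _
  set δ := min (min 1 (c₀ * ε / 64)) (ε' / C) with hδ
  have hδ0 : 0 < δ := by positivity
  have hδ1 : δ ≤ 1 := (min_le_left _ _).trans (min_le_left _ _)
  have hδ2 : δ ≤ c₀ * ε / 64 := (min_le_left _ _).trans (min_le_right _ _)
  have hδ3 : C * δ ≤ ε' := by
    have : δ ≤ ε' / C := min_le_right _ _
    rw [le_div_iff₀ hC] at this
    linarith
  obtain ⟨N, hN⟩ := exists_nat_ge (max (4 / c₀) (64 / (c₀ * ε)))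
  refine ⟨δ, hδ0, N + 1, ?_⟩
  intro n hn h t hcount hE T hT
  have hn0 : 0 < n := by omega
  have hn' : (0 : ℝ) < n := by exact_mod_cast hn0
  have hNn : (N : ℝ) ≤ n := by exact_mod_cast (by omega : N ≤ n)
  have hn1 : 4 ≤ c₀ * n := by
    have := ((le_max_left _ _).trans hN).trans hNn
    rw [div_le_iff₀ hc₀] at this
    linarith
  have hn2 : 1 ≤ c₀ * ε / 64 * n := by
    have := ((le_max_right _ _).trans hN).trans hNn
    rw [div_le_iff₀ (by positivity)] at this
    linarith
  obtain ⟨X, L, i₀, hX, hL, rfl, htop⟩ := hT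
  obtain ⟨B, hB, hpure⟩ := hbad n hn0 h t hcount δ hδ0 hδ1 hE X L hX hL
  have hB' : (B.card : ℝ) ≤ ε' * n := hB.trans (mul_le_mul_of_nonneg_right hδ3 hn'.le)
  have hmeet : ∀ a, ∃ i ∉ B, t i = a := by
    intro a
    by_contra hcon
    push Not at hcon
    have hsub : (Finset.univ.filter fun i => t i = a) ⊆ B := by
      intro i hi
      by_contra hiB
      exact hcon i hiB (Finset.mem_filter.1 hi).2
    have h1 : ((Finset.univ.filter fun i => t i = a).card : ℝ) ≤ B.card := by
      exact_mod_cast Finset.card_le_card hsub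
    have h2 := hcount a
    nlinarith
  obtain ⟨hfwd, hbwd⟩ := cluster_type_correspondence hL.1 hpure hmeet
  have hdens : ∀ i a, (∀ j ∉ B, (j ∈ cluster L i ↔ t j = a)) →
      |withinDensity h (cluster L i) - M a a| ≤ ε / 2 := by
    intro i a hia
    have h1 : c₀ * n / 2 ≤ ((cluster L i).card : ℝ) := by
      have hsub : (Finset.univ.filter fun i => t i = a) ⊆ cluster L i ∪ B := by
        intro j hj
        by_cases hjB : j ∈ B
        · exact Finset.mem_union_right _ hjB
        · exact Finset.mem_union_left _ ((hia j hjB).2 (Finset.mem_filter.1 hj).2)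
      have h2 : ((Finset.univ.filter fun i => t i = a).card : ℝ) ≤
          (cluster L i).card + B.card := by
        exact_mod_cast (Finset.card_le_card hsub).trans (Finset.card_union_le _ _)
      have h3 := hcount a
      nlinarith
    have h4 : 2 ≤ (cluster L i).card := by
      have : (2 : ℝ) ≤ (cluster L i).card := by linarith
      exact_mod_cast this
    refine (abs_withinDensity_sub_le hM (by positivity) hE hia h4).trans ?_
    rw [div_le_iff₀ (by linarith)]
    have h5 : c₀ * n / 4 ≤ ((cluster L i).card : ℝ) - 1 := by linarith
    calc δ * n + 2 * B.card + 1 ≤ c₀ * ε / 64 * n + 2 * (c₀ * ε / 64 * n) + c₀ * ε / 64 * n := by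
          have h6 := mul_le_mul_of_nonneg_right hδ2 hn'.le
          have h7 := mul_le_mul_of_nonneg_right hε'3 hn'.le
          linarith
      _ ≤ ε / 2 * (c₀ * n / 4) := by nlinarith [mul_pos (mul_pos hc₀ hε) hn']
      _ ≤ _ := mul_le_mul_of_nonneg_left h5 (by linarith)
  obtain ⟨a, ha⟩ := hfwd i₀
  refine ⟨a, B, fun b => ?_, hB'.trans (mul_le_mul_of_nonneg_right hε'1 hn'.le), ha⟩
  obtain ⟨i, hi⟩ := hbwd b
  have h1 := abs_le.1 (hdens i₀ a ha)
  have h2 := abs_le.1 (hdens i b hi)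
  linarith [htop i, h1.1, h1.2, h2.1, h2.2]

end Clusters

end VertexNomination

namespace VertexNomination

/-! ### Positions in the ordering `groupFirst` -/

section Rank

variable {n : ℕ} (T : Finset (Fin n)) (τ τ' : Equiv.Perm (Fin n))

theorem card_filter_equiv_lt (g : Fin n ≃ Fin n) (w : Fin n) :
    (Finset.univ.filter fun w' => g w' < g w).card = (g w : ℕ) := by
  rw [← Fin.card_Iio (g w)]
  refine Finset.card_equiv g fun i => by simp

theorem groupFirst_eq_card (w : Fin n) : (groupFirst T τ τ' w : ℕ) =
    (Finset.univ.filter fun w' => sortKey T τ τ' w' < sortKey T τ τ' w).card := by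
  rw [← card_filter_equiv_lt]
  simp only [groupFirst_lt_iff]

theorem groupFirst_lt_of_mem {w : Fin n} (hw : w ∈ T) : (groupFirst T τ τ' w : ℕ) < T.card := by
  rw [groupFirst_eq_card]
  refine Finset.card_lt_card ?_
  rw [Finset.ssubset_iff_of_subset]
  · exact ⟨w, hw, by simp⟩
  · intro w' hw'
    by_contra hT
    have h := (Finset.mem_filter.1 hw').2
    simp [sortKey, hw, hT, Prod.Lex.toLex_lt_toLex] at h

theorem groupFirst_le_of_notMem {w : Fin n} (hw : w ∉ T) :
    (groupFirst T τ τ' w : ℕ) ≤ T.card + τ' w := by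
  rw [groupFirst_eq_card, ← card_filter_equiv_lt τ' w]
  refine (Finset.card_le_card fun w' hw' => ?_).trans (Finset.card_union_le _ _)
  by_cases hT : w' ∈ T
  · exact Finset.mem_union_left _ hT
  · refine Finset.mem_union_right _ (Finset.mem_filter.2 ⟨Finset.mem_univ _, ?_⟩)
    have h := (Finset.mem_filter.1 hw').2
    simpa [sortKey, hw, hT, Prod.Lex.toLex_lt_toLex] using h

/-- Few elements are ranked at position `k` or later if most of them belong to the first group
and this group has not many more than `k` elements. -/
theorem card_late_le (V : Finset (Fin n)) (f : Equiv.Perm (Fin n)) (k : ℕ) :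
    (V.filter fun v => k ≤ (groupFirst T τ τ' (f v) : ℕ)).card ≤
      (V.filter fun v => f v ∉ T).card + (T.card - k) := by
  have h1 : (V.filter fun v => k ≤ (groupFirst T τ τ' (f v) : ℕ)) ⊆
      (V.filter fun v => f v ∉ T) ∪
        (V.filter fun v => f v ∈ T ∧ k ≤ (groupFirst T τ τ' (f v) : ℕ)) := by
    intro v hv
    simp only [Finset.mem_union, Finset.mem_filter] at hv ⊢
    by_cases h : f v ∈ T
    · exact Or.inr ⟨hv.1, h, hv.2⟩
    · exact Or.inl ⟨hv.1, h⟩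
  refine (Finset.card_le_card h1).trans ((Finset.card_union_le _ _).trans
    (Nat.add_le_add_left ?_ _))
  rw [← Nat.card_Ico]
  refine Finset.card_le_card_of_injOn (fun v => (groupFirst T τ τ' (f v) : ℕ)) ?_ ?_
  · intro v hv
    have := (Finset.mem_filter.1 hv).2
    exact Finset.mem_coe.2 (Finset.mem_Ico.2 ⟨this.2, groupFirst_lt_of_mem T τ τ' this.1⟩)
  · intro v _ v' _ h
    exact f.injective ((groupFirst T τ τ').injective (Fin.ext h))

/-- Elements outside the first group that come early in the order `τ'` take top positions. -/
theorem card_early_add_le {V W : Finset (Fin n)} (hVW : Disjoint V W) {j k : ℕ}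
    (hWT : ∀ w ∈ W, w ∉ T) (hW : ∀ w ∈ W, (τ' w : ℕ) < j) (hk : T.card + j ≤ k) :
    (V.filter fun v => (groupFirst T τ τ' v : ℕ) < k).card + W.card ≤ k := by
  have hdis : Disjoint (V.filter fun v => (groupFirst T τ τ' v : ℕ) < k) W :=
    hVW.mono_left (Finset.filter_subset _ _)
  rw [← Finset.card_union_of_disjoint hdis]
  nth_rewrite 3 [← Finset.card_range k]
  refine Finset.card_le_card_of_injOn (fun v => (groupFirst T τ τ' v : ℕ)) ?_ ?_
  · intro v hv
    simp only [Finset.coe_union, Set.mem_union, Finset.mem_coe, Finset.mem_filter] at hv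
    refine Finset.mem_coe.2 (Finset.mem_range.2 ?_)
    rcases hv with hv | hv
    · exact hv.2
    · have := groupFirst_le_of_notMem T τ τ' (hWT v hv)
      have := hW v hv
      change (groupFirst T τ τ' v : ℕ) < k
      omega
  · intro v _ v' _ h
    exact (groupFirst T τ τ').injective (Fin.ext h)

end Rank

/-! ### Bounds for the losses -/

section Loss

variable {n : ℕ} (Φ : RankingRule n) (g₁ g₂ : SimpleGraph (Fin n)) (o : Equiv.Perm (Fin n))
  (V : Finset (Fin n)) (k : ℕ)

theorem card_early_le :
    (V.filter fun v => (Φ g₁ (obfuscate o g₂) V (o v) : ℕ) < k).card ≤ k := by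
  nth_rewrite 3 [← Finset.card_range k]
  refine Finset.card_le_card_of_injOn (fun v => (Φ g₁ (obfuscate o g₂) V (o v) : ℕ)) ?_ ?_
  · intro v hv
    exact Finset.mem_coe.2 (Finset.mem_range.2 (Finset.mem_filter.1 hv).2)
  · intro v _ v' _ h
    exact o.injective ((Φ g₁ (obfuscate o g₂) V).injective (Fin.ext h))

theorem card_early_add_late :
    (V.filter fun v => (Φ g₁ (obfuscate o g₂) V (o v) : ℕ) < k).card +
      (V.filter fun v => k ≤ (Φ g₁ (obfuscate o g₂) V (o v) : ℕ)).card = V.card := by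
  simp only [← not_lt]
  exact Finset.card_filter_add_card_filter_not _

theorem recallLoss_nonneg : 0 ≤ recallLoss Φ g₁ g₂ o V k := by
  unfold recallLoss; positivity

theorem recallLoss_le_one : recallLoss Φ g₁ g₂ o V k ≤ 1 :=
  div_le_one_of_le₀ (by exact_mod_cast Finset.card_filter_le _ _) (Nat.cast_nonneg _)

theorem precisionLoss_nonneg : 0 ≤ precisionLoss Φ g₁ g₂ o V k :=
  sub_nonneg.2 (div_le_one_of_le₀ (by exact_mod_cast card_early_le Φ g₁ g₂ o V k)
    (Nat.cast_nonneg _))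

theorem precisionLoss_le_one : precisionLoss Φ g₁ g₂ o V k ≤ 1 := by
  unfold precisionLoss
  have : (0 : ℝ) ≤ ((V.filter fun v => (Φ g₁ (obfuscate o g₂) V (o v) : ℕ) < k).card : ℝ) / k :=
    by positivity
  linarith

variable {Φ g₁ g₂ o V}

/-- With k = ⌊n/2⌋, the top positions not taken by `V` number (k − |V|) + late ≤ (ε + a)n. Both
denominators, |V| and k, are at least n/4, which gives the factor 4; for k this needs n ≥ 2. -/
theorem losses_le {ε a : ℝ} (hn : 2 ≤ n) (hε : ε ≤ 1 / 4) (ha0 : 0 ≤ a)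
    (hV : |(V.card : ℝ) - 1 / 2 * n| ≤ ε * n)
    (h : ((V.filter fun v => n / 2 ≤ (Φ g₁ (obfuscate o g₂) V (o v) : ℕ)).card : ℝ) ≤ a * n) :
    recallLoss Φ g₁ g₂ o V (n / 2) ≤ 4 * (a + ε) ∧
      precisionLoss Φ g₁ g₂ o V (n / 2) ≤ 4 * (a + ε) := by
  have hn' : (2 : ℝ) ≤ n := by exact_mod_cast hn
  have hk1 : ((n / 2 : ℕ) : ℝ) ≤ n / 2 := Nat.cast_div_le
  have hk2 : (n : ℝ) / 4 ≤ ((n / 2 : ℕ) : ℝ) := by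
    have : n ≤ 4 * (n / 2) := by omega
    have : (n : ℝ) ≤ 4 * ((n / 2 : ℕ) : ℝ) := by exact_mod_cast this
    linarith
  rw [abs_le] at hV
  have hε0 : 0 ≤ ε := by nlinarith
  have hVn : (n : ℝ) / 4 ≤ V.card := by nlinarith
  constructor
  · rw [recallLoss, div_le_iff₀ (by linarith)]
    nlinarith [mul_nonneg ha0 (by linarith : (0 : ℝ) ≤ V.card - n / 4)]
  · have hsum : ((V.filter fun v => (Φ g₁ (obfuscate o g₂) V (o v) : ℕ) < n / 2).card : ℝ) +
        ((V.filter fun v => n / 2 ≤ (Φ g₁ (obfuscate o g₂) V (o v) : ℕ)).card : ℝ) = V.card := by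
      exact_mod_cast card_early_add_late Φ g₁ g₂ o V (n / 2)
    rw [precisionLoss, sub_le_comm, le_div_iff₀ (by linarith)]
    nlinarith [mul_nonneg (add_nonneg ha0 hε0)
      (by linarith : (0 : ℝ) ≤ ((n / 2 : ℕ) : ℝ) - n / 4)]

/-- Early and late vertices of interest add up to |V| ≥ n/2 − εn, so cn wasted top positions force
at least (c − ε)n late ones. Both denominators are at most n. -/
theorem le_losses {ε c : ℝ} (hn : 2 ≤ n) (hε : ε ≤ 1 / 4) (hc : 0 ≤ c)
    (hV : |(V.card : ℝ) - 1 / 2 * n| ≤ ε * n)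
    (h : ((V.filter fun v => (Φ g₁ (obfuscate o g₂) V (o v) : ℕ) < n / 2).card : ℝ) + c * n ≤
      ((n / 2 : ℕ) : ℝ)) :
    c - 4 * ε ≤ recallLoss Φ g₁ g₂ o V (n / 2) ∧
      c - 4 * ε ≤ precisionLoss Φ g₁ g₂ o V (n / 2) := by
  have hn' : (2 : ℝ) ≤ n := by exact_mod_cast hn
  have hk1 : ((n / 2 : ℕ) : ℝ) ≤ n / 2 := Nat.cast_div_le
  have hk2 : (n : ℝ) / 4 ≤ ((n / 2 : ℕ) : ℝ) := by
    have : n ≤ 4 * (n / 2) := by omega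
    have : (n : ℝ) ≤ 4 * ((n / 2 : ℕ) : ℝ) := by exact_mod_cast this
    linarith
  rw [abs_le] at hV
  have hε0 : 0 ≤ ε := by nlinarith
  have hVn : (n : ℝ) / 4 ≤ V.card := by nlinarith
  have hVn' : (V.card : ℝ) ≤ n := by nlinarith
  constructor
  · have hsum : ((V.filter fun v => (Φ g₁ (obfuscate o g₂) V (o v) : ℕ) < n / 2).card : ℝ) +
        ((V.filter fun v => n / 2 ≤ (Φ g₁ (obfuscate o g₂) V (o v) : ℕ)).card : ℝ) = V.card := by
      exact_mod_cast card_early_add_late Φ g₁ g₂ o V (n / 2)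
    rw [recallLoss, le_div_iff₀ (by linarith)]
    nlinarith
  · rw [precisionLoss, le_sub_comm, div_le_iff₀ (by linarith)]
    nlinarith

end Loss

/-! ### Vertex nomination schemes from arbitrary rules -/

section Scheme

variable {n : ℕ}

theorem obfuscate_adj (o : Equiv.Perm (Fin n)) (g : SimpleGraph (Fin n)) (u v : Fin n) :
    (obfuscate o g).Adj (o u) (o v) ↔ g.Adj u v :=
  SimpleGraph.map_adj_apply (f := o.toEmbedding)

theorem obfuscate_one (g : SimpleGraph (Fin n)) : obfuscate 1 g = g := by
  ext u v
  exact obfuscate_adj 1 g u v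

theorem obfuscate_mul (o o' : Equiv.Perm (Fin n)) (g : SimpleGraph (Fin n)) :
    obfuscate (o * o') g = obfuscate o (obfuscate o' g) := by
  ext u v
  obtain ⟨u, rfl⟩ := (o * o').surjective u
  obtain ⟨v, rfl⟩ := (o * o').surjective v
  rw [obfuscate_adj, Equiv.Perm.mul_apply, Equiv.Perm.mul_apply, obfuscate_adj, obfuscate_adj]

/-- Two graphs are equivalent if one is an obfuscation of the other. -/
def obfuscationSetoid (n : ℕ) : Setoid (SimpleGraph (Fin n)) where
  r g h := ∃ o, obfuscate o g = h
  iseqv :=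
    { refl := fun g => ⟨1, obfuscate_one g⟩
      symm := by
        rintro g _ ⟨o, rfl⟩
        exact ⟨o⁻¹, by rw [← obfuscate_mul, inv_mul_cancel, obfuscate_one]⟩
      trans := by
        rintro g _ _ ⟨o, rfl⟩ ⟨o', rfl⟩
        exact ⟨o' * o, obfuscate_mul _ _ _⟩ }

theorem orbit_mem_of_obfuscate_eq {g : SimpleGraph (Fin n)} {a : Equiv.Perm (Fin n)}
    (ha : obfuscate a g = g) {u w : Fin n} (hw : w ∈ orbit g u) : a w ∈ orbit g u := by
  obtain ⟨σ, rfl⟩ := hw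
  refine ⟨σ.trans ⟨a, fun {x y} => ?_⟩, rfl⟩
  have := obfuscate_adj a g x y
  rwa [ha] at this

/-- Every rule can be turned into a scheme, with the losses of the rule for other obfuscating
functions. -/
theorem exists_isVNScheme (Θ : RankingRule n) : ∃ Ψ : RankingRule n, IsVNScheme Ψ ∧
    ∀ g₁ g₂ V o, ∃ o' : Equiv.Perm (Fin n), ∀ v,
      Ψ g₁ (obfuscate o g₂) V (o v) = Θ g₁ (obfuscate o' g₂) V (o' v) := by
  let rep : SimpleGraph (Fin n) → SimpleGraph (Fin n) := fun h =>
    (Quotient.mk (obfuscationSetoid n) h).out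
  have hrep : ∀ h, ∃ a, obfuscate a h = rep h := fun h =>
    (obfuscationSetoid n).symm (Quotient.mk_out (s := obfuscationSetoid n) h)
  have hrep_eq : ∀ o g, rep (obfuscate o g) = rep g := fun o g => by
    have : Quotient.mk (obfuscationSetoid n) g = Quotient.mk (obfuscationSetoid n)
      (obfuscate o g) := Quotient.sound ⟨o, rfl⟩
    simp only [rep, this]
  choose a ha using hrep
  have hq : ∀ o g, obfuscate (a (obfuscate o g) * o) g = rep g := fun o g => by
    rw [obfuscate_mul, ha, hrep_eq]
  -- The graph is renamed to the representative of its isomorphism class before `Θ` is applied. Two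
  -- obfuscations reach the representative by maps that differ by an automorphism of g₂, which
  -- preserves every orbit; hence the rank sets agree.
  refine ⟨fun g₁ h V => (a h).trans (Θ g₁ (rep h) V), ?_, ?_⟩
  · intro g₁ g₂ V
    have hsub : ∀ o₁ o₂ u, rankSet (fun g₁ h V => (a h).trans (Θ g₁ (rep h) V)) g₁ g₂ o₁ V
        (orbit g₂ u) ⊆ rankSet (fun g₁ h V => (a h).trans (Θ g₁ (rep h) V)) g₁ g₂ o₂ V
          (orbit g₂ u) := by
      rintro o₁ o₂ u _ ⟨w, hw, rfl⟩
      set q₁ := a (obfuscate o₁ g₂) * o₁ with hq₁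
      set q₂ := a (obfuscate o₂ g₂) * o₂ with hq₂
      have haut : obfuscate (q₂⁻¹ * q₁) g₂ = g₂ := by
        rw [obfuscate_mul, hq₁, hq, ← hq o₂, ← obfuscate_mul, ← hq₂, inv_mul_cancel,
          obfuscate_one]
      refine ⟨(q₂⁻¹ * q₁) w, orbit_mem_of_obfuscate_eq haut hw, ?_⟩
      have h1 : q₂ ((q₂⁻¹ * q₁) w) = q₁ w := by simp
      have h2 : a (obfuscate o₂ g₂) (o₂ ((q₂⁻¹ * q₁) w)) = a (obfuscate o₁ g₂) (o₁ w) := h1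
      simp only [Equiv.trans_apply, hrep_eq, h2]
    exact fun o₁ o₂ u => Set.Subset.antisymm (hsub o₁ o₂ u) (hsub o₂ o₁ u)
  · intro g₁ g₂ V o
    refine ⟨a (obfuscate o g₂) * o, fun v => ?_⟩
    simp only [Equiv.trans_apply, hq, hrep_eq, Equiv.Perm.mul_apply]

/-- Here `o'` depends on g₂, hence on the outcome, so only loss bounds for `Θ` that are uniform in
the obfuscation carry over to the scheme. -/
theorem exists_isVNScheme_losses (Θ : RankingRule n) : ∃ Ψ : RankingRule n, IsVNScheme Ψ ∧
    ∀ g₁ g₂ V o, ∃ o' : Equiv.Perm (Fin n), ∀ k,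
      recallLoss Ψ g₁ g₂ o V k = recallLoss Θ g₁ g₂ o' V k ∧
      precisionLoss Ψ g₁ g₂ o V k = precisionLoss Θ g₁ g₂ o' V k := by
  obtain ⟨Ψ, h, h'⟩ := exists_isVNScheme Θ
  refine ⟨Ψ, h, fun g₁ g₂ V o => ?_⟩
  obtain ⟨o', ho'⟩ := h' g₁ g₂ V o
  exact ⟨o', fun k => by simp only [recallLoss, precisionLoss, ho', and_self]⟩

end Scheme

end VertexNomination

namespace VertexNomination

/-! ### High probability events of the two-block model -/

/-- Expectation over all vertex and pair states. -/
noncomputable def Params.expect (θ : Params) {n : ℕ} (f : Outcome n → ℝ) : ℝ :=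
  ∑ ω, θ.weight ω * f ω

/-- Laws of the pair states, given the vertex states. -/
def Params.pairLaw (θ : Params) {n : ℕ} (y : Fin n → VertexState) (e : Sym2 (Fin n)) :
    PairState → ℝ :=
  θ.pairWeight (θ.pairProb (fun v => (y v).1) e)

section Whp

variable (θ : Params) {n : ℕ}

theorem Params.vertexWeight_pos (s : VertexState) : 0 < θ.vertexWeight s := by
  have h1 := θ.piPlus_mem
  have h2 := θ.piMinus_mem
  have hb : ∀ {a : ℝ}, a ∈ Set.Ioo (0 : ℝ) 1 → ∀ x, 0 < bern a x := by
    intro a ha x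
    cases x <;> simp [bern, ha.1, ha.2]
  exact mul_pos (mul_pos (by norm_num) (hb h1 _)) (hb h2 _)

theorem Params.pairLaw_nonneg (y : Fin n → VertexState) (e : Sym2 (Fin n)) (s : PairState) :
    0 ≤ θ.pairLaw y e s := by
  have h := θ.pairProb_mem (fun v => (y v).1) e
  exact mul_nonneg (mul_nonneg (corrBern_nonneg h.1 h.2 θ.rho_pos.le θ.rho_le_one _ _)
    (bern_nonneg θ.sPlus_mem.1 θ.sPlus_mem.2 _)) (bern_nonneg θ.sMinus_mem.1 θ.sMinus_mem.2 _)

theorem Params.sum_pairLaw (y : Fin n → VertexState) (e : Sym2 (Fin n)) :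
    ∑ s, θ.pairLaw y e s = 1 := θ.sum_pairWeight _

theorem Params.expect_eq (f : Outcome n → ℝ) : θ.expect f =
    prodExpect (fun _ => θ.vertexWeight)
      (fun y => prodExpect (θ.pairLaw y) (fun x => f (y, x))) := by
  simp only [Params.expect, prodExpect, Params.weight, Fintype.sum_prod_type, Finset.mul_sum,
    mul_assoc, Params.pairLaw]

theorem Params.expect_mono {f g : Outcome n → ℝ} (h : ∀ ω, f ω ≤ g ω) :
    θ.expect f ≤ θ.expect g :=
  Finset.sum_le_sum fun ω _ => mul_le_mul_of_nonneg_left (h ω) (θ.weight_nonneg ω)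

theorem Params.expect_add (f g : Outcome n → ℝ) :
    θ.expect (fun ω => f ω + g ω) = θ.expect f + θ.expect g := by
  simp only [Params.expect, mul_add, Finset.sum_add_distrib]

theorem Params.expect_const (c : ℝ) : θ.expect (fun _ : Outcome n => c) = c := by
  simp only [Params.expect]
  rw [← Finset.sum_mul, θ.sum_weight, one_mul]

theorem Params.expect_const_mul (c : ℝ) (f : Outcome n → ℝ) :
    θ.expect (fun ω => c * f ω) = c * θ.expect f := by
  simp only [Params.expect, Finset.mul_sum]
  exact Finset.sum_congr rfl fun x _ => by ring

theorem Params.expect_nonneg {f : Outcome n → ℝ} (h : ∀ ω, 0 ≤ f ω) : 0 ≤ θ.expect f :=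
  Finset.sum_nonneg fun ω _ => mul_nonneg (θ.weight_nonneg ω) (h ω)

open Classical in
/-- The events `E n` hold with probability tending to one. -/
def Whp (E : ∀ n, Outcome n → Prop) : Prop :=
  Tendsto (fun n => θ.expect fun ω : Outcome n => if E n ω then (0 : ℝ) else 1) atTop (𝓝 0)

variable {θ}

theorem Whp.mono {E E' : ∀ n, Outcome n → Prop} (h : Whp θ E)
    (h' : ∀ᶠ n in atTop, ∀ ω, E n ω → E' n ω) : Whp θ E' := by
  refine squeeze_zero' (Eventually.of_forall fun n => θ.expect_nonneg fun ω => ?_) ?_ h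
  · split_ifs <;> norm_num
  · filter_upwards [h'] with n hn
    refine θ.expect_mono fun ω => ?_
    by_cases h1 : E n ω
    · simp [h1, hn ω h1]
    · rw [if_neg h1]; split_ifs <;> norm_num

theorem Whp.and {E E' : ∀ n, Outcome n → Prop} (h : Whp θ E) (h' : Whp θ E') :
    Whp θ fun n ω => E n ω ∧ E' n ω := by
  have h2 := Tendsto.add h h'
  rw [add_zero] at h2
  refine squeeze_zero (fun n => θ.expect_nonneg fun ω => ?_) (fun n => ?_) h2
  · split_ifs <;> norm_num
  · rw [← θ.expect_add]
    refine θ.expect_mono fun ω => ?_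
    by_cases h1 : E n ω <;> by_cases h2 : E' n ω <;> simp [h1, h2]

theorem Whp.forall_finset {κ : Type*} (s : Finset κ) {E : κ → ∀ n, Outcome n → Prop}
    (h : ∀ k ∈ s, Whp θ (E k)) : Whp θ fun n ω => ∀ k ∈ s, E k n ω := by
  classical
  induction s using Finset.induction_on with
  | empty => simp [Whp, Params.expect]
  | insert a s _ ih =>
    refine ((h a (Finset.mem_insert_self a s)).and
      (ih fun k hk => h k (Finset.mem_insert_of_mem hk))).mono (Eventually.of_forall ?_)
    intro n ω hω k hk
    rcases Finset.mem_insert.1 hk with rfl | hk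
    · exact hω.1
    · exact hω.2 k hk

theorem Whp.forall {κ : Type*} [Fintype κ] {E : κ → ∀ n, Outcome n → Prop}
    (h : ∀ k, Whp θ (E k)) : Whp θ fun n ω => ∀ k, E k n ω :=
  (Whp.forall_finset Finset.univ fun k _ => h k).mono
    (Eventually.of_forall fun _ _ hω k => hω k (Finset.mem_univ k))

open Classical in
theorem whp_of_vertex {E : ∀ n, (Fin n → VertexState) → Prop} {b : ℕ → ℝ}
    (hb : Tendsto b atTop (𝓝 0))
    (h : ∀ n, prodExpect (fun _ => θ.vertexWeight) (fun y => if E n y then (0 : ℝ) else 1) ≤ b n) :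
    Whp θ fun n ω => E n ω.1 := by
  refine squeeze_zero (fun n => θ.expect_nonneg fun ω => ?_) (fun n => ?_) hb
  · split_ifs <;> norm_num
  · rw [θ.expect_eq]
    refine le_trans (le_of_eq ?_) (h n)
    congr 1
    funext y
    exact prodExpect_const (θ.sum_pairLaw y) (if E n y then (0 : ℝ) else 1)

-- Given the vertex states the pairs are independent; a conditional failure bound that is uniform in
-- these states survives averaging.
open Classical in
theorem whp_of_pair {E : ∀ n, Outcome n → Prop} {b : ℕ → ℝ} (hb : Tendsto b atTop (𝓝 0))
    (h : ∀ᶠ n in atTop, ∀ y : Fin n → VertexState,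
      prodExpect (θ.pairLaw y) (fun x => if E n (y, x) then (0 : ℝ) else 1) ≤ b n) :
    Whp θ E := by
  refine squeeze_zero' (Eventually.of_forall fun n => θ.expect_nonneg fun ω => ?_) ?_ hb
  · split_ifs <;> norm_num
  · filter_upwards [h] with n hn
    rw [θ.expect_eq, ← prodExpect_const (w := fun _ : Fin n => θ.vertexWeight)
      (fun _ => θ.sum_vertexWeight) (b n)]
    exact prodExpect_mono (fun _ s => (θ.vertexWeight_pos s).le) hn

/-- A loss in [0, 1] has mean at most ε plus the probability that it exceeds ε. -/
theorem tendsto_expect_of_whp {f : ∀ n, Outcome n → ℝ} (h0 : ∀ n ω, 0 ≤ f n ω)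
    (h1 : ∀ n ω, f n ω ≤ 1) (h : ∀ ε : ℝ, 0 < ε → Whp θ fun n ω => f n ω ≤ ε) :
    Tendsto (fun n => θ.expect (f n)) atTop (𝓝 0) := by
  classical
  rw [Metric.tendsto_atTop]
  intro ε hε
  obtain ⟨N, hN⟩ := Metric.tendsto_atTop.1 (h (ε / 2) (by positivity)) (ε / 2) (by positivity)
  refine ⟨N, fun n hn => ?_⟩
  have h2 := hN n hn
  rw [Real.dist_eq, sub_zero] at h2 ⊢
  rw [abs_of_nonneg (θ.expect_nonneg (h0 n))]
  have h3 : θ.expect (f n) ≤ θ.expect (fun ω => ε / 2 + if f n ω ≤ ε / 2 then (0 : ℝ) else 1) := by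
    refine θ.expect_mono fun ω => ?_
    split_ifs with h
    · linarith
    · linarith [h1 n ω]
  rw [θ.expect_add, θ.expect_const] at h3
  have h4 := (le_abs_self _).trans_lt h2
  refine h3.trans_lt ?_
  have h5 : θ.expect (fun ω : Outcome n => if f n ω ≤ ε / 2 then (0 : ℝ) else 1) < ε / 2 := by
    convert h4
  linarith

theorem eventually_le_expect_of_whp {f : ∀ n, Outcome n → ℝ} (h0 : ∀ n ω, 0 ≤ f n ω)
    {c : ℝ} (hc : 0 < c) (h : Whp θ fun n ω => c ≤ f n ω) :
    ∀ᶠ n in atTop, c / 2 ≤ θ.expect (f n) := by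
  classical
  have h1 : Tendsto (fun n => c - c * θ.expect fun ω : Outcome n => if c ≤ f n ω then (0 : ℝ) else 1)
      atTop (𝓝 (c - c * 0)) := by
    refine tendsto_const_nhds.sub (Tendsto.const_mul c ?_)
    unfold Whp at h
    convert h
  rw [mul_zero, sub_zero] at h1
  filter_upwards [h1.eventually (lt_mem_nhds (half_lt_self hc))] with n hn
  refine hn.le.trans ?_
  have h2 : θ.expect (fun ω : Outcome n => c + (-c) * if c ≤ f n ω then (0 : ℝ) else 1) ≤
      θ.expect (f n) := by
    refine θ.expect_mono fun ω => ?_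
    split_ifs with h
    · linarith
    · linarith [h0 n ω]
  rw [θ.expect_add, θ.expect_const, θ.expect_const_mul] at h2
  linarith

open Classical in
/-- Concentration of the number of vertices with a given property. -/
theorem whp_count (P : VertexState → Prop) [DecidablePred P] (I : ∀ n, Finset (Fin n)) {ε : ℝ} (hε : 0 < ε) :
    Whp θ fun n ω => |(((I n).filter fun v => P (ω.1 v)).card : ℝ) -
      (∑ s, if P s then θ.vertexWeight s else 0) * (I n).card| ≤ ε * n := by
  have hlim : Tendsto (fun n : ℕ => 2 * Real.exp (-(ε ^ 2 / 4) * n)) atTop (𝓝 0) := by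
    have h1 : Tendsto (fun n : ℕ => -(ε ^ 2 / 4) * (n : ℝ)) atTop atBot :=
      tendsto_natCast_atTop_atTop.const_mul_atTop_of_neg (by simp; positivity)
    simpa using (Real.tendsto_exp_atBot.comp h1).const_mul 2
  refine whp_of_vertex (E := fun n y => |(((I n).filter fun v => P (y v)).card : ℝ) -
      (∑ s, if P s then θ.vertexWeight s else 0) * (I n).card| ≤ ε * n) hlim fun n => ?_
  let f : (Fin n → VertexState) → ℝ := fun y => (((I n).filter fun v => P (y v)).card : ℝ)
  have hf : ∀ y, f y = ∑ v ∈ I n, if P (y v) then (1 : ℝ) else 0 := fun y => by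
    simp [f]
  have hmean : prodExpect (fun _ => θ.vertexWeight) f =
      (∑ s, if P s then θ.vertexWeight s else 0) * (I n).card := by
    rw [show f = fun y => ∑ v ∈ I n, if P (y v) then (1 : ℝ) else 0 from funext hf,
      prodExpect_sum]
    have : ∀ v, prodExpect (fun _ : Fin n => θ.vertexWeight)
        (fun y => if P (y v) then (1 : ℝ) else 0) =
        ∑ s, if P s then θ.vertexWeight s else 0 := fun v => by
      rw [prodExpect_coord (fun _ => θ.sum_vertexWeight) v (fun s => if P s then (1 : ℝ) else 0)]
      simp
    simp only [this, Finset.sum_const, nsmul_eq_mul]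
    ring
  -- One vertex changes the count by at most 1; l = ε/2 minimises the exponent nl² − lεn, with value
  -- −(ε²/4)n.
  have htail := prodExpect_tail (w := fun _ : Fin n => θ.vertexWeight)
    (fun _ s => (θ.vertexWeight_pos s).le) (fun _ => θ.sum_vertexWeight) (c := 1) f (by
      intro y i s s'
      rw [hf, hf, ← Finset.sum_sub_distrib]
      refine (Finset.abs_sum_le_sum_abs _ _).trans ?_
      calc _ ≤ ∑ v ∈ I n, if v = i then (1 : ℝ) else 0 := by
            refine Finset.sum_le_sum fun v _ => ?_
            by_cases hv : v = i
            · subst hv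
              simp only [Function.update_self, if_true]
              split_ifs <;> norm_num
            · simp [hv]
        _ ≤ 1 := by
            rw [Finset.sum_ite_eq']
            split_ifs <;> norm_num) (l := ε / 2) (by positivity) (ε * n)
  rw [hmean] at htail
  refine le_trans (le_of_eq ?_) (htail.trans (le_of_eq ?_))
  · congr 1
    funext y
    by_cases h : |f y - (∑ s, if P s then θ.vertexWeight s else 0) * (I n).card| ≤ ε * n
    · rw [if_pos h, if_neg (not_lt.2 h)]
    · rw [if_neg h, if_pos (not_le.1 h)]
  · rw [Fintype.card_fin]
    congr 2
    ring

end Whp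

end VertexNomination

namespace VertexNomination

open Matrix

/-! ### The second graph as a function of vertex classes and pair states -/

/-- The class of a vertex for the adversary: `0` for `W₊`, `1` for `W₋`, `2` for the rest. -/
def attackClass (s : VertexState) : Fin 3 := if s.2.1 then 0 else if s.2.2 then 1 else 2

/-- The class of every vertex in the absence of an adversary. -/
def cleanClass (_ : VertexState) : Fin 3 := 2

/-- Can edges between vertices of these classes be deleted? -/
abbrev Deletable (c d : Fin 3) : Prop := (c = 1 ∧ d ≠ 0) ∨ (d = 1 ∧ c ≠ 0)

/-- Can edges between vertices of these classes be added? -/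
abbrev Addable (c d : Fin 3) : Prop := (c = 0 ∧ d ≠ 1) ∨ (d = 0 ∧ c ≠ 1)

/-- The edge indicator after the attack. -/
def edgeAfter (c d : Fin 3) (x : PairState) : Bool :=
  if Deletable c d then x.2.1 && !x.2.2.2
  else if Addable c d then x.2.1 || x.2.2.1 else x.2.1

/-- The edge probability after the attack, if it was `a` before. -/
noncomputable def Params.meanAfter (θ : Params) (a : ℝ) (c d : Fin 3) : ℝ :=
  if Deletable c d then a * (1 - θ.sMinus)
  else if Addable c d then a + (1 - a) * θ.sPlus else a

/-- The covariance of the edge indicators in the first graph and after the attack. -/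
noncomputable def Params.covAfter (θ : Params) (a : ℝ) (c d : Fin 3) : ℝ :=
  θ.rho * a * (1 - a) *
    if Deletable c d then 1 - θ.sMinus else if Addable c d then 1 - θ.sPlus else 1

theorem edgeAfter_comm (c d : Fin 3) : edgeAfter c d = edgeAfter d c := by
  funext x
  simp only [edgeAfter, or_comm]

theorem Params.meanAfter_comm (θ : Params) (a : ℝ) (c d : Fin 3) :
    θ.meanAfter a c d = θ.meanAfter a d c := by
  simp only [Params.meanAfter, or_comm]

theorem Params.covAfter_comm (θ : Params) (a : ℝ) (c d : Fin 3) :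
    θ.covAfter a c d = θ.covAfter a d c := by
  simp only [Params.covAfter, or_comm]

theorem Params.B_comm (θ : Params) (i j : Fin 2) : θ.B i j = θ.B j i := by
  by_cases h : i = j
  · rw [h]
  · simp [Params.B, h, Ne.symm h]

theorem Params.sum_edgeAfter (θ : Params) (a : ℝ) (c d : Fin 3) :
    ∑ x, θ.pairWeight a x * (if edgeAfter c d x then 1 else 0) = θ.meanAfter a c d := by
  unfold edgeAfter Params.meanAfter
  split_ifs <;> simp [Fintype.sum_prod_type, Params.pairWeight, corrBern, bern] <;> ring

theorem Params.sum_cov (θ : Params) (a : ℝ) (c d : Fin 3) :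
    ∑ x, θ.pairWeight a x * (((if x.1 then 1 else 0) - a) * (if edgeAfter c d x then 1 else 0))
      = θ.covAfter a c d := by
  unfold edgeAfter Params.covAfter
  split_ifs <;> simp [Fintype.sum_prod_type, Params.pairWeight, corrBern, bern] <;> ring

theorem Params.sum_first (θ : Params) (a : ℝ) :
    ∑ x, θ.pairWeight a x * ((if x.1 then 1 else 0) - a) = 0 := by
  simp [Fintype.sum_prod_type, Params.pairWeight, corrBern, bern]
  ring

theorem Params.B_mem (θ : Params) (i j : Fin 2) : 0 < θ.B i j ∧ θ.B i j ≤ 1 := by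
  have h1 := θ.r_pos
  have h2 := θ.r_lt_q
  have h3 := θ.q_lt_p
  have h4 := θ.p_le_one
  simp only [Params.B]
  split_ifs <;> constructor <;> linarith

theorem Params.meanAfter_mem (θ : Params) {a : ℝ} (h0 : 0 ≤ a) (h1 : a ≤ 1) (c d : Fin 3) :
    θ.meanAfter a c d ∈ Set.Icc (0 : ℝ) 1 := by
  have hp := θ.sPlus_mem
  have hm := θ.sMinus_mem
  unfold Params.meanAfter
  split_ifs
  · exact ⟨mul_nonneg h0 (by linarith [hm.2]), by nlinarith [hm.1, hm.2]⟩
  · exact ⟨by nlinarith [hp.1, hp.2], by nlinarith [hp.1, hp.2]⟩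
  · exact ⟨h0, h1⟩

theorem Params.covAfter_nonneg (θ : Params) {a : ℝ} (h0 : 0 ≤ a) (h1 : a ≤ 1) (c d : Fin 3) :
    0 ≤ θ.covAfter a c d := by
  have hp := θ.sPlus_mem
  have hm := θ.sMinus_mem
  have h : 0 ≤ θ.rho * a * (1 - a) :=
    mul_nonneg (mul_nonneg θ.rho_pos.le h0) (by linarith)
  refine mul_nonneg h ?_
  split_ifs
  · linarith [hm.2]
  · linarith [hp.2]
  · norm_num

section Graph

variable {n : ℕ} (cl : VertexState → Fin 3)

/-- The edge indicator of an unordered pair, as a function of the state of the pair. -/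
def pairEdge (y : Fin n → VertexState) : Sym2 (Fin n) → PairState → Bool :=
  Sym2.lift ⟨fun u v => edgeAfter (cl (y u)) (cl (y v)), fun _ _ => edgeAfter_comm _ _⟩

/-- The edge probability of an unordered pair. -/
noncomputable def Params.pairMean (θ : Params) (y : Fin n → VertexState) : Sym2 (Fin n) → ℝ :=
  Sym2.lift ⟨fun u v => θ.meanAfter (θ.B (y u).1 (y v).1) (cl (y u)) (cl (y v)), fun u v => by
    simp only [θ.meanAfter_comm _ (cl (y u)), θ.B_comm (y u).1]⟩

/-- The covariance of the edge indicators of an unordered pair. -/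
noncomputable def Params.pairCov (θ : Params) (y : Fin n → VertexState) : Sym2 (Fin n) → ℝ :=
  Sym2.lift ⟨fun u v => θ.covAfter (θ.B (y u).1 (y v).1) (cl (y u)) (cl (y v)), fun u v => by
    simp only [θ.covAfter_comm _ (cl (y u)), θ.B_comm (y u).1]⟩

/-- The second graph, for the given classes. -/
def classGraph (ω : Outcome n) : SimpleGraph (Fin n) :=
  graphOf fun e => pairEdge cl ω.1 e (ω.2 e)

theorem secondGraph_eq (ω : Outcome n) : secondGraph ω = classGraph cleanClass ω := by
  ext u v
  simp [secondGraph, classGraph, graphOf, pairEdge, edgeAfter, cleanClass]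

theorem mem_plusSet_iff (ω : Outcome n) (v : Fin n) :
    v ∈ plusSet ω ↔ attackClass (ω.1 v) = 0 := by
  simp only [plusSet, attackClass, Set.mem_ofPred_eq]
  split_ifs <;> simp_all

theorem mem_minusSet_iff (ω : Outcome n) (v : Fin n) :
    v ∈ minusSet ω ↔ attackClass (ω.1 v) = 1 := by
  simp only [minusSet, plusSet, attackClass, Set.mem_ofPred_eq]
  split_ifs <;> simp_all

/-- No pair of classes is both deletable and addable, so the order in which `edgeAfter` tests the
two conditions is immaterial. -/
theorem attackedGraph_eq (ω : Outcome n) : attackedGraph ω = classGraph attackClass ω := by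
  ext u v
  simp only [attackedGraph, contaminate, classGraph, graphOf, pairEdge, secondGraph,
    Sym2.lift_mk, mem_plusSet_iff, mem_minusSet_iff]
  generalize attackClass (ω.1 u) = c
  generalize attackClass (ω.1 v) = d
  generalize ω.2 s(u, v) = x
  obtain ⟨x1, x2, x3, x4⟩ := x
  by_cases huv : u = v
  · simp [huv]
  · simp only [huv, ne_eq, not_false_eq_true, true_and]
    change (x2 = true ∧ ¬(Deletable c d ∧ x4 = true)) ∨
      (¬x2 = true ∧ Addable c d ∧ x3 = true) ↔ edgeAfter c d (x1, x2, x3, x4) = true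
    have hex : Deletable c d → ¬ Addable c d := by
      clear huv
      revert c d
      decide
    unfold edgeAfter
    by_cases hd : Deletable c d
    · simp only [hd, hex hd, if_true]
      cases x2 <;> simp
    · by_cases ha : Addable c d
      · simp only [hd, ha, if_true, if_false]
        cases x2 <;> simp
      · simp only [hd, ha, if_false]
        cases x2 <;> simp

theorem Params.sum_pairEdge (θ : Params) (y : Fin n → VertexState) (e : Sym2 (Fin n)) :
    ∑ x, θ.pairLaw y e x * (if pairEdge cl y e x then 1 else 0) = θ.pairMean cl y e := by
  induction e using Sym2.ind with
  | _ u v => exact θ.sum_edgeAfter _ _ _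

theorem Params.sum_pairCov (θ : Params) (y : Fin n → VertexState) (e : Sym2 (Fin n)) :
    ∑ x, θ.pairLaw y e x * (((if x.1 then 1 else 0) - θ.pairProb (fun v => (y v).1) e) *
      (if pairEdge cl y e x then 1 else 0)) = θ.pairCov cl y e := by
  induction e using Sym2.ind with
  | _ u v => exact θ.sum_cov _ _ _

theorem Params.pairMean_mem (θ : Params) (y : Fin n → VertexState) (e : Sym2 (Fin n)) :
    θ.pairMean cl y e ∈ Set.Icc (0 : ℝ) 1 := by
  induction e using Sym2.ind with
  | _ u v => exact θ.meanAfter_mem (θ.B_mem _ _).1.le (θ.B_mem _ _).2 _ _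

theorem Params.pairCov_nonneg (θ : Params) (y : Fin n → VertexState) (e : Sym2 (Fin n)) :
    0 ≤ θ.pairCov cl y e := by
  induction e using Sym2.ind with
  | _ u v => exact θ.covAfter_nonneg (θ.B_mem _ _).1.le (θ.B_mem _ _).2 _ _

/-! ### The deviation of the adjacency matrix from its mean -/

/-- Adjacency matrix minus mean; the mean is also subtracted on the diagonal. -/
noncomputable def Params.deviation (θ : Params) (ω : Outcome n) : Matrix (Fin n) (Fin n) ℝ :=
  Matrix.of fun i j => (if i ≠ j ∧ pairEdge cl ω.1 s(i, j) (ω.2 s(i, j)) then 1 else 0) -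
    θ.pairMean cl ω.1 s(i, j)

-- Subtracting the mean on the diagonal as well makes the mean matrix exactly a block matrix, at the
-- price of uncentred diagonal entries.
open Classical in
theorem Params.deviation_eq (θ : Params) (ω : Outcome n) : θ.deviation cl ω =
    (classGraph cl ω).adjMatrix ℝ - blockMatrix
      (fun a b : Fin 2 × Fin 3 => θ.meanAfter (θ.B a.1 b.1) a.2 b.2)
      (fun v => ((ω.1 v).1, cl (ω.1 v))) := by
  ext i j
  rw [Matrix.sub_apply, SimpleGraph.adjMatrix_apply, Params.deviation, Matrix.of_apply]
  exact congrArg₂ _ (if_congr Iff.rfl rfl rfl) rfl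

theorem Params.deviation_symm (θ : Params) (ω : Outcome n) (i j : Fin n) :
    θ.deviation cl ω i j = θ.deviation cl ω j i := by
  simp only [Params.deviation, Matrix.of_apply, Sym2.eq_swap (a := i), ne_comm (a := i)]

theorem Params.abs_deviation_le (θ : Params) (ω : Outcome n) (i j : Fin n) :
    |θ.deviation cl ω i j| ≤ 1 := by
  have h := θ.pairMean_mem cl ω.1 s(i, j)
  simp only [Params.deviation, Matrix.of_apply]
  rw [abs_le]
  split_ifs <;> constructor <;> linarith [h.1, h.2]

theorem Params.deviation_update (θ : Params) (y : Fin n → VertexState)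
    (x : Sym2 (Fin n) → PairState) {e : Sym2 (Fin n)} (s : PairState) {i j : Fin n}
    (h : s(i, j) ≠ e) :
    θ.deviation cl (y, Function.update x e s) i j = θ.deviation cl (y, x) i j := by
  simp only [Params.deviation, Matrix.of_apply, Function.update_of_ne h]

/-- The four factors run along the closed walk i, k, j, l, i. Unless two of the listed indices
coincide, the pair {i, k} is off-diagonal and differs from the other three, so its centred entry
makes the mean vanish. The exceptional products are bounded by 1. -/
theorem Params.expect_deviation_prod (θ : Params) (y : Fin n → VertexState) (i j k l : Fin n) :
    prodExpect (θ.pairLaw y) (fun x => θ.deviation cl (y, x) i k * (θ.deviation cl (y, x) k j *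
      (θ.deviation cl (y, x) i l * θ.deviation cl (y, x) l j))) ≤
      (if i = k then 1 else 0) + (if i = j then 1 else 0) + (if k = l then 1 else 0) +
        (if i = l then 1 else 0) := by
  by_cases h : i = k ∨ i = j ∨ k = l ∨ i = l
  · have h1 : prodExpect (θ.pairLaw y) (fun x => θ.deviation cl (y, x) i k *
        (θ.deviation cl (y, x) k j *
          (θ.deviation cl (y, x) i l * θ.deviation cl (y, x) l j))) ≤ 1 := by
      rw [← prodExpect_const (θ.sum_pairLaw y) 1]
      refine prodExpect_mono (θ.pairLaw_nonneg y) fun x => (le_abs_self _).trans ?_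
      rw [abs_mul, abs_mul, abs_mul]
      have ha := θ.abs_deviation_le cl (y, x)
      exact mul_le_one₀ (ha _ _) (by positivity) (mul_le_one₀ (ha _ _) (by positivity)
        (mul_le_one₀ (ha _ _) (by positivity) (ha _ _)))
    refine h1.trans ?_
    split_ifs <;> first | (exfalso; tauto) | norm_num
  · push Not at h
    obtain ⟨hik, hij, hkl, hil⟩ := h
    have h0 : prodExpect (θ.pairLaw y) (fun x => θ.deviation cl (y, x) i k *
        (θ.deviation cl (y, x) k j *
          (θ.deviation cl (y, x) i l * θ.deviation cl (y, x) l j))) = 0 := by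
      have hdev : ∀ x, θ.deviation cl (y, x) i k =
          (fun s => (if pairEdge cl y s(i, k) s then (1 : ℝ) else 0) - θ.pairMean cl y s(i, k))
            (x s(i, k)) := fun x => by
        simp [Params.deviation, hik]
      simp only [hdev]
      refine prodExpect_mul_eq_zero (θ.sum_pairLaw y) (e := s(i, k))
        (φ := fun s => (if pairEdge cl y s(i, k) s then (1 : ℝ) else 0) -
          θ.pairMean cl y s(i, k)) ?_ ?_
      · simp only [mul_sub, Finset.sum_sub_distrib, θ.sum_pairEdge cl]
        rw [← Finset.sum_mul, θ.sum_pairLaw, one_mul, sub_self]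
      · intro x s
        rw [θ.deviation_update, θ.deviation_update, θ.deviation_update]
        · intro h; rcases Sym2.eq_iff.1 h with h | h
          · exact hil h.1.symm
          · exact hkl h.1.symm
        · intro h; rcases Sym2.eq_iff.1 h with h | h
          · exact hkl h.2.symm
          · exact hik h.1
        · intro h; rcases Sym2.eq_iff.1 h with h | h
          · exact hik h.1.symm
          · exact hij h.2.symm
    rw [h0]
    positivity

/-- The sum is the trace of the fourth power of the deviation; each of the four coincidences leaves
three free indices. -/
theorem Params.expect_deviation_sq (θ : Params) (y : Fin n → VertexState) :
    prodExpect (θ.pairLaw y) (fun x => ∑ i, ∑ j,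
      (∑ k, θ.deviation cl (y, x) i k * θ.deviation cl (y, x) k j) ^ 2) ≤ 4 * (n : ℝ) ^ 3 := by
  have h1 : ∀ x, ∑ i, ∑ j, (∑ k, θ.deviation cl (y, x) i k * θ.deviation cl (y, x) k j) ^ 2 =
      ∑ i, ∑ j, ∑ k, ∑ l, θ.deviation cl (y, x) i k * (θ.deviation cl (y, x) k j *
      (θ.deviation cl (y, x) i l * θ.deviation cl (y, x) l j)) := fun x => by
    refine Finset.sum_congr rfl fun i _ => Finset.sum_congr rfl fun j _ => ?_
    rw [pow_two, Finset.sum_mul_sum]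
    exact Finset.sum_congr rfl fun k _ => Finset.sum_congr rfl fun l _ => by ring
  simp only [h1, prodExpect_sum]
  calc _ ≤ ∑ i : Fin n, ∑ j : Fin n, ∑ k : Fin n, ∑ l : Fin n,
        ((if i = k then 1 else 0) + (if i = j then 1 else 0) + (if k = l then 1 else 0) +
        (if i = l then (1 : ℝ) else 0)) :=
      Finset.sum_le_sum fun i _ => Finset.sum_le_sum fun j _ => Finset.sum_le_sum fun k _ =>
        Finset.sum_le_sum fun l _ => θ.expect_deviation_prod cl y i j k l
    _ = _ := by
      simp [Finset.sum_add_distrib]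
      ring

end Graph

/-- By symmetry |Ex|² = ⟨x, E²x⟩, and E² is bounded by its Frobenius norm. -/
theorem opBound_of_sum_sq {n : ℕ} {E : Matrix (Fin n) (Fin n) ℝ} (hE : ∀ i j, E i j = E j i)
    {D : ℝ} (h : ∑ i, ∑ j, (∑ k, E i k * E k j) ^ 2 ≤ D ^ 4) : OpBound E D := by
  intro x
  have hsymm : Eᵀ = E := by ext i j; exact hE j i
  have h0 := dotProduct_self_nonneg' x
  have h1 : (E *ᵥ x) ⬝ᵥ (E *ᵥ x) = x ⬝ᵥ ((E * E) *ᵥ x) := by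
    rw [← Matrix.mulVec_mulVec, Matrix.dotProduct_mulVec x, ← Matrix.mulVec_transpose, hsymm]
  have h2 : ((E * E) *ᵥ x) ⬝ᵥ ((E * E) *ᵥ x) ≤ D ^ 4 * (x ⬝ᵥ x) := by
    refine le_trans ?_ (mul_le_mul_of_nonneg_right h h0)
    rw [Finset.sum_mul]
    refine Finset.sum_le_sum fun i _ => ?_
    have h3 := dotProduct_sq_le ((E * E) i) x
    rw [pow_two] at h3
    refine h3.trans_eq ?_
    congr 1
    exact Finset.sum_congr rfl fun j _ => by rw [Matrix.mul_apply, pow_two]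
  refine (abs_le_of_sq_le_sq (b := D ^ 2 * (x ⬝ᵥ x)) ?_ (by positivity)).trans' (le_abs_self _)
  rw [h1]
  refine (dotProduct_sq_le _ _).trans ?_
  calc _ ≤ (x ⬝ᵥ x) * (D ^ 4 * (x ⬝ᵥ x)) := mul_le_mul_of_nonneg_left h2 h0
    _ = _ := by ring

-- Markov's inequality bounds the failure probability by 4n³/(δn)⁴ = 4/(δ⁴n).
open Classical in
theorem whp_opBound (θ : Params) (cl : VertexState → Fin 3) {δ : ℝ} (hδ : 0 < δ) :
    Whp θ fun n ω => OpBound (θ.deviation cl ω) (δ * n) := by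
  have hlim : Tendsto (fun n : ℕ => (4 / δ ^ 4) / (n : ℝ)) atTop (𝓝 0) :=
    tendsto_const_nhds.div_atTop tendsto_natCast_atTop_atTop
  refine whp_of_pair hlim ?_
  filter_upwards [eventually_gt_atTop 0] with n hn y
  have hn' : (0 : ℝ) < n := by exact_mod_cast hn
  have h1 : prodExpect (θ.pairLaw y) (fun x => if OpBound (θ.deviation cl (y, x)) (δ * n)
      then (0 : ℝ) else 1) ≤ prodExpect (θ.pairLaw y) (fun x => (1 / (δ * n) ^ 4) * ∑ i, ∑ j,
      (∑ k, θ.deviation cl (y, x) i k * θ.deviation cl (y, x) k j) ^ 2) := by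
    refine prodExpect_mono (θ.pairLaw_nonneg y) fun x => ?_
    by_cases h : OpBound (θ.deviation cl (y, x)) (δ * n)
    · rw [if_pos h]; positivity
    · rw [if_neg h, one_div, inv_mul_eq_div, le_div_iff₀ (by positivity), one_mul]
      by_contra hcon
      exact h (opBound_of_sum_sq (θ.deviation_symm cl _) (not_le.1 hcon).le)
  refine h1.trans ?_
  rw [prodExpect_const_mul]
  calc _ ≤ (1 / (δ * n) ^ 4) * (4 * (n : ℝ) ^ 3) :=
        mul_le_mul_of_nonneg_left (θ.expect_deviation_sq cl y) (by positivity)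
    _ = _ := by field_simp

end VertexNomination

namespace VertexNomination

/-! ### Nomination by matching the graphs -/

open Classical in
/-- Edge indicator. -/
noncomputable def edgeInd {n : ℕ} (g : SimpleGraph (Fin n)) (e : Sym2 (Fin n)) : ℝ :=
  if e ∈ g.edgeSet then 1 else 0

/-- Empirical covariance of the first graph and the second graph pulled back by `σ`. -/
noncomputable def Params.matchScore (θ : Params) {n : ℕ} (g₁ h : SimpleGraph (Fin n))
    (V : Finset (Fin n)) (σ : Equiv.Perm (Fin n)) : ℝ :=
  ∑ e, (edgeInd g₁ e - θ.pairProb (fun v => if v ∈ V then 0 else 1) e) * edgeInd h (e.map σ)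

theorem Params.exists_best_match (θ : Params) {n : ℕ} (g₁ h : SimpleGraph (Fin n))
    (V : Finset (Fin n)) :
    ∃ σ, ∀ σ', θ.matchScore g₁ h V σ' ≤ θ.matchScore g₁ h V σ :=
  Finite.exists_max (θ.matchScore g₁ h V)

/-- The rule that ranks the best match of the vertices of interest first. -/
noncomputable def Params.matchRule (θ : Params) (n : ℕ) : RankingRule n := fun g₁ h V =>
  groupFirst (V.map (θ.exists_best_match g₁ h V).choose.toEmbedding) 1 1

section Match

variable (θ : Params) {n : ℕ} (cl : VertexState → Fin 3)

/-- Obfuscation merely translates the group of candidate matchings, so what is proved about the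
original graph applies to every obfuscation. -/
theorem matchScore_obfuscate (g₁ g₂ : SimpleGraph (Fin n)) (V : Finset (Fin n))
    (o σ : Equiv.Perm (Fin n)) :
    θ.matchScore g₁ (obfuscate o g₂) V σ = θ.matchScore g₁ g₂ V (o⁻¹ * σ) := by
  refine Finset.sum_congr rfl fun e _ => ?_
  have h : e.map σ ∈ (obfuscate o g₂).edgeSet ↔ e.map (o⁻¹ * σ) ∈ g₂.edgeSet := by
    induction e using Sym2.ind with
    | _ u v =>
      simp only [Sym2.map_mk, SimpleGraph.mem_edgeSet]
      rw [← obfuscate_adj o g₂]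
      simp
  congr 1
  unfold edgeInd
  by_cases hh : e.map (o⁻¹ * σ) ∈ g₂.edgeSet
  · rw [if_pos hh, if_pos (h.2 hh)]
  · rw [if_neg hh, if_neg fun h' => hh (h.1 h')]

/-- The match score in terms of the pair states. -/
noncomputable def Params.score (y : Fin n → VertexState) (σ : Equiv.Perm (Fin n))
    (x : Sym2 (Fin n) → PairState) : ℝ :=
  ∑ e ∈ Finset.univ.filter fun e : Sym2 (Fin n) => ¬ e.IsDiag,
    ((if (x e).1 then 1 else 0) - θ.pairProb (fun v => (y v).1) e) *
      (if pairEdge cl y (e.map σ) (x (e.map σ)) then 1 else 0)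

theorem isDiag_map_perm (σ : Equiv.Perm (Fin n)) (e : Sym2 (Fin n)) :
    (e.map σ).IsDiag ↔ e.IsDiag := by
  induction e using Sym2.ind with
  | _ u v => simp

theorem edgeInd_graphOf (x : Sym2 (Fin n) → Bool) (e : Sym2 (Fin n)) :
    edgeInd (graphOf x) e = if e.IsDiag then 0 else if x e then 1 else 0 := by
  unfold edgeInd
  induction e using Sym2.ind with
  | _ u v =>
    simp only [SimpleGraph.mem_edgeSet, graphOf, Sym2.mk_isDiag_iff]
    by_cases h : u = v <;> simp [h]

theorem matchScore_eq (ω : Outcome n) (σ : Equiv.Perm (Fin n)) :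
    θ.matchScore (firstGraph ω) (classGraph cl ω) (firstBlock ω) σ = θ.score cl ω.1 σ ω.2 := by
  have hV : (fun v => if v ∈ firstBlock ω then (0 : Fin 2) else 1) = fun v => (ω.1 v).1 := by
    funext v
    simp only [firstBlock, Finset.mem_filter, Finset.mem_univ, true_and]
    split_ifs with h
    · exact h.symm
    · omega
  rw [Params.matchScore, Params.score, Finset.sum_filter, hV]
  refine Finset.sum_congr rfl fun e _ => ?_
  rw [firstGraph, classGraph, edgeInd_graphOf, edgeInd_graphOf]
  simp only [isDiag_map_perm]
  by_cases h : e.IsDiag <;> simp [h]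

/-- The mean of the score. -/
noncomputable def Params.meanScore (y : Fin n → VertexState) (σ : Equiv.Perm (Fin n)) : ℝ :=
  ∑ e ∈ Finset.univ.filter fun e : Sym2 (Fin n) => ¬ e.IsDiag,
    if e.map σ = e then θ.pairCov cl y e else 0

theorem Params.sum_first_pairLaw (y : Fin n → VertexState) (e : Sym2 (Fin n)) :
    ∑ s, θ.pairLaw y e s * ((if s.1 then 1 else 0) - θ.pairProb (fun v => (y v).1) e) = 0 :=
  θ.sum_first _

/-- If σ moves e, the centred indicator of e in the first graph is independent of the second-graph
indicator at σ(e); only fixed pairs retain their covariance. -/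
theorem prodExpect_score (y : Fin n → VertexState) (σ : Equiv.Perm (Fin n)) :
    prodExpect (θ.pairLaw y) (θ.score cl y σ) = θ.meanScore cl y σ := by
  unfold Params.score Params.meanScore
  rw [prodExpect_sum]
  refine Finset.sum_congr rfl fun e _ => ?_
  by_cases h : e.map σ = e
  · rw [if_pos h, h, ← θ.sum_pairCov]
    exact prodExpect_coord (θ.sum_pairLaw y) e fun s =>
      ((if s.1 then 1 else 0) - θ.pairProb (fun v => (y v).1) e) *
        (if pairEdge cl y e s then 1 else 0)
  · rw [if_neg h]
    refine prodExpect_mul_eq_zero (θ.sum_pairLaw y) (e := e)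
      (φ := fun s => (if s.1 then 1 else 0) - θ.pairProb (fun v => (y v).1) e)
      (g := fun x => if pairEdge cl y (e.map σ) (x (e.map σ)) then 1 else 0)
      (θ.sum_first_pairLaw y e) fun x s => ?_
    rw [Function.update_of_ne h]

/-- The state of one pair enters at most two summands, once through the first graph and once as an
image under σ, and changes each by at most 2. -/
theorem score_bounded_differences (y : Fin n → VertexState) (σ : Equiv.Perm (Fin n))
    (x : Sym2 (Fin n) → PairState) (i : Sym2 (Fin n)) (s s' : PairState) :
    |θ.score cl y σ (Function.update x i s) - θ.score cl y σ (Function.update x i s')| ≤ 4 := by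
  unfold Params.score
  rw [← Finset.sum_sub_distrib]
  set F : PairState → Sym2 (Fin n) → ℝ := fun s e =>
    ((if (Function.update x i s e).1 then 1 else 0) - θ.pairProb (fun v => (y v).1) e) *
      (if pairEdge cl y (e.map σ) (Function.update x i s (e.map σ)) then 1 else 0) with hF
  have hterm : ∀ s e, |F s e| ≤ 1 := by
    intro s e
    have h := θ.pairProb_mem (fun v => (y v).1) e
    simp only [hF]
    rw [abs_mul]
    refine mul_le_one₀ ?_ (abs_nonneg _) ?_
    · rw [abs_le]; split_ifs <;> constructor <;> linarith [h.1, h.2]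
    · split_ifs <;> simp
  have hmap : Function.Injective fun e : Sym2 (Fin n) => e.map σ := Sym2.map.injective σ.injective
  calc _ ≤ ∑ e ∈ Finset.univ.filter (fun e : Sym2 (Fin n) => ¬ e.IsDiag), |F s e - F s' e| :=
        Finset.abs_sum_le_sum_abs _ _
    _ ≤ ∑ e, |F s e - F s' e| :=
        Finset.sum_le_sum_of_subset_of_nonneg (Finset.filter_subset _ _)
          fun _ _ _ => abs_nonneg _
    _ ≤ ∑ e, ((if e = i then (2 : ℝ) else 0) + if e.map σ = i then (2 : ℝ) else 0) := by
        refine Finset.sum_le_sum fun e _ => ?_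
        have h2 : |F s e - F s' e| ≤ 2 :=
          (abs_sub _ _).trans (by linarith [hterm s e, hterm s' e])
        by_cases h1 : e = i
        · rw [if_pos h1]
          refine h2.trans (le_add_of_nonneg_right ?_)
          split_ifs <;> norm_num
        · by_cases h3 : e.map σ = i
          · rw [if_pos h3, if_neg h1, zero_add]; exact h2
          · simp only [hF, Function.update_of_ne h1, Function.update_of_ne h3, sub_self, abs_zero,
              if_neg h1, if_neg h3, add_zero, le_refl]
    _ ≤ 4 := by
        rw [Finset.sum_add_distrib, Finset.sum_ite_eq', if_pos (Finset.mem_univ _)]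
        have h4 : ∑ e : Sym2 (Fin n), (if e.map σ = i then (2 : ℝ) else 0) ≤ 2 := by
          rw [← Finset.sum_filter, Finset.sum_const, nsmul_eq_mul]
          have : (Finset.univ.filter fun e : Sym2 (Fin n) => e.map σ = i).card ≤ 1 :=
            Finset.card_le_one.2 fun a ha b hb => hmap
              ((Finset.mem_filter.1 ha).2.trans (Finset.mem_filter.1 hb).2.symm)
          have : ((Finset.univ.filter fun e : Sym2 (Fin n) => e.map σ = i).card : ℝ) ≤ 1 := by
            exact_mod_cast this
          linarith
        linarith

theorem card_sym2_le : (Fintype.card (Sym2 (Fin n)) : ℝ) ≤ (n : ℝ) ^ 2 := by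
  have h : Fintype.card (Sym2 (Fin n)) ≤ Fintype.card (Fin n × Fin n) :=
    Fintype.card_le_of_surjective _ (Sym2.mk_surjective (α := Fin n))
  rw [Fintype.card_prod, Fintype.card_fin, ← pow_two] at h
  exact_mod_cast h

/-- This is the union bound over all permutations: n! ≤ exp(n log n), and n log n is of smaller
order than n². -/
theorem tendsto_factorial_mul_exp {κ : ℝ} (hκ : 0 < κ) :
    Tendsto (fun n : ℕ => (Nat.factorial n : ℝ) * (2 * Real.exp (-κ * (n : ℝ) ^ 2)))
      atTop (𝓝 0) := by
  have hlim : Tendsto (fun n : ℕ => 2 * Real.exp (-(κ / 2) * n)) atTop (𝓝 0) := by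
    have h1 : Tendsto (fun n : ℕ => -(κ / 2) * (n : ℝ)) atTop atBot :=
      tendsto_natCast_atTop_atTop.const_mul_atTop_of_neg (by simp; positivity)
    simpa using (Real.tendsto_exp_atBot.comp h1).const_mul 2
  have hlog := (Real.isLittleO_log_id_atTop.bound (by positivity : 0 < κ / 2)).natCast_atTop
  refine squeeze_zero' (Eventually.of_forall fun n => by positivity) ?_ hlim
  filter_upwards [hlog, eventually_ge_atTop 1] with n hn hn1
  have hn1' : (1 : ℝ) ≤ n := by exact_mod_cast hn1
  have h1 : Real.log n ≤ κ / 2 * n := by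
    refine (le_abs_self _).trans (hn.trans_eq ?_)
    rw [id, Real.norm_of_nonneg (by linarith)]
  have h2 : (Nat.factorial n : ℝ) ≤ Real.exp (n * (κ / 2 * n)) := by
    calc (Nat.factorial n : ℝ) ≤ (n : ℝ) ^ n := by exact_mod_cast Nat.factorial_le_pow n
      _ = Real.exp (n * Real.log n) := by
        rw [← Real.log_pow, Real.exp_log (by positivity)]
      _ ≤ _ := Real.exp_le_exp.2 (mul_le_mul_of_nonneg_left h1 (by linarith))
  calc _ ≤ Real.exp (n * (κ / 2 * n)) * (2 * Real.exp (-κ * (n : ℝ) ^ 2)) :=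
        mul_le_mul_of_nonneg_right h2 (by positivity)
    _ = 2 * Real.exp (-(κ / 2) * (n * n)) := by
        rw [mul_left_comm, ← Real.exp_add]; ring_nf
    _ ≤ _ := by
        refine mul_le_mul_of_nonneg_left (Real.exp_le_exp.2 ?_) (by norm_num)
        have : (n : ℝ) ≤ n * n := by nlinarith
        nlinarith

open Classical in
/-- The scores of all permutations are close to their means. -/
theorem whp_score {ε : ℝ} (hε : 0 < ε) : Whp θ fun n ω => ∀ σ : Equiv.Perm (Fin n),
    |θ.score cl ω.1 σ ω.2 - θ.meanScore cl ω.1 σ| ≤ ε * (n : ℝ) ^ 2 := by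
  refine whp_of_pair (tendsto_factorial_mul_exp (κ := ε ^ 2 / 64) (by positivity))
    (Eventually.of_forall fun n y => ?_)
  have h1 : ∀ σ : Equiv.Perm (Fin n), prodExpect (θ.pairLaw y)
      (fun x => if ε * (n : ℝ) ^ 2 < |θ.score cl y σ x - θ.meanScore cl y σ| then (1 : ℝ) else 0) ≤
      2 * Real.exp (-(ε ^ 2 / 64) * (n : ℝ) ^ 2) := by
    intro σ
    -- With differences 4, at most n² coordinates and l = ε/32, the exponent is at most (ε²/64 −
    -- ε²/32)n² = −(ε²/64)n².
    have h2 := prodExpect_tail (θ.pairLaw_nonneg y) (θ.sum_pairLaw y) (θ.score cl y σ)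
      (score_bounded_differences θ cl y σ) (l := ε / 32) (by positivity) (ε * (n : ℝ) ^ 2)
    rw [prodExpect_score] at h2
    refine h2.trans (mul_le_mul_of_nonneg_left (Real.exp_le_exp.2 ?_) (by norm_num))
    have := mul_le_mul_of_nonneg_right (card_sym2_le (n := n))
      (by positivity : 0 ≤ (ε / 32) ^ 2 * 4 ^ 2)
    nlinarith
  calc _ ≤ prodExpect (θ.pairLaw y) (fun x => ∑ σ : Equiv.Perm (Fin n),
        if ε * (n : ℝ) ^ 2 < |θ.score cl y σ x - θ.meanScore cl y σ| then (1 : ℝ) else 0) := by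
        refine prodExpect_mono (θ.pairLaw_nonneg y) fun x => ?_
        have hnn : ∀ σ ∈ (Finset.univ : Finset (Equiv.Perm (Fin n))), (0 : ℝ) ≤
            if ε * (n : ℝ) ^ 2 < |θ.score cl y σ x - θ.meanScore cl y σ| then (1 : ℝ) else 0 :=
          fun σ _ => by split_ifs <;> norm_num
        split_ifs with h
        · exact Finset.sum_nonneg hnn
        · push Not at h
          obtain ⟨σ, hσ⟩ := h
          refine le_trans ?_ (Finset.single_le_sum hnn (Finset.mem_univ σ))
          rw [if_pos hσ]
    _ ≤ ∑ σ : Equiv.Perm (Fin n), 2 * Real.exp (-(ε ^ 2 / 64) * (n : ℝ) ^ 2) := by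
        rw [prodExpect_sum]
        exact Finset.sum_le_sum fun σ _ => h1 σ
    _ = _ := by
        rw [Finset.sum_const, Finset.card_univ, Fintype.card_perm, Fintype.card_fin, nsmul_eq_mul]

/-- Every vertex state has a counterpart in the other block with unperturbed edges. -/
def HasPartners : Prop :=
  ∀ s, ∃ s' : VertexState, s'.1 ≠ s.1 ∧ ¬ Deletable (cl s) (cl s') ∧ ¬ Addable (cl s) (cl s')

/-- In the opposite block, W₊ and W₋ are partners of each other, and unselected vertices are
partners of unselected ones. -/
theorem hasPartners_attackClass : HasPartners attackClass := by
  unfold HasPartners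
  decide

theorem hasPartners_cleanClass : HasPartners cleanClass := by
  unfold HasPartners
  decide

theorem sum_sum_sym2_le (g : Sym2 (Fin n) → ℝ) (hg : ∀ e, 0 ≤ g e) :
    ∑ u, ∑ v, g s(u, v) ≤ 2 * ∑ e, g e := by
  rw [← Fintype.sum_prod_type' (f := fun u v => g s(u, v)),
    ← Finset.sum_fiberwise Finset.univ (fun a : Fin n × Fin n => s(a.1, a.2)), Finset.mul_sum]
  refine Finset.sum_le_sum fun e _ => ?_
  have h1 : ∑ a ∈ Finset.univ.filter (fun a : Fin n × Fin n => s(a.1, a.2) = e), g s(a.1, a.2)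
      = ((Finset.univ.filter fun a : Fin n × Fin n => s(a.1, a.2) = e).card : ℝ) * g e := by
    rw [← nsmul_eq_mul, ← Finset.sum_const]
    exact Finset.sum_congr rfl fun a ha => by rw [(Finset.mem_filter.1 ha).2]
  rw [h1]
  refine mul_le_mul_of_nonneg_right ?_ (hg e)
  induction e using Sym2.ind with
  | _ p q =>
    have hsub : (Finset.univ.filter fun a : Fin n × Fin n => s(a.1, a.2) = s(p, q)) ⊆
        {(p, q), (q, p)} := by
      intro a ha
      rcases Sym2.eq_iff.1 (Finset.mem_filter.1 ha).2 with h | h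
      · simp [Prod.ext_iff, h]
      · simp [Prod.ext_iff, h]
    exact_mod_cast (Finset.card_le_card hsub).trans Finset.card_le_two

theorem pairCov_of_partner {y : Fin n → VertexState} {u v : Fin n} (h : (y v).1 ≠ (y u).1)
    (hd : ¬ Deletable (cl (y u)) (cl (y v))) (ha : ¬ Addable (cl (y u)) (cl (y v))) :
    θ.pairCov cl y s(u, v) = θ.rho * θ.r * (1 - θ.r) := by
  change θ.covAfter _ _ _ = _
  rw [Params.covAfter, if_neg hd, if_neg ha, Params.B, if_neg h.symm, mul_one]

/-- A permutation whose mean score is almost maximal fixes most vertices. -/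
theorem card_moved_le {cl : VertexState → Fin 3} (hcl : HasPartners cl) {y : Fin n → VertexState}
    {c₁ : ℝ} (hc : ∀ s, c₁ * n ≤ ((Finset.univ.filter fun v => y v = s).card : ℝ))
    (σ : Equiv.Perm (Fin n)) :
    ((Finset.univ.filter fun u => σ u ≠ u).card : ℝ) *
        (θ.rho * θ.r * (1 - θ.r) * (c₁ * n - 1)) ≤
      2 * (θ.meanScore cl y 1 - θ.meanScore cl y σ) := by
  have hr1 : θ.r < 1 := by linarith [θ.r_lt_q, θ.q_lt_p, θ.p_le_one]
  have hκ : 0 < θ.rho * θ.r * (1 - θ.r) :=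
    mul_pos (mul_pos θ.rho_pos θ.r_pos) (by linarith)
  set κ := θ.rho * θ.r * (1 - θ.r) with hκdef
  let g : Sym2 (Fin n) → ℝ := fun e =>
    if ¬ e.IsDiag ∧ e.map σ ≠ e then θ.pairCov cl y e else 0
  have hg : ∀ e, 0 ≤ g e := fun e => by
    simp only [g]
    split_ifs
    · exact θ.pairCov_nonneg cl y e
    · exact le_rfl
  have hdiff : θ.meanScore cl y 1 - θ.meanScore cl y σ = ∑ e, g e := by
    unfold Params.meanScore
    rw [← Finset.sum_sub_distrib, Finset.sum_filter]
    refine Finset.sum_congr rfl fun e _ => ?_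
    simp only [g, Equiv.Perm.coe_one, Sym2.map_id, id, if_true]
    by_cases h1 : e.IsDiag <;> by_cases h2 : e.map σ = e <;> simp [h1, h2]
  rw [hdiff]
  refine le_trans ?_ (sum_sum_sym2_le g hg)
  rw [← nsmul_eq_mul, ← Finset.sum_const]
  refine (Finset.sum_le_sum fun u hu => ?_).trans
    (Finset.sum_le_sum_of_subset_of_nonneg (Finset.filter_subset _ _)
      fun u _ _ => Finset.sum_nonneg fun v _ => hg _)
  have hu' : σ u ≠ u := (Finset.mem_filter.1 hu).2
  obtain ⟨s, hs, hd, ha⟩ := hcl (y u)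
  -- As σ u ≠ u, the pair {u, v} can be fixed only if σ swaps u and v; excluding v = σ u costs one
  -- partner.
  have hsub : (Finset.univ.filter fun v => y v = s) ⊆
      insert (σ u) (Finset.univ.filter fun v => y v = s ∧ v ≠ σ u) := by
    intro v hv
    by_cases h : v = σ u
    · rw [h]; exact Finset.mem_insert_self _ _
    · exact Finset.mem_insert_of_mem
        (Finset.mem_filter.2 ⟨Finset.mem_univ _, (Finset.mem_filter.1 hv).2, h⟩)
  have hcard : c₁ * n - 1 ≤ ((Finset.univ.filter fun v => y v = s ∧ v ≠ σ u).card : ℝ) := by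
    have h1 : ((Finset.univ.filter fun v => y v = s).card : ℝ) ≤
        (Finset.univ.filter fun v => y v = s ∧ v ≠ σ u).card + 1 := by
      exact_mod_cast (Finset.card_le_card hsub).trans (Finset.card_insert_le _ _)
    linarith [hc s]
  calc κ * (c₁ * n - 1) ≤ κ * ((Finset.univ.filter fun v => y v = s ∧ v ≠ σ u).card : ℝ) :=
        mul_le_mul_of_nonneg_left hcard hκ.le
    _ = ∑ v ∈ Finset.univ.filter (fun v => y v = s ∧ v ≠ σ u), κ := by
        rw [Finset.sum_const, nsmul_eq_mul, mul_comm]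
    _ ≤ ∑ v ∈ Finset.univ.filter (fun v => y v = s ∧ v ≠ σ u), g s(u, v) := by
        refine Finset.sum_le_sum fun v hv => ?_
        obtain ⟨hvs, hvσ⟩ := (Finset.mem_filter.1 hv).2
        have huv : u ≠ v := fun h => hs (by rw [← hvs, h])
        have hmoved : (s(u, v) : Sym2 (Fin n)).map σ ≠ s(u, v) := by
          rw [Sym2.map_mk]
          intro h
          rcases Sym2.eq_iff.1 h with h | h
          · exact hu' h.1
          · exact hvσ h.1.symm
        simp only [g]
        rw [if_pos ⟨by simpa using huv, hmoved⟩,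
          pairCov_of_partner θ cl (by rw [hvs]; exact hs) (by rw [hvs]; exact hd)
            (by rw [hvs]; exact ha)]
    _ ≤ _ := Finset.sum_le_sum_of_subset_of_nonneg (Finset.filter_subset _ _) fun v _ _ => hg _

end Match

end VertexNomination

namespace VertexNomination

/-! ### The matching scheme loses nothing in the limit -/

section Bayes

variable {θ : Params}

theorem card_firstBlock_eq {n : ℕ} (ω : Outcome n) :
    firstBlock ω = Finset.univ.filter fun v => (ω.1 v).1 = 0 := rfl

theorem Params.sum_vertexWeight_block (θ : Params) :
    (∑ s : VertexState, if s.1 = 0 then θ.vertexWeight s else 0) = 1 / 2 := by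
  simp [Fintype.sum_prod_type, Params.vertexWeight, bern]
  ring

theorem whp_card_firstBlock {ε : ℝ} (hε : 0 < ε) :
    Whp θ fun n ω => |((firstBlock ω).card : ℝ) - 1 / 2 * n| ≤ ε * n := by
  refine (whp_count (fun s => s.1 = 0) (fun n => Finset.univ) hε).mono
    (Eventually.of_forall fun n ω h => ?_)
  rwa [θ.sum_vertexWeight_block, Finset.card_univ, Fintype.card_fin] at h

/-- Every vertex state is taken by a positive proportion of the vertices. -/
theorem exists_whp_states (θ : Params) : ∃ c : ℝ, 0 < c ∧ (∀ s, 2 * c ≤ θ.vertexWeight s) ∧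
    Whp θ fun n ω => ∀ s, c * n ≤ ((Finset.univ.filter fun v => ω.1 v = s).card : ℝ) := by
  obtain ⟨s₀, hs₀⟩ := Finite.exists_min θ.vertexWeight
  have hpos := θ.vertexWeight_pos s₀
  refine ⟨θ.vertexWeight s₀ / 2, by positivity, fun s => by linarith [hs₀ s],
    Whp.forall fun s => ?_⟩
  refine (whp_count (fun s' => s' = s) (fun n => Finset.univ)
    (ε := θ.vertexWeight s₀ / 2) (by positivity)).mono (Eventually.of_forall fun n ω h => ?_)
  have h1 := (abs_le.1 h).1
  rw [Finset.sum_ite_eq', if_pos (Finset.mem_univ _), Finset.card_univ, Fintype.card_fin] at h1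
  have h2 := mul_le_mul_of_nonneg_right (hs₀ s) (Nat.cast_nonneg (α := ℝ) n)
  have h3 : θ.vertexWeight s₀ / 2 * n ≤
      ((Finset.univ.filter fun v => ω.1 v = s).card : ℝ) := by
    refine le_trans ?_ (by linarith : θ.vertexWeight s * n - θ.vertexWeight s₀ / 2 * n ≤ _)
    linarith
  exact h3

/-- The best match agrees with the truth at most vertices. -/
theorem card_late_matchRule_le {cl : VertexState → Fin 3} (hcl : HasPartners cl) {n : ℕ}
    {ω : Outcome n} {c ε : ℝ} (hc : 0 < c) (hn : 2 ≤ c * n) (hn' : 1 ≤ ε * n)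
    (hstates : ∀ s, c * n ≤ ((Finset.univ.filter fun v => ω.1 v = s).card : ℝ))
    (hscore : ∀ σ : Equiv.Perm (Fin n), |θ.score cl ω.1 σ ω.2 - θ.meanScore cl ω.1 σ| ≤
      ε * (θ.rho * θ.r * (1 - θ.r) * c) / 8 * (n : ℝ) ^ 2)
    (hV : |((firstBlock ω).card : ℝ) - 1 / 2 * n| ≤ ε * n) (o : Equiv.Perm (Fin n)) :
    (((firstBlock ω).filter fun v => n / 2 ≤ (θ.matchRule n (firstGraph ω)
      (obfuscate o (classGraph cl ω)) (firstBlock ω) (o v) : ℕ)).card : ℝ) ≤ 3 * ε * n := by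
  have hr1 : θ.r < 1 := by linarith [θ.r_lt_q, θ.q_lt_p, θ.p_le_one]
  have hκ : 0 < θ.rho * θ.r * (1 - θ.r) :=
    mul_pos (mul_pos θ.rho_pos θ.r_pos) (by linarith)
  set V := firstBlock ω with hVdef
  set h := obfuscate o (classGraph cl ω) with hh
  set σ := (θ.exists_best_match (firstGraph ω) h V).choose with hσ
  have hbest := (θ.exists_best_match (firstGraph ω) h V).choose_spec o
  rw [← hσ, hh, matchScore_obfuscate, matchScore_obfuscate, inv_mul_cancel, hVdef, matchScore_eq,
    matchScore_eq] at hbest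
  have hmoved := card_moved_le θ hcl hstates (o⁻¹ * σ)
  have h1 := abs_le.1 (hscore 1)
  have h2 := abs_le.1 (hscore (o⁻¹ * σ))
  set m : ℝ := ((Finset.univ.filter fun u => (o⁻¹ * σ) u ≠ u).card : ℝ) with hm
  have hm0 : 0 ≤ m := Nat.cast_nonneg _
  set κ := θ.rho * θ.r * (1 - θ.r) with hκdef
  have hn0 : 0 < (n : ℝ) := by
    by_contra hcon
    have : (n : ℝ) = 0 := le_antisymm (not_lt.1 hcon) (Nat.cast_nonneg _)
    rw [this] at hn
    linarith
  -- Optimality of σ against o puts the score of o⁻¹σ above that of the identity. The two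
  -- concentration errors add up to εκcn²/4, doubled by `card_moved_le`, whereas each moved vertex
  -- costs at least κcn/2.
  have hm1 : m ≤ ε * n := by
    have h3 : m * (κ * (c * n / 2)) ≤ m * (κ * (c * n - 1)) :=
      mul_le_mul_of_nonneg_left (mul_le_mul_of_nonneg_left (by linarith) hκ.le) hm0
    have h4 : m * (κ * (c * n / 2)) ≤ ε * n * (κ * (c * n / 2)) := by
      refine (h3.trans hmoved).trans ?_
      nlinarith
    exact le_of_mul_le_mul_right h4 (by positivity)
  have hlate := card_late_le (V.map σ.toEmbedding) 1 1 V o (n / 2)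
  have hmiss : (V.filter fun v => o v ∉ V.map σ.toEmbedding).card ≤
      (Finset.univ.filter fun u => (o⁻¹ * σ) u ≠ u).card := by
    refine Finset.card_le_card fun v hv => Finset.mem_filter.2 ⟨Finset.mem_univ _, fun hfix => ?_⟩
    obtain ⟨hvV, hvo⟩ := Finset.mem_filter.1 hv
    refine hvo (Finset.mem_map.2 ⟨v, hvV, ?_⟩)
    rw [Equiv.Perm.mul_apply, Equiv.Perm.inv_eq_iff_eq] at hfix
    exact hfix
  rw [Finset.card_map] at hlate
  have hk : (n : ℝ) ≤ 2 * ((n / 2 : ℕ) : ℝ) + 1 := by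
    exact_mod_cast (by omega : n ≤ 2 * (n / 2) + 1)
  have hover : ((V.card - n / 2 : ℕ) : ℝ) ≤ ε * n + 1 := by
    rcases le_total (n / 2) V.card with hle | hle
    · rw [Nat.cast_sub hle]
      linarith [(abs_le.1 hV).2]
    · rw [Nat.sub_eq_zero_of_le hle, Nat.cast_zero]
      linarith
  calc _ ≤ (((V.filter fun v => o v ∉ V.map σ.toEmbedding).card + (V.card - n / 2) : ℕ) : ℝ) := by
        exact_mod_cast hlate
    _ ≤ m + (ε * n + 1) := by
        rw [Nat.cast_add]
        exact add_le_add (by rw [hm]; exact_mod_cast hmiss) hover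
    _ ≤ _ := by linarith

theorem whp_matchRule_losses {cl : VertexState → Fin 3} (hcl : HasPartners cl) {ε : ℝ}
    (hε : 0 < ε) : Whp θ fun n ω => ∀ o : Equiv.Perm (Fin n),
      recallLoss (θ.matchRule n) (firstGraph ω) (classGraph cl ω) o (firstBlock ω) (n / 2) ≤ ε ∧
      precisionLoss (θ.matchRule n) (firstGraph ω) (classGraph cl ω) o (firstBlock ω) (n / 2)
        ≤ ε := by
  have hr1 : θ.r < 1 := by linarith [θ.r_lt_q, θ.q_lt_p, θ.p_le_one]
  have hκ : 0 < θ.rho * θ.r * (1 - θ.r) :=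
    mul_pos (mul_pos θ.rho_pos θ.r_pos) (by linarith)
  obtain ⟨c, hc, -, hstates⟩ := exists_whp_states θ
  set ε' := min (ε / 16) (1 / 4) with hε'
  have hε'0 : 0 < ε' := by positivity
  have hε'1 : ε' ≤ ε / 16 := min_le_left _ _
  refine ((hstates.and (whp_score θ cl
    (ε := ε' * (θ.rho * θ.r * (1 - θ.r) * c) / 8) (by positivity))).and
      (whp_card_firstBlock hε'0)).mono ?_
  have hev : ∀ {a b : ℝ}, 0 < a → ∀ᶠ n : ℕ in atTop, b ≤ a * n := fun {a b} ha => by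
    filter_upwards [eventually_ge_atTop ⌈b / a⌉₊] with n hn
    have := Nat.ceil_le.1 hn
    rwa [div_le_iff₀' ha] at this
  filter_upwards [hev (b := 2) hc, hev (b := 1) hε'0, eventually_ge_atTop 2] with n hn1 hn2 hn3 ω hω
  intro o
  have h1 := card_late_matchRule_le hcl hc hn1 hn2 hω.1.1 hω.1.2 hω.2 o
  have h2 := losses_le hn3 (min_le_right _ _) (by positivity) hω.2 h1
  exact ⟨h2.1.trans (by linarith), h2.2.trans (by linarith)⟩

/-- The scheme inherits the losses of the matching rule at an obfuscation that varies with the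
outcome; `whp_matchRule_losses` covers all obfuscations on one event. -/
theorem exists_consistent_scheme (θ : Params) {cl : VertexState → Fin 3} (hcl : HasPartners cl) :
    ∃ Ψ : ∀ n, RankingRule n, (∀ n, IsVNScheme (Ψ n)) ∧ ∀ o : ∀ n, Equiv.Perm (Fin n),
      Tendsto (fun n => θ.expect fun ω : Outcome n => recallLoss (Ψ n) (firstGraph ω)
        (classGraph cl ω) (o n) (firstBlock ω) (n / 2)) atTop (𝓝 0) ∧
      Tendsto (fun n => θ.expect fun ω : Outcome n => precisionLoss (Ψ n) (firstGraph ω)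
        (classGraph cl ω) (o n) (firstBlock ω) (n / 2)) atTop (𝓝 0) := by
  choose Ψ hΨ hloss using fun n => exists_isVNScheme_losses (θ.matchRule n)
  refine ⟨Ψ, hΨ, fun o => ⟨?_, ?_⟩⟩
  · refine tendsto_expect_of_whp (fun n ω => recallLoss_nonneg _ _ _ _ _ _)
      (fun n ω => recallLoss_le_one _ _ _ _ _ _) fun ε hε =>
      (whp_matchRule_losses hcl hε).mono (Eventually.of_forall fun n ω hω => ?_)
    obtain ⟨o', ho'⟩ := hloss n (firstGraph ω) (classGraph cl ω) (firstBlock ω) (o n)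
    rw [(ho' _).1]
    exact (hω o').1
  · refine tendsto_expect_of_whp (fun n ω => precisionLoss_nonneg _ _ _ _ _ _)
      (fun n ω => precisionLoss_le_one _ _ _ _ _ _) fun ε hε =>
      (whp_matchRule_losses hcl hε).mono (Eventually.of_forall fun n ω hω => ?_)
    obtain ⟨o', ho'⟩ := hloss n (firstGraph ω) (classGraph cl ω) (firstBlock ω) (o n)
    rw [(ho' _).2]
    exact (hω o').2

/-! ### Bayes errors of an arbitrary model -/

section General

variable {n : ℕ} (F : NominationModel n)

theorem NominationModel.expect_nonneg {f : F.Ω → ℝ} (h : ∀ ω, 0 ≤ f ω) : 0 ≤ F.expect f :=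
  Finset.sum_nonneg fun ω _ => mul_nonneg (F.weight_nonneg ω) (h ω)

theorem recallError_nonneg (Φ : RankingRule n) (o : Equiv.Perm (Fin n)) (k : ℕ) :
    0 ≤ recallError F Φ o k := F.expect_nonneg fun _ => recallLoss_nonneg _ _ _ _ _ _

theorem precisionError_nonneg (Φ : RankingRule n) (o : Equiv.Perm (Fin n)) (k : ℕ) :
    0 ≤ precisionError F Φ o k := F.expect_nonneg fun _ => precisionLoss_nonneg _ _ _ _ _ _

theorem bayesRecallError_nonneg (o : Equiv.Perm (Fin n)) (k : ℕ) :
    0 ≤ bayesRecallError F o k := Real.iInf_nonneg fun _ => recallError_nonneg F _ o k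

theorem bayesPrecisionError_nonneg (o : Equiv.Perm (Fin n)) (k : ℕ) :
    0 ≤ bayesPrecisionError F o k := Real.iInf_nonneg fun _ => precisionError_nonneg F _ o k

theorem bayesRecallError_le {Ψ : RankingRule n} (hΨ : IsVNScheme Ψ) (o : Equiv.Perm (Fin n))
    (k : ℕ) : bayesRecallError F o k ≤ recallError F Ψ o k :=
  ciInf_le (f := fun Ψ : {Ψ : RankingRule n // IsVNScheme Ψ} => recallError F Ψ.1 o k)
    ⟨0, by rintro _ ⟨Ψ, rfl⟩; exact recallError_nonneg F _ o k⟩ ⟨Ψ, hΨ⟩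

theorem bayesPrecisionError_le {Ψ : RankingRule n} (hΨ : IsVNScheme Ψ) (o : Equiv.Perm (Fin n))
    (k : ℕ) : bayesPrecisionError F o k ≤ precisionError F Ψ o k :=
  ciInf_le (f := fun Ψ : {Ψ : RankingRule n // IsVNScheme Ψ} => precisionError F Ψ.1 o k)
    ⟨0, by rintro _ ⟨Ψ, rfl⟩; exact precisionError_nonneg F _ o k⟩ ⟨Ψ, hΨ⟩

end General

theorem tendsto_bayes_clean (θ : Params) (o : ∀ n, Equiv.Perm (Fin n)) :
    Tendsto (fun n => bayesRecallError (cleanModel θ n) (o n) (n / 2)) atTop (𝓝 0) ∧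
      Tendsto (fun n => bayesPrecisionError (cleanModel θ n) (o n) (n / 2)) atTop (𝓝 0) := by
  obtain ⟨Ψ, hΨ, hlim⟩ := exists_consistent_scheme θ hasPartners_cleanClass
  obtain ⟨h1, h2⟩ := hlim o
  simp only [← secondGraph_eq] at h1 h2
  exact ⟨squeeze_zero (fun n => bayesRecallError_nonneg _ _ _)
      (fun n => bayesRecallError_le (cleanModel θ n) (hΨ n) _ _) h1,
    squeeze_zero (fun n => bayesPrecisionError_nonneg _ _ _)
      (fun n => bayesPrecisionError_le (cleanModel θ n) (hΨ n) _ _) h2⟩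

theorem tendsto_bayes_contaminated (θ : Params) (o : ∀ n, Equiv.Perm (Fin n)) :
    Tendsto (fun n => bayesRecallError (contaminatedModel θ n) (o n) (n / 2)) atTop (𝓝 0) ∧
      Tendsto (fun n => bayesPrecisionError (contaminatedModel θ n) (o n) (n / 2))
        atTop (𝓝 0) := by
  obtain ⟨Ψ, hΨ, hlim⟩ := exists_consistent_scheme θ hasPartners_attackClass
  obtain ⟨h1, h2⟩ := hlim o
  simp only [← attackedGraph_eq] at h1 h2
  exact ⟨squeeze_zero (fun n => bayesRecallError_nonneg _ _ _)
      (fun n => bayesRecallError_le (contaminatedModel θ n) (hΨ n) _ _) h1,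
    squeeze_zero (fun n => bayesPrecisionError_nonneg _ _ _)
      (fun n => bayesPrecisionError_le (contaminatedModel θ n) (hΨ n) _ _) h2⟩

end Bayes

/-! ### Exchangeability -/

section Exchange

variable {n : ℕ} (θ : Params) (o : Equiv.Perm (Fin n))

/-- The outcome in which vertex `v` is renamed to `o v`. -/
def relabel : Outcome n ≃ Outcome n where
  toFun ω := (fun v => ω.1 (o⁻¹ v), fun e => ω.2 (e.map ⇑(o⁻¹)))
  invFun ω := (fun v => ω.1 (o v), fun e => ω.2 (e.map o))
  left_inv ω := by
    ext1
    · funext v; simp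
    · funext e; simp [Sym2.map_map]
  right_inv ω := by
    ext1
    · funext v; simp
    · funext e; simp [Sym2.map_map]

theorem weight_relabel (ω : Outcome n) : θ.weight (relabel o ω) = θ.weight ω := by
  have hprob : ∀ e : Sym2 (Fin n), θ.pairProb (fun v => (ω.1 (o⁻¹ v)).1) e =
      θ.pairProb (fun v => (ω.1 v).1) (e.map ⇑(o⁻¹)) := fun e => by
    induction e using Sym2.ind with
    | _ u v => rfl
  have hbij : Function.Bijective fun e : Sym2 (Fin n) => e.map ⇑(o⁻¹) :=
    Finite.injective_iff_bijective.1 (Sym2.map.injective (o⁻¹).injective)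
  simp only [Params.weight, relabel, Equiv.coe_fn_mk, hprob]
  congr 1
  · exact Fintype.prod_equiv o⁻¹ _ _ fun v => rfl
  · exact Fintype.prod_bijective _ hbij _ _ fun e => rfl

theorem expect_relabel (f : Outcome n → ℝ) :
    θ.expect (fun ω => f (relabel o ω)) = θ.expect f := by
  unfold Params.expect
  rw [← Equiv.sum_comp (relabel o) fun ω => θ.weight ω * f ω]
  simp only [weight_relabel]

theorem secondGraph_relabel (ω : Outcome n) :
    secondGraph (relabel o ω) = obfuscate o (secondGraph ω) := by
  ext u v
  obtain ⟨u, rfl⟩ := o.surjective u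
  obtain ⟨v, rfl⟩ := o.surjective v
  rw [obfuscate_adj]
  simp [secondGraph, graphOf, relabel]

theorem firstBlock_relabel (ω : Outcome n) :
    firstBlock (relabel o ω) = (firstBlock ω).map o.toEmbedding := by
  ext v
  obtain ⟨v, rfl⟩ := o.surjective v
  simp [firstBlock, relabel]

/-- A rule that depends on the second graph only has the same errors for all obfuscating
functions in the exchangeable model. -/
theorem expect_losses_relabel {Φ : RankingRule n} {R : SimpleGraph (Fin n) → Fin n ≃ Fin n}
    (hΦ : ∀ g₁ h V, Φ g₁ h V = R h) (k : ℕ) :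
    recallError (cleanModel θ n) Φ o k = recallError (cleanModel θ n) Φ 1 k ∧
      precisionError (cleanModel θ n) Φ o k = precisionError (cleanModel θ n) Φ 1 k := by
  have hcard : ∀ (ω : Outcome n) (P : Fin n → Prop) [DecidablePred P],
      ((firstBlock (relabel o ω)).filter P).card =
        ((firstBlock ω).filter fun v => P (o v)).card := fun ω P _ => by
    rw [firstBlock_relabel, Finset.filter_map, Finset.card_map]
    rfl
  constructor
  · refine Eq.trans ?_ (expect_relabel θ o fun ω =>
      recallLoss Φ (firstGraph ω) (secondGraph ω) 1 (firstBlock ω) k)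
    change θ.expect (fun ω => recallLoss Φ (firstGraph ω) (secondGraph ω) o (firstBlock ω) k) = _
    congr 1
    funext ω
    simp only [recallLoss, hΦ, hcard, obfuscate_one, secondGraph_relabel, Equiv.Perm.one_apply]
    rw [firstBlock_relabel, Finset.card_map]
  · refine Eq.trans ?_ (expect_relabel θ o fun ω =>
      precisionLoss Φ (firstGraph ω) (secondGraph ω) 1 (firstBlock ω) k)
    change θ.expect (fun ω => precisionLoss Φ (firstGraph ω) (secondGraph ω) o (firstBlock ω) k)
      = _
    congr 1
    funext ω
    simp only [precisionLoss, hΦ, hcard, obfuscate_one, secondGraph_relabel,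
      Equiv.Perm.one_apply]

end Exchange

end VertexNomination

namespace VertexNomination

/-! ### The spectral rule in the two models -/

section Spectral

variable {θ : Params}

open Classical in
theorem whp_of_tendsto_prob {F : ∀ n, Outcome n → Prop}
    (h : Tendsto (fun n => θ.expect fun ω : Outcome n => if F n ω then (1 : ℝ) else 0)
      atTop (𝓝 1)) : Whp θ F := by
  have h1 := (tendsto_const_nhds (x := (1 : ℝ))).sub h
  rw [sub_self] at h1
  refine h1.congr fun n => ?_
  rw [sub_eq_iff_eq_add, ← θ.expect_add]
  refine (θ.expect_const (n := n) 1).symm.trans (congrArg θ.expect (funext fun ω => ?_))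
  split_ifs <;> norm_num

open Classical in
/-- With high probability, a top cluster of the spectral clustering is close to a type class of
almost highest density. -/
theorem whp_spectral {τ : Type*} [Fintype τ] [DecidableEq τ] [Nonempty τ] {M : τ → τ → ℝ}
    (hM : ∀ a b, M a b ∈ Set.Icc (0 : ℝ) 1) (hrow : ∀ a b, a ≠ b → ∃ c, M a c ≠ M b c)
    {cl : VertexState → Fin 3} {tp : VertexState → τ} (htp : Function.Surjective tp)
    (hdev : ∀ n (ω : Outcome n), θ.deviation cl ω =
      (classGraph cl ω).adjMatrix ℝ - blockMatrix M fun v => tp (ω.1 v)) {ε : ℝ} (hε : 0 < ε) :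
    Whp θ fun n ω => ∀ T, IsTopSpectralCluster (Fintype.card τ) (classGraph cl ω) T →
      ∃ (a : τ) (B : Finset (Fin n)), (∀ b, M b b ≤ M a a + ε) ∧ (B.card : ℝ) ≤ ε * n ∧
          ∀ j ∉ B, (j ∈ T ↔ tp (ω.1 j) = a) := by
  obtain ⟨c, hc, -, hstates⟩ := exists_whp_states θ
  obtain ⟨δ, hδ, N, hN⟩ := exists_spectral_threshold hM hrow hc hε
  refine (hstates.and (whp_opBound θ cl hδ)).mono ?_
  filter_upwards [eventually_ge_atTop N] with n hn ω hω T hT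
  refine hN n hn (classGraph cl ω) (fun v => tp (ω.1 v)) (fun a => ?_) (hdev n ω ▸ hω.2) T hT
  obtain ⟨s, rfl⟩ := htp a
  refine (hω.1 s).trans ?_
  exact_mod_cast Finset.card_le_card fun v hv =>
    Finset.mem_filter.2 ⟨Finset.mem_univ _, congrArg tp (Finset.mem_filter.1 hv).2⟩

theorem eventually_le_mul {a : ℝ} (b : ℝ) (ha : 0 < a) : ∀ᶠ n : ℕ in atTop, b ≤ a * n := by
  filter_upwards [eventually_ge_atTop ⌈b / a⌉₊] with n hn
  have := Nat.ceil_le.1 hn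
  rwa [div_le_iff₀' ha] at this

/-! ### The uncontaminated model -/

open Classical in
theorem deviation_cleanClass {n : ℕ} (ω : Outcome n) : θ.deviation cleanClass ω =
    (classGraph cleanClass ω).adjMatrix ℝ - blockMatrix θ.B fun v => (ω.1 v).1 := by
  rw [θ.deviation_eq]
  congr 1

theorem Params.B_rows (θ : Params) (a b : Fin 2) (hab : a ≠ b) : ∃ c, θ.B a c ≠ θ.B b c := by
  have h : θ.r < θ.p := θ.r_lt_q.trans θ.q_lt_p
  refine ⟨0, ?_⟩
  fin_cases a <;> fin_cases b <;> simp [Params.B] at hab ⊢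
  · exact h.ne'
  · exact h.ne

/-- The top cluster differs from the first block in few vertices, because the other class has
density q < p. Its size is then close to ⌊n/2⌋, so the arbitrary orders hardly matter. -/
theorem whp_clean_losses {Khat : ∀ n : ℕ, SimpleGraph (Fin n) → ℕ} {Φ : ∀ n : ℕ, RankingRule n}
    (hΦ : ∀ n : ℕ, 0 < n → IsSpectralRule (Khat n) (Φ n))
    (hK : Whp θ fun n ω => Khat n (secondGraph ω) = 2) {ε : ℝ} (hε : 0 < ε) :
    Whp θ fun n ω =>
      recallLoss (Φ n) (firstGraph ω) (secondGraph ω) 1 (firstBlock ω) (n / 2) ≤ ε ∧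
      precisionLoss (Φ n) (firstGraph ω) (secondGraph ω) 1 (firstBlock ω) (n / 2) ≤ ε := by
  -- At most 4ε'n vertices of interest come late, so `losses_le` yields 20ε'. The bound (p − q)/2
  -- excludes the second block as top class.
  set ε' := min (min (ε / 20) (1 / 4)) ((θ.p - θ.q) / 2) with hε'
  have hpq := θ.q_lt_p
  have hε'0 : 0 < ε' := lt_min (by positivity) (by linarith)
  have hε'1 : ε' ≤ ε / 20 := (min_le_left _ _).trans (min_le_left _ _)
  have hε'2 : ε' ≤ 1 / 4 := (min_le_left _ _).trans (min_le_right _ _)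
  have hε'3 : ε' ≤ (θ.p - θ.q) / 2 := min_le_right _ _
  have hspec := whp_spectral (θ := θ) (M := θ.B) (tp := fun s => s.1) (cl := cleanClass)
    (fun a b => ⟨(θ.B_mem a b).1.le, (θ.B_mem a b).2⟩) θ.B_rows
    (fun a => ⟨(a, false, false), rfl⟩) (fun n ω => deviation_cleanClass ω) hε'0
  refine ((hspec.and hK).and (whp_card_firstBlock hε'0)).mono ?_
  filter_upwards [eventually_ge_atTop 2, eventually_le_mul 1 hε'0] with n hn hn1 ω hω
  obtain ⟨⟨hω1, hω2⟩, hV⟩ := hω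
  rw [← secondGraph_eq, Fintype.card_fin] at hω1
  obtain ⟨τ, τ', hrule⟩ := hΦ n (by omega)
  obtain ⟨T, hT, hΦT⟩ := hrule (secondGraph ω)
  rw [hω2] at hT
  obtain ⟨a, B, hmax, hB, hTB⟩ := hω1 T hT
  have ha : a = 0 := by
    by_contra hne
    have ha1 : a = 1 := by omega
    have h1 := hmax 0
    rw [ha1] at h1
    simp only [Params.B, if_true, one_ne_zero, if_false] at h1
    linarith
  subst ha
  have hmiss : ((firstBlock ω).filter fun v => (1 : Equiv.Perm (Fin n)) v ∉ T).card ≤ B.card := by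
    refine Finset.card_le_card fun v hv => ?_
    by_contra hvB
    obtain ⟨h1, h2⟩ := Finset.mem_filter.1 hv
    exact h2 ((hTB v hvB).2 (Finset.mem_filter.1 h1).2)
  have hTcard : T.card ≤ (firstBlock ω).card + B.card := by
    refine (Finset.card_le_card fun v hv => ?_).trans (Finset.card_union_le _ _)
    by_cases hvB : v ∈ B
    · exact Finset.mem_union_right _ hvB
    · exact Finset.mem_union_left _
        (Finset.mem_filter.2 ⟨Finset.mem_univ _, (hTB v hvB).1 hv⟩)
  have hlate := card_late_le T τ τ' (firstBlock ω) 1 (n / 2)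
  have hk : (n : ℝ) ≤ 2 * ((n / 2 : ℕ) : ℝ) + 1 := by
    exact_mod_cast (by omega : n ≤ 2 * (n / 2) + 1)
  have hover : ((T.card - n / 2 : ℕ) : ℝ) ≤ 2 * ε' * n + 1 := by
    have h3 : (T.card : ℝ) ≤ (firstBlock ω).card + B.card := by exact_mod_cast hTcard
    rcases le_total (n / 2) T.card with hle | hle
    · rw [Nat.cast_sub hle]
      linarith [(abs_le.1 hV).2]
    · rw [Nat.sub_eq_zero_of_le hle, Nat.cast_zero]
      positivity
  have hfinal : (((firstBlock ω).filter fun v => n / 2 ≤ (Φ n (firstGraph ω)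
      (obfuscate 1 (secondGraph ω)) (firstBlock ω) ((1 : Equiv.Perm (Fin n)) v) : ℕ)).card : ℝ)
      ≤ 4 * ε' * n := by
    rw [obfuscate_one, hΦT]
    calc _ ≤ ((((firstBlock ω).filter fun v => (1 : Equiv.Perm (Fin n)) v ∉ T).card +
          (T.card - n / 2) : ℕ) : ℝ) := by exact_mod_cast hlate
      _ ≤ ε' * n + (2 * ε' * n + 1) := by
          rw [Nat.cast_add]
          refine add_le_add (le_trans ?_ hB) hover
          exact_mod_cast hmiss
      _ ≤ _ := by linarith
  have h4 := losses_le hn hε'2 (by positivity) hV hfinal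
  exact ⟨h4.1.trans (by linarith), h4.2.trans (by linarith)⟩

/-- The rule reads the second graph only, so exchangeability reduces every obfuscation to the
identity. -/
theorem clean_consistent {Khat : ∀ n : ℕ, SimpleGraph (Fin n) → ℕ} {Φ : ∀ n : ℕ, RankingRule n}
    (hΦ : ∀ n : ℕ, 0 < n → IsSpectralRule (Khat n) (Φ n))
    (hK : Whp θ fun n ω => Khat n (secondGraph ω) = 2) :
    RecallConsistent (cleanModel θ) Φ (fun n => n / 2) ∧
      PrecisionConsistent (cleanModel θ) Φ (fun n => n / 2) := by
  have hrel : ∀ o : ∀ n, Equiv.Perm (Fin n), ∀ᶠ n in atTop,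
      recallError (cleanModel θ n) (Φ n) 1 (n / 2) =
        recallError (cleanModel θ n) (Φ n) (o n) (n / 2) ∧
      precisionError (cleanModel θ n) (Φ n) 1 (n / 2) =
        precisionError (cleanModel θ n) (Φ n) (o n) (n / 2) := by
    intro o
    filter_upwards [eventually_gt_atTop 0] with n hn
    obtain ⟨τ, τ', hrule⟩ := hΦ n hn
    choose T _ hT using hrule
    have h := expect_losses_relabel θ (o n) (R := fun h => groupFirst (T h) τ τ')
      (fun g₁ h V => hT h g₁ V) (n / 2)
    exact ⟨h.1.symm, h.2.symm⟩
  constructor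
  · intro o
    have h1 : Tendsto (fun n => recallError (cleanModel θ n) (Φ n) 1 (n / 2)) atTop (𝓝 0) :=
      tendsto_expect_of_whp (θ := θ) (f := fun n ω => recallLoss (Φ n) (firstGraph ω)
        (secondGraph ω) 1 (firstBlock ω) (n / 2)) (fun n ω => recallLoss_nonneg _ _ _ _ _ _)
        (fun n ω => recallLoss_le_one _ _ _ _ _ _) fun ε hε =>
        (whp_clean_losses hΦ hK hε).mono (Eventually.of_forall fun n ω h => h.1)
    have h2 := (h1.congr' ((hrel o).mono fun n h => h.1)).sub (tendsto_bayes_clean θ o).1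
    rwa [sub_zero] at h2
  · intro o
    have h1 : Tendsto (fun n => precisionError (cleanModel θ n) (Φ n) 1 (n / 2)) atTop (𝓝 0) :=
      tendsto_expect_of_whp (θ := θ) (f := fun n ω => precisionLoss (Φ n) (firstGraph ω)
        (secondGraph ω) 1 (firstBlock ω) (n / 2)) (fun n ω => precisionLoss_nonneg _ _ _ _ _ _)
        (fun n ω => precisionLoss_le_one _ _ _ _ _ _) fun ε hε =>
        (whp_clean_losses hΦ hK hε).mono (Eventually.of_forall fun n ω h => h.2)
    have h2 := (h1.congr' ((hrel o).mono fun n h => h.2)).sub (tendsto_bayes_clean θ o).2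
    rwa [sub_zero] at h2

/-! ### The contaminated model -/

/-- Edge probabilities of the contaminated graph between the six types. -/
noncomputable def Params.attackedB (θ : Params) (a b : Fin 2 × Fin 3) : ℝ :=
  θ.meanAfter (θ.B a.1 b.1) a.2 b.2

theorem Params.meanAfter_table (θ : Params) (a : ℝ) :
    θ.meanAfter a 0 0 = a + (1 - a) * θ.sPlus ∧ θ.meanAfter a 0 1 = a ∧
    θ.meanAfter a 0 2 = a + (1 - a) * θ.sPlus ∧ θ.meanAfter a 1 0 = a ∧
    θ.meanAfter a 1 1 = a * (1 - θ.sMinus) ∧ θ.meanAfter a 1 2 = a * (1 - θ.sMinus) ∧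
    θ.meanAfter a 2 0 = a + (1 - a) * θ.sPlus ∧ θ.meanAfter a 2 1 = a * (1 - θ.sMinus) ∧
    θ.meanAfter a 2 2 = a := by
  unfold Params.meanAfter
  refine ⟨?_, ?_, ?_, ?_, ?_, ?_, ?_, ?_, ?_⟩
  all_goals
    first
      | exact if_pos (by decide)
      | exact (if_neg (by decide)).trans (if_pos (by decide))
      | exact (if_neg (by decide)).trans (if_neg (by decide))

/-- Entrywise, the row of W₊ dominates that of the unselected vertices, which dominates that of W₋.
Consecutive rows differ in one column through s₊ and in another through s₋, so one positive rate
suffices. -/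
theorem meanAfter_class_ne (θ : Params) (hs : 0 < θ.sPlus ∨ 0 < θ.sMinus) {a : ℝ} (h0 : 0 < a)
    (h1 : a < 1) (x y : Fin 3) (hxy : x ≠ y) :
    ∃ z, θ.meanAfter a x z ≠ θ.meanAfter a y z := by
  have hp := θ.sPlus_mem
  have hm := θ.sMinus_mem
  have hlt : ∀ x y : Fin 3, (x, y) = (0, 2) ∨ (x, y) = (2, 1) ∨ (x, y) = (0, 1) →
      ∃ z, θ.meanAfter a y z < θ.meanAfter a x z := by
    rintro x y (h | h | h) <;> obtain ⟨rfl, rfl⟩ := Prod.ext_iff.1 h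
    · rcases hs with hs | hs
      · exact ⟨2, by simp only [θ.meanAfter_table]; nlinarith⟩
      · exact ⟨1, by simp only [θ.meanAfter_table]; nlinarith⟩
    · rcases hs with hs | hs
      · exact ⟨0, by simp only [θ.meanAfter_table]; nlinarith⟩
      · exact ⟨2, by simp only [θ.meanAfter_table]; nlinarith⟩
    · rcases hs with hs | hs
      · exact ⟨0, by simp only [θ.meanAfter_table]; nlinarith⟩
      · exact ⟨2, by simp only [θ.meanAfter_table]; nlinarith [hp.1]⟩
  have hcases : ((x, y) = (0, 2) ∨ (x, y) = (2, 1) ∨ (x, y) = (0, 1)) ∨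
      ((y, x) = (0, 2) ∨ (y, x) = (2, 1) ∨ (y, x) = (0, 1)) := by
    revert x y
    decide
  rcases hcases with h | h
  · obtain ⟨z, hz⟩ := hlt x y h
    exact ⟨z, hz.ne'⟩
  · obtain ⟨z, hz⟩ := hlt y x h
    exact ⟨z, hz.ne⟩

/-- The column is chosen such that the attack does not lower the entry of `a` and does not raise
that of `b`. Hence it works for all rates, extreme ones included. -/
theorem meanAfter_lt (θ : Params) {a b : ℝ} (hb0 : 0 ≤ b) (hba : b < a) (ha1 : a ≤ 1)
    (x y : Fin 3) (hxy : x = y ∨ x = 0 ∨ y = 1) :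
    ∃ z, θ.meanAfter b y z < θ.meanAfter a x z := by
  have hp := θ.sPlus_mem
  have hm := θ.sMinus_mem
  have hcases : (x = 0 ∧ y = 0) ∨ (x = 0 ∧ y = 1) ∨ (x = 0 ∧ y = 2) ∨ (x = 1 ∧ y = 1) ∨
      (x = 2 ∧ y = 1) ∨ (x = 2 ∧ y = 2) := by
    revert x y
    decide
  rcases hcases with ⟨rfl, rfl⟩ | ⟨rfl, rfl⟩ | ⟨rfl, rfl⟩ | ⟨rfl, rfl⟩ | ⟨rfl, rfl⟩ | ⟨rfl, rfl⟩
  · exact ⟨1, by simpa only [θ.meanAfter_table] using hba⟩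
  · exact ⟨2, by simp only [θ.meanAfter_table]; nlinarith [hp.1, hm.1]⟩
  · exact ⟨2, by simp only [θ.meanAfter_table]; nlinarith [hp.1]⟩
  · exact ⟨0, by simpa only [θ.meanAfter_table] using hba⟩
  · exact ⟨2, by simp only [θ.meanAfter_table]; nlinarith [hm.1]⟩
  · exact ⟨2, by simpa only [θ.meanAfter_table] using hba⟩

theorem Params.attackedB_rows (θ : Params) (hs : 0 < θ.sPlus ∨ 0 < θ.sMinus)
    (a b : Fin 2 × Fin 3) (hab : a ≠ b) : ∃ c, θ.attackedB a c ≠ θ.attackedB b c := by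
  have hr := θ.r_pos
  have hrq := θ.r_lt_q
  have hqp := θ.q_lt_p
  have hp := θ.p_le_one
  have hdiff : ∀ x y : Fin 3, ∃ c, θ.attackedB (0, x) c ≠ θ.attackedB (1, y) c := by
    intro x y
    have hcases : (x = y ∨ x = 0 ∨ y = 1) ∨ (y = x ∨ y = 0 ∨ x = 1) := by
      revert x y
      decide
    rcases hcases with h | h
    · obtain ⟨z, hz⟩ := meanAfter_lt θ hr.le (hrq.trans hqp) hp x y h
      exact ⟨(0, z), by simpa [Params.attackedB, Params.B] using hz.ne'⟩
    · obtain ⟨z, hz⟩ := meanAfter_lt θ hr.le hrq (hqp.le.trans hp) y x h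
      exact ⟨(1, z), by simpa [Params.attackedB, Params.B] using hz.ne⟩
  obtain ⟨i, x⟩ := a
  obtain ⟨j, y⟩ := b
  by_cases hij : i = j
  · subst hij
    have hxy : x ≠ y := fun h => hab (by rw [h])
    -- Classes within a block are separated by columns of the opposite block, since 0 < r < 1
    -- whereas p = 1 is allowed.
    obtain ⟨z, hz⟩ := meanAfter_class_ne θ hs hr (by linarith) x y hxy
    have hne : i ≠ i + 1 := by omega
    exact ⟨(i + 1, z), by simpa [Params.attackedB, Params.B, hne] using hz⟩
  · have h2 : (i = 0 ∧ j = 1) ∨ (i = 1 ∧ j = 0) := by omega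
    rcases h2 with ⟨rfl, rfl⟩ | ⟨rfl, rfl⟩
    · exact hdiff x y
    · obtain ⟨c, hc⟩ := hdiff y x
      exact ⟨c, hc.symm⟩

theorem exists_state (a : Fin 2 × Fin 3) : ∃ s : VertexState, (s.1, attackClass s) = a := by
  revert a
  decide

/-- Losses of the spectral rule in the contaminated model are bounded away from zero. -/
theorem whp_contaminated_losses {Khat : ∀ n : ℕ, SimpleGraph (Fin n) → ℕ}
    {Φ : ∀ n : ℕ, RankingRule n} (hΦ : ∀ n : ℕ, 0 < n → IsSpectralRule (Khat n) (Φ n))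
    (hs : 0 < θ.sPlus ∨ 0 < θ.sMinus)
    (hK : Whp θ fun n ω => Khat n (attackedGraph ω) = 6) :
    ∃ c : ℝ, 0 < c ∧ Whp θ fun n ω =>
      c ≤ recallLoss (Φ n) (firstGraph ω) (attackedGraph ω) 1 (firstBlock ω) (n / 2) ∧
      c ≤ precisionLoss (Φ n) (firstGraph ω) (attackedGraph ω) 1 (firstBlock ω) (n / 2) := by
  classical
  obtain ⟨c, hc, hcw, hstates⟩ := exists_whp_states θ
  have hpq := θ.q_lt_p
  have hc1 : c ≤ 1 := by
    have h1 := θ.sum_vertexWeight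
    have h2 := Finset.single_le_sum (f := θ.vertexWeight)
      (fun s _ => (θ.vertexWeight_pos s).le) (Finset.mem_univ ((0 : Fin 2), false, false))
    linarith [hcw ((0 : Fin 2), false, false)]
  set ε := min (min (c ^ 2 / 32) (1 / 4)) ((θ.p - θ.q) / 2) with hεdef
  have hε0 : 0 < ε := lt_min (by positivity) (by linarith)
  have hε1 : ε ≤ c ^ 2 / 32 := (min_le_left _ _).trans (min_le_left _ _)
  have hε2 : ε ≤ 1 / 4 := (min_le_left _ _).trans (min_le_right _ _)
  have hε3 : ε ≤ (θ.p - θ.q) / 2 := min_le_right _ _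
  -- The orders are fixed for each n before any outcome is considered; this makes the index set `I
  -- n` below deterministic, as `whp_count` requires.
  have hτ : ∀ n, ∃ τ τ' : Equiv.Perm (Fin n), 0 < n → ∀ h : SimpleGraph (Fin n),
      ∃ T : Finset (Fin n), IsTopSpectralCluster (Khat n h) h T ∧
        ∀ g₁ V, Φ n g₁ h V = groupFirst T τ τ' := fun n => by
    by_cases hn : 0 < n
    · obtain ⟨τ, τ', h⟩ := hΦ n hn
      exact ⟨τ, τ', fun _ => h⟩
    · exact ⟨1, 1, fun h => absurd h hn⟩
  choose τ τ' hrule using hτ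
  let j : ℕ → ℕ := fun n => ⌊c * n / 2⌋₊
  let I : ∀ n, Finset (Fin n) := fun n => Finset.univ.filter fun w => (τ' n w : ℕ) < j n
  have hIcard : ∀ n, (I n).card = j n := fun n => by
    have hjn : j n ≤ n := by
      refine Nat.floor_le_of_le ?_
      have := mul_le_mul_of_nonneg_right hc1 (Nat.cast_nonneg (α := ℝ) n)
      linarith
    have h1 : (I n).card = (Finset.univ.filter fun w : Fin n => (w : ℕ) < j n).card :=
      Finset.card_equiv (τ' n) fun w => by simp [I]
    rw [h1, Fin.card_filter_val_lt, min_eq_right hjn]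
  have hspec := whp_spectral (θ := θ) (M := θ.attackedB) (tp := fun s => (s.1, attackClass s))
    (cl := attackClass)
    (fun a b => θ.meanAfter_mem (θ.B_mem _ _).1.le (θ.B_mem _ _).2 _ _)
    (θ.attackedB_rows hs) exists_state (fun n ω => θ.deviation_eq attackClass ω) hε0
  have hcount := whp_count (θ := θ) (fun s => (s.1, attackClass s) = (1, 1)) I hε0
  refine ⟨c ^ 2 / 4, by positivity, ?_⟩
  refine ((((hspec.and hK).and (whp_card_firstBlock hε0)).and hstates).and hcount).mono ?_
  filter_upwards [eventually_ge_atTop 2, eventually_le_mul 4 hc] with n hn hn1 ω hω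
  obtain ⟨⟨⟨⟨hω1, hω2⟩, hV⟩, hst⟩, hcnt⟩ := hω
  rw [← attackedGraph_eq] at hω1
  obtain ⟨T, hT, hΦT⟩ := hrule n (by omega) (attackedGraph ω)
  rw [hω2] at hT
  obtain ⟨a, B, hmax, hB, hTB⟩ := hω1 T hT
  have hn0 : (0 : ℝ) ≤ n := Nat.cast_nonneg n
  -- Unselected vertices of the first block retain density p, while the second block within W₋ has
  -- density at most q.
  have ha : a ≠ (1, 1) := by
    intro ha1
    have h1 := hmax (0, 2)
    have hm := θ.sMinus_mem
    rw [ha1] at h1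
    simp only [Params.attackedB, Params.B, θ.meanAfter_table, if_true, one_ne_zero, if_false] at h1
    nlinarith [θ.r_pos, θ.r_lt_q, hm.1]
  -- the top cluster misses a positive proportion of its block
  obtain ⟨s, hs1, hs2⟩ : ∃ s : VertexState, s.1 = a.1 ∧ (s.1, attackClass s) ≠ a := by
    obtain ⟨i, x⟩ := a
    obtain ⟨s, hs⟩ := exists_state (i, x + 1)
    have hne : ∀ x : Fin 3, x + 1 ≠ x := by decide
    exact ⟨s, congrArg Prod.fst hs, by rw [hs]; simp [hne]⟩
  have hTcard : T.card + (Finset.univ.filter fun v => ω.1 v = s).card ≤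
      (Finset.univ.filter fun v => (ω.1 v).1 = a.1).card + B.card := by
    have h1 : T.card ≤
        (Finset.univ.filter fun v => ((ω.1 v).1, attackClass (ω.1 v)) = a).card + B.card := by
      refine (Finset.card_le_card fun v hv => ?_).trans (Finset.card_union_le _ _)
      by_cases hvB : v ∈ B
      · exact Finset.mem_union_right _ hvB
      · exact Finset.mem_union_left _
          (Finset.mem_filter.2 ⟨Finset.mem_univ _, (hTB v hvB).1 hv⟩)
    have h2 : (Finset.univ.filter fun v => ((ω.1 v).1, attackClass (ω.1 v)) = a).card +
        (Finset.univ.filter fun v => ω.1 v = s).card ≤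
        (Finset.univ.filter fun v => (ω.1 v).1 = a.1).card := by
      rw [← Finset.card_union_of_disjoint]
      · refine Finset.card_le_card fun v hv => Finset.mem_filter.2 ⟨Finset.mem_univ _, ?_⟩
        rcases Finset.mem_union.1 hv with hv | hv
        · exact congrArg Prod.fst (Finset.mem_filter.1 hv).2
        · rw [(Finset.mem_filter.1 hv).2, hs1]
      · refine Finset.disjoint_filter.2 fun v _ h3 h4 => hs2 ?_
        rw [← h3, h4]
    omega
  have hblock : ((Finset.univ.filter fun v => (ω.1 v).1 = a.1).card : ℝ) ≤ (1 / 2 + ε) * n := by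
    have hV' := abs_le.1 hV
    by_cases ha0 : a.1 = 0
    · rw [ha0]
      change ((firstBlock ω).card : ℝ) ≤ _
      linarith [hV'.2]
    · have ha1 : a.1 = 1 := by omega
      have h1 : (firstBlock ω).card + (Finset.univ.filter fun v => ¬ (ω.1 v).1 = 0).card = n := by
        rw [card_firstBlock_eq, Finset.card_filter_add_card_filter_not, Finset.card_univ,
          Fintype.card_fin]
      have h2 : (Finset.univ.filter fun v => (ω.1 v).1 = a.1) =
          (Finset.univ.filter fun v => ¬ (ω.1 v).1 = 0) := by
        refine Finset.filter_congr fun v _ => ?_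
        rw [ha1]
        omega
      have h3 : ((firstBlock ω).card : ℝ) +
          ((Finset.univ.filter fun v => ¬ (ω.1 v).1 = 0).card : ℝ) = n := by exact_mod_cast h1
      rw [h2]
      linarith [hV'.1]
  have hj : (j n : ℝ) ≤ c * n / 2 := Nat.floor_le (by positivity)
  have hj' : c * n / 2 - 1 ≤ (j n : ℝ) := (Nat.sub_one_lt_floor _).le
  have hεc : ε * n ≤ c * n / 32 := by
    have h1 : c ^ 2 ≤ c := by nlinarith
    have h2 : ε ≤ c / 32 := by linarith
    nlinarith
  -- The missing class makes |T| at most (1/2 + 2ε − c)n, which leaves room for j ≤ cn/2 further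
  -- positions because 2ε ≤ c/16.
  have hTj : T.card + j n ≤ n / 2 := by
    have h1 : (T.card : ℝ) + ((Finset.univ.filter fun v => ω.1 v = s).card : ℝ) ≤
        ((Finset.univ.filter fun v => (ω.1 v).1 = a.1).card : ℝ) + B.card := by
      exact_mod_cast hTcard
    have h2 := hst s
    have h3 : 2 * ((T.card + j n : ℕ) : ℝ) ≤ n := by
      push_cast
      linarith
    have h4 : 2 * (T.card + j n) ≤ n := by exact_mod_cast h3
    omega
  -- vertices of the second block that are ranked early
  set W := ((I n).filter fun v => ((ω.1 v).1, attackClass (ω.1 v)) = (1, 1)) \ B with hW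
  have hWT : ∀ w ∈ W, w ∉ T := by
    intro w hw hwT
    obtain ⟨h1, h2⟩ := Finset.mem_sdiff.1 hw
    exact ha (((hTB w h2).1 hwT).symm.trans (Finset.mem_filter.1 h1).2)
  have hWτ : ∀ w ∈ W, (τ' n w : ℕ) < j n := fun w hw =>
    (Finset.mem_filter.1 (Finset.mem_filter.1 (Finset.mem_sdiff.1 hw).1).1).2
  have hVW : Disjoint (firstBlock ω) W := by
    rw [Finset.disjoint_left]
    intro v hv hvW
    have h1 := congrArg Prod.fst (Finset.mem_filter.1 (Finset.mem_sdiff.1 hvW).1).2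
    have h2 : (ω.1 v).1 = 0 := (Finset.mem_filter.1 hv).2
    simp [h2] at h1
  have hearly := card_early_add_le T (τ n) (τ' n) hVW hWT hWτ hTj
  -- The class has weight at least 2c and j ≥ cn/4, so it takes at least c²n/2 − εn of the first j
  -- labels. Removing the bad set costs another εn, with ε ≤ c²/32.
  have hWcard : 3 / 8 * c ^ 2 * n ≤ (W.card : ℝ) := by
    obtain ⟨s', hs'⟩ := exists_state (1, 1)
    have h1 : 2 * c ≤ ∑ s : VertexState,
        if (s.1, attackClass s) = ((1 : Fin 2), (1 : Fin 3)) then θ.vertexWeight s else 0 := by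
      refine (hcw s').trans ?_
      refine le_trans (le_of_eq ?_) (Finset.single_le_sum (f := fun s : VertexState =>
        if (s.1, attackClass s) = ((1 : Fin 2), (1 : Fin 3)) then θ.vertexWeight s else 0)
        (fun s _ => ?_) (Finset.mem_univ s'))
      · rw [if_pos hs']
      · split_ifs
        · exact (θ.vertexWeight_pos s).le
        · exact le_rfl
    have h2 := (abs_le.1 hcnt).1
    rw [hIcard] at h2
    have h3 : (((I n).filter fun v => ((ω.1 v).1, attackClass (ω.1 v)) = (1, 1)).card : ℝ) ≤
        W.card + B.card := by
      exact_mod_cast Finset.card_le_card_sdiff_add_card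
    have h4 := mul_le_mul_of_nonneg_right h1 (Nat.cast_nonneg (α := ℝ) (j n))
    have h5 : c * (c * n / 2) ≤ 2 * c * (j n : ℝ) := by
      have : c * n / 2 ≤ 2 * (j n : ℝ) := by linarith
      nlinarith
    have h6 : ε * n ≤ c ^ 2 / 32 * n := mul_le_mul_of_nonneg_right hε1 hn0
    linarith
  have hfinal : (((firstBlock ω).filter fun v => (Φ n (firstGraph ω)
      (obfuscate 1 (attackedGraph ω)) (firstBlock ω) ((1 : Equiv.Perm (Fin n)) v) : ℕ) < n / 2).card
      : ℝ) + 3 / 8 * c ^ 2 * n ≤ ((n / 2 : ℕ) : ℝ) := by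
    rw [obfuscate_one, hΦT]
    refine (add_le_add le_rfl hWcard).trans ?_
    exact_mod_cast hearly
  have h7 := le_losses hn hε2 (by positivity) hV hfinal
  exact ⟨le_trans (by linarith) h7.1, le_trans (by linarith) h7.2⟩

/-- The identity obfuscation is enough: as the Bayes errors vanish, consistency would send errors
that stay bounded below to 0. -/
theorem contaminated_not_consistent {Khat : ∀ n : ℕ, SimpleGraph (Fin n) → ℕ}
    {Φ : ∀ n : ℕ, RankingRule n} (hΦ : ∀ n : ℕ, 0 < n → IsSpectralRule (Khat n) (Φ n))
    (hs : 0 < θ.sPlus ∨ 0 < θ.sMinus)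
    (hK : Whp θ fun n ω => Khat n (attackedGraph ω) = 6) :
    ¬ RecallConsistent (contaminatedModel θ) Φ (fun n => n / 2) ∧
      ¬ PrecisionConsistent (contaminatedModel θ) Φ (fun n => n / 2) := by
  obtain ⟨c, hc, hloss⟩ := whp_contaminated_losses hΦ hs hK
  constructor
  · intro hcon
    have h1 := (hcon fun _ => 1).add (tendsto_bayes_contaminated θ fun _ => 1).1
    simp only [sub_add_cancel, add_zero] at h1
    have h2 := eventually_le_expect_of_whp (θ := θ) (f := fun n ω => recallLoss (Φ n)
      (firstGraph ω) (attackedGraph ω) 1 (firstBlock ω) (n / 2))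
      (fun n ω => recallLoss_nonneg _ _ _ _ _ _) hc
      (hloss.mono (Eventually.of_forall fun n ω h => h.1))
    have h3 : c / 2 ≤ 0 := ge_of_tendsto h1 h2
    linarith
  · intro hcon
    have h1 := (hcon fun _ => 1).add (tendsto_bayes_contaminated θ fun _ => 1).2
    simp only [sub_add_cancel, add_zero] at h1
    have h2 := eventually_le_expect_of_whp (θ := θ) (f := fun n ω => precisionLoss (Φ n)
      (firstGraph ω) (attackedGraph ω) 1 (firstBlock ω) (n / 2))
      (fun n ω => precisionLoss_nonneg _ _ _ _ _ _) hc
      (hloss.mono (Eventually.of_forall fun n ω h => h.2))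
    have h3 : c / 2 ≤ 0 := ge_of_tendsto h1 h2
    linarith

end Spectral

end VertexNomination

theorem mainTheorem4 (θ : VertexNomination.Params)
    (Khat : ∀ n : ℕ, SimpleGraph (Fin n) → ℕ)
    (Φ : ∀ n : ℕ, VertexNomination.RankingRule n)
    (hΦ : ∀ n : ℕ, 0 < n → VertexNomination.IsSpectralRule (Khat n) (Φ n))
    (hK_clean : Tendsto
      (fun n => (VertexNomination.cleanModel θ n).prob
        fun ω => Khat n ((VertexNomination.cleanModel θ n).G₂ ω) = 2) atTop (𝓝 1))
    (hK_cont : Tendsto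
      (fun n => (VertexNomination.contaminatedModel θ n).prob
        fun ω => Khat n ((VertexNomination.contaminatedModel θ n).G₂ ω) = 6) atTop (𝓝 1))
    (h : θ.p - θ.q < θ.sMinus ∨ (θ.p - θ.q) / (1 - θ.q) < θ.sPlus) :
    (VertexNomination.RecallConsistent (VertexNomination.cleanModel θ) Φ (fun n => n / 2) ∧
      VertexNomination.PrecisionConsistent (VertexNomination.cleanModel θ) Φ (fun n => n / 2)) ∧
    ¬ VertexNomination.RecallConsistent (VertexNomination.contaminatedModel θ) Φ
        (fun n => n / 2) ∧
    ¬ VertexNomination.PrecisionConsistent (VertexNomination.contaminatedModel θ) Φ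
        (fun n => n / 2) := by
  have hqp := θ.q_lt_p
  have hp := θ.p_le_one
  -- Either alternative bounds a rate below by a nonnegative number; a positive rate is what
  -- separates the six types.
  have hs : 0 < θ.sPlus ∨ 0 < θ.sMinus := by
    rcases h with h | h
    · exact Or.inr (by linarith)
    · exact Or.inl (lt_of_le_of_lt (div_nonneg (by linarith) (by linarith)) h)
  exact ⟨VertexNomination.clean_consistent hΦ (VertexNomination.whp_of_tendsto_prob hK_clean),
    VertexNomination.contaminated_not_consistent hΦ hs
      (VertexNomination.whp_of_tendsto_prob hK_cont)⟩
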